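/- **Definitions.** $\cong$ denotes isomorphism of topological groups. A *Polish ultrametric space* is a (nonempty) ultrametric space whose metric is complete and induces a second-countable topology; it is *uniformly discrete* if for some $r>0$ all open balls of radius $r$ are singletons. $\operatorname{Iso}(U)$ carries the topology of pointwise convergence. "Countable" means finite or countably infinite. For a set $X$, $\operatorname{Sym}(X)$ carries the topology of pointwise convergence with respect to the discrete topology on $X$, and subgroups carry the relative topology. *Trees.* Let $L$ be a linear order. A *weak $L$-tree* $\mathcal T=(T,\le_T,\lambda_T)$ is a partial order $(T,\le_T)$ with a surjection $\lambda_T\colon T\to L$ such that: $t<_Tt'$ implies $\lambda_T(t)<\lambda_T(t')$; for each $t\in T$ and $\ell\ge\lambda_T(t)$ there is a unique $t|_\ell\ge_T t$ with $\lambda_T(t|_\ell)=\ell$; for all $t,t'\in T$ there is $\ell\ge\max\{\lambda_T(t),\lambda_T(t')\}$ with $t|_\ell=t'|_\ell$. It is an *$L$-tree* if moreover for all $\le_T$-incomparable $t,t'$ the set $\{\ell\ge\max\{\lambda_T(t),\lambda_T(t')\} : t|_\ell\ne t'|_\ell\}$ has a maximum. It is *countable* if $T$ is, and *pruned* if for every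 $t\in T$ there is $b\colon L\to T$ with $\lambda_T(b(\ell))=\ell$ for all $\ell$, $b(\ell)\le_T b(\ell')$ whenever $\ell\le\ell'$, and $b(\lambda_T(t))=t$. $\operatorname{Aut}(\mathcal T)\le\operatorname{Sym}(T)$ is the group of order-automorphisms of $T$ preserving $\lambda_T$. The *condensed tree* $\Delta(\mathcal T)$ is the weak $L$-tree of all $\operatorname{Aut}(\mathcal T)$-orbits $[t]$, with level $\lambda_T(t)$ and with $\delta\le\delta'$ iff $t\le_T t'$ for some $t\in\delta$, $t'\in\delta'$. An $L$-tree $\mathcal T$ is *special* if $\Delta(\mathcal T)$ is an $L$-tree. *Skeletons.* A *countable skeleton* $\langle\Delta,N\rangle$ is a nonempty countable partial order $\Delta$ with cardinals $1\le N_\delta\le\omega$ ($\delta\in\Delta$), where $N_\delta$ is identified with the set of natural numbers less than $N_\delta$. It is *treeable* if for some linear order $L$ and some map $\lambda\colon\Delta\to L$, $(\Delta,\le,\lambda)$ is a pruned $L$-tree. For $z\in\prod_{\gamma\ge\delta}N_\gamma$, $\gamma\ge\delta$ and $i\in N_\delta$ let $z|_\gamma$ be the restriction of $z$ to $\{\beta:\beta\ge\gamma\}$,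 and let $z^\delta_i$ be $z$ with its value at $\delta$ changed to $i$. For $\mathbf S\subseteq\bigcup_{\delta}\prod_{\gamma\ge\delta}N_\gamma$ put $\mathbf S_\delta=\mathbf S\cap\prod_{\gamma\ge\delta}N_\gamma$. For $x\in\prod_{\delta\in\Delta}N_\delta$ put $\operatorname{supp}(x)=\{\delta : x(\delta)\neq0\}$. Let $\mathbf S^{\rm LF}$ (respectively $\mathbf S^{\rm Max}$) be the set of all $x|_\delta$ with $\delta\in\Delta$ and $x\in\prod_{\delta\in\Delta} N_\delta$ such that $\operatorname{supp}(x)\cap\{\gamma:\gamma\ge\beta\}$ is finite for every $\beta\in\Delta$ (respectively such that every nonempty subset of $\operatorname{supp}(x)$ has a maximal element). *Wreath products.* A *system of projections* $\langle\mathbf S,\boldsymbol\pi\rangle$ over $\langle\Delta,N\rangle$ consists of $\mathbf S$ as above with all $\mathbf S_\delta\neq\emptyset$ and with $z^\delta_i\in\mathbf S_\delta$ for all $z\in\mathbf S_\delta$ and $i\in N_\delta$, together with surjections $\pi_{\delta\gamma}\colon\mathbf S_\delta\to\mathbf S_\gamma$ ($\gamma\ge\delta$) such that $\pi_{\delta\gamma}(z)=\pi_{\delta\gamma}(z')\iff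 z|_\gamma=z'|_\gamma$, and $\pi_{\gamma\beta}\circ\pi_{\delta\gamma}=\pi_{\delta\beta}$ for $\beta\ge\gamma\ge\delta$. It is *countable* if $\mathbf S$ is. The *projective wreath product* $\operatorname{Wr}^{\mathbf S,\boldsymbol\pi}_{\delta\in\Delta}\operatorname{Sym}(N_\delta)$ is the group of all $g\in\operatorname{Sym}(\mathbf S)$ such that, for all $\gamma\ge\delta$ and $z\in\mathbf S_\delta$, $g(\mathbf S_\delta)=\mathbf S_\delta$, $g(\pi_{\delta\gamma}(z))=\pi_{\delta\gamma}(g(z))$, and $i\mapsto g(z^\delta_i)(\delta)$ is a permutation of $N_\delta$. The system is *locally homogeneous* if this group acts transitively on each $\mathbf S_\delta$; it has *finite character* if every cone $\{\gamma:\gamma\ge\delta\}$ can be partitioned into finitely many convex sets $C_0,\dots,C_n$ such that $\pi_{\gamma\beta}(z)=z|_\beta$ whenever $\gamma\le\beta$ lie in the same $C_i$ and $z\in\mathbf S_\gamma$. A *family of local domains* is a set $\mathbf S$ which together with the restriction maps $\pi_{\delta\gamma}(z)=z|_\gamma$ is a system of projections; its projective wreath product is then denoted $\operatorname{Wr}^{\mathbf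 S}_{\delta\in\Delta}\operatorname{Sym}(N_\delta)$. **Theorem.** For every topological group $G$ the following are equivalent: 1. $G\cong\operatorname{Iso}(U)$ for some Polish ultrametric space $U$; 2. $G\cong\operatorname{Iso}(U)$ for some perfect locally compact Polish ultrametric space $U$; 3. $G\cong\operatorname{Iso}(U)$ for some uniformly discrete Polish ultrametric space $U$; 4. $G\cong\operatorname{Aut}(\mathcal T)$ for some linear order $L$ and some countable pruned $L$-tree $\mathcal T$; 5. $G\cong\operatorname{Aut}(\mathcal T)$ for some linear order $L$ with a minimum and some countable pruned special $L$-tree $\mathcal T$; 6. $G\cong\operatorname{Aut}(\mathcal T)$ for some countable pruned special $\mathbb Q$-tree $\mathcal T$; 7. $G\cong\operatorname{Wr}^{\mathbf S^{\rm LF},\boldsymbol\pi}_{\delta\in\Delta}\operatorname{Sym}(N_\delta)$ for some countable treeable skeleton $\langle\Delta,N\rangle$ and some locally homogeneous system of projections $\langle\mathbf S^{\rm LF},\boldsymbol\pi\rangle$ of finite character; 8. $G\cong\operatorname{Wr}^{\mathbf S}_{\delta\in\Delta}\operatorname{Sym}(N_\delta)$ for some countable treeable skeleton $\langle\Delta,N\rangle$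 and some countable family of local domains $\mathbf S\subseteq\mathbf S^{\rm Max}$; 9. $G\cong\operatorname{Wr}^{\mathbf S,\boldsymbol\pi}_{\delta\in\Delta}\operatorname{Sym}(N_\delta)$ for some countable treeable skeleton $\langle\Delta,N\rangle$ and some countable system of projections $\langle\mathbf S,\boldsymbol\pi\rangle$ with $\mathbf S\subseteq\mathbf S^{\rm Max}$. -/

import Mathlib

/-! ## Topologies of pointwise convergence -/

/-- `Sym(X)` with the topology of pointwise convergence with respect to the discrete topology
on `X`. -/
instance permPointwiseTopology (X : Type*) : TopologicalSpace (Equiv.Perm X) :=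
  TopologicalSpace.induced (fun (f : Equiv.Perm X) (x : X) => f x)
    (@Pi.topologicalSpace X (fun _ => X) (fun _ => ⊥))

/-- `Iso(U)` with the topology of pointwise convergence (with respect to the metric topology
of `U`). -/
instance isoPointwiseTopology (U : Type*) [MetricSpace U] : TopologicalSpace (U ≃ᵢ U) :=
  TopologicalSpace.induced (fun (f : U ≃ᵢ U) (x : U) => f x) inferInstance

/-! ## Ultrametric spaces -/

/-- A (nonempty) Polish ultrametric space: the given metric is a complete ultrametric and induces
a second-countable topology. -/
structure IsPolishUltrametric (U : Type*) [MetricSpace U] : Prop where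
  nonempty : Nonempty U
  ultrametric : IsUltrametricDist U
  complete : CompleteSpace U
  secondCountable : SecondCountableTopology U

/-- Some fixed radius `r > 0` isolates every point. -/
def IsUniformlyDiscrete (U : Type*) [MetricSpace U] : Prop :=
  ∃ r : ℝ, 0 < r ∧ ∀ x : U, Metric.ball x r = {x}

/-! ## Weak `L`-trees and `L`-trees -/

/-- A weak `L`-tree structure on the partial order `T`. Nodes `t` with `t ≤ s` and `lam s = ℓ`
determine `s = t|_ℓ`, so `t|_ℓ = u|_ℓ` is expressed by a common upper bound of level `ℓ`. -/
structure WeakLTree (L T : Type*) [LinearOrder L] [PartialOrder T] where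
  lam : T → L
  lam_surjective : Function.Surjective lam
  lam_lt : ∀ t u : T, t < u → lam t < lam u
  existsUnique_above : ∀ (t : T) (ℓ : L), lam t ≤ ℓ → ∃! s : T, t ≤ s ∧ lam s = ℓ
  exists_common : ∀ t u : T, ∃ ℓ : L, lam t ≤ ℓ ∧ lam u ≤ ℓ ∧ ∃ s : T, t ≤ s ∧ u ≤ s ∧ lam s = ℓ

namespace WeakLTree

variable {L T : Type*} [LinearOrder L] [PartialOrder T]

/-- `t|_ℓ = u|_ℓ` (for `ℓ` above the levels of `t` and `u`). -/
def AgreeAt (𝒯 : WeakLTree L T) (t u : T) (ℓ : L) : Prop :=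
  ∃ s : T, t ≤ s ∧ u ≤ s ∧ 𝒯.lam s = ℓ

/-- A weak `L`-tree is an `L`-tree if for incomparable `t, u` the set of levels at which
`t|_ℓ ≠ u|_ℓ` has a maximum. -/
def IsLTree (𝒯 : WeakLTree L T) : Prop :=
  ∀ t u : T, ¬ t ≤ u → ¬ u ≤ t →
    ∃ m : L, IsGreatest {ℓ : L | 𝒯.lam t ≤ ℓ ∧ 𝒯.lam u ≤ ℓ ∧ ¬ 𝒯.AgreeAt t u ℓ} m

/-- Branches of a weak `L`-tree. -/
def IsBranch (𝒯 : WeakLTree L T) (b : L → T) : Prop :=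
  (∀ ℓ, 𝒯.lam (b ℓ) = ℓ) ∧ ∀ ℓ ℓ', ℓ ≤ ℓ' → b ℓ ≤ b ℓ'

/-- Every node lies on a branch. -/
def IsPruned (𝒯 : WeakLTree L T) : Prop :=
  ∀ t : T, ∃ b : L → T, 𝒯.IsBranch b ∧ b (𝒯.lam t) = t

/-- The automorphism group `Aut(𝒯)`, with the topology inherited from `Sym(T)`. -/
def aut (𝒯 : WeakLTree L T) : Subgroup (Equiv.Perm T) where
  carrier := {f | (∀ t, 𝒯.lam (f t) = 𝒯.lam t) ∧ ∀ t u, t ≤ u ↔ f t ≤ f u}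
  mul_mem' := by
    rintro f g ⟨hf, hf'⟩ ⟨hg, hg'⟩
    exact ⟨fun t => by rw [Equiv.Perm.mul_apply, hf, hg],
      fun t u => by rw [Equiv.Perm.mul_apply, Equiv.Perm.mul_apply, ← hf', ← hg']⟩
  one_mem' := ⟨fun _ => rfl, fun _ _ => Iff.rfl⟩
  inv_mem' := by
    rintro f ⟨hf, hf'⟩
    exact ⟨fun t => by simpa using (hf (f⁻¹ t)).symm,
      fun t u => by simpa using (hf' (f⁻¹ t) (f⁻¹ u)).symm⟩

/-- `t ∼ u` iff some automorphism sends `t` to `u`. -/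
def orbitSetoid (𝒯 : WeakLTree L T) : Setoid T where
  r t u := ∃ f ∈ 𝒯.aut, f t = u
  iseqv :=
    { refl := fun _ => ⟨1, 𝒯.aut.one_mem, rfl⟩
      symm := by
        rintro t u ⟨f, hf, rfl⟩
        exact ⟨f⁻¹, 𝒯.aut.inv_mem hf, by simp⟩
      trans := by
        rintro t u v ⟨f, hf, rfl⟩ ⟨g, hg, rfl⟩
        exact ⟨g * f, 𝒯.aut.mul_mem hg hf, rfl⟩ }

/-- The set of orbits. -/
def Condensed (𝒯 : WeakLTree L T) : Type _ := Quotient 𝒯.orbitSetoid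

/-- The orbit `[t]`. -/
def orb (𝒯 : WeakLTree L T) (t : T) : 𝒯.Condensed := Quotient.mk 𝒯.orbitSetoid t

theorem orb_eq_iff (𝒯 : WeakLTree L T) {t u : T} :
    𝒯.orb t = 𝒯.orb u ↔ ∃ f ∈ 𝒯.aut, f t = u :=
  ⟨fun h => Quotient.exact h, fun h => Quotient.sound h⟩

theorem exists_orb (𝒯 : WeakLTree L T) (δ : 𝒯.Condensed) : ∃ t, 𝒯.orb t = δ :=
  Quotient.exists_rep δ

/-- The level of an orbit. -/
def condensedLam (𝒯 : WeakLTree L T) : 𝒯.Condensed → L :=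
  Quotient.lift 𝒯.lam (by
    rintro t u ⟨f, hf, rfl⟩
    exact (hf.1 t).symm)

theorem condensedLam_orb (𝒯 : WeakLTree L T) (t : T) : 𝒯.condensedLam (𝒯.orb t) = 𝒯.lam t := rfl

theorem lam_mono (𝒯 : WeakLTree L T) {t u : T} (h : t ≤ u) : 𝒯.lam t ≤ 𝒯.lam u := by
  rcases h.eq_or_lt with rfl | h
  · exact le_rfl
  · exact (𝒯.lam_lt _ _ h).le

/-- `δ ≤ ε` iff `t ≤ u` for some `t ∈ δ` and `u ∈ ε`. -/
def condensedLE (𝒯 : WeakLTree L T) (δ ε : 𝒯.Condensed) : Prop :=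
  ∃ t u : T, 𝒯.orb t = δ ∧ 𝒯.orb u = ε ∧ t ≤ u

/-- In the definition of the order between orbits the lower representative is arbitrary. -/
theorem condensedLE_orb (𝒯 : WeakLTree L T) {t : T} {ε : 𝒯.Condensed} :
    𝒯.condensedLE (𝒯.orb t) ε ↔ ∃ u : T, 𝒯.orb u = ε ∧ t ≤ u := by
  constructor
  · rintro ⟨t₁, u, ht, rfl, htu⟩
    obtain ⟨f, hf, rfl⟩ := 𝒯.orb_eq_iff.1 ht
    exact ⟨f u, (𝒯.orb_eq_iff.2 ⟨f, hf, rfl⟩).symm, (hf.2 _ _).1 htu⟩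
  · rintro ⟨u, hu, htu⟩
    exact ⟨t, u, rfl, hu, htu⟩

instance condensedOrder (𝒯 : WeakLTree L T) : PartialOrder 𝒯.Condensed where
  le := 𝒯.condensedLE
  le_refl δ := by
    obtain ⟨t, rfl⟩ := 𝒯.exists_orb δ
    exact ⟨t, t, rfl, rfl, le_rfl⟩
  le_trans δ ε ζ h₁ h₂ := by
    obtain ⟨t, rfl⟩ := 𝒯.exists_orb δ
    obtain ⟨u, rfl, htu⟩ := 𝒯.condensedLE_orb.1 h₁
    obtain ⟨v, hv, huv⟩ := 𝒯.condensedLE_orb.1 h₂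
    exact ⟨t, v, rfl, hv, htu.trans huv⟩
  le_antisymm δ ε h₁ h₂ := by
    obtain ⟨t, rfl⟩ := 𝒯.exists_orb δ
    obtain ⟨u, rfl, htu⟩ := 𝒯.condensedLE_orb.1 h₁
    obtain ⟨v, hv, huv⟩ := 𝒯.condensedLE_orb.1 h₂
    rcases htu.eq_or_lt with rfl | htu
    · rfl
    · have h := (𝒯.lam_lt _ _ htu).trans_le (𝒯.lam_mono huv)
      rw [← 𝒯.condensedLam_orb v, hv, 𝒯.condensedLam_orb t] at h
      exact absurd h (lt_irrefl _)

/-- The condensed tree `Δ(𝒯)`. -/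
def condensed (𝒯 : WeakLTree L T) : WeakLTree L 𝒯.Condensed where
  lam := 𝒯.condensedLam
  lam_surjective ℓ := by
    obtain ⟨t, rfl⟩ := 𝒯.lam_surjective ℓ
    exact ⟨𝒯.orb t, rfl⟩
  lam_lt δ ε h := by
    obtain ⟨t, rfl⟩ := 𝒯.exists_orb δ
    obtain ⟨u, rfl, htu⟩ := 𝒯.condensedLE_orb.1 h.le
    rcases htu.eq_or_lt with rfl | htu
    · exact absurd h (lt_irrefl _)
    · exact 𝒯.lam_lt _ _ htu
  existsUnique_above δ ℓ hℓ := by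
    obtain ⟨t, rfl⟩ := 𝒯.exists_orb δ
    obtain ⟨s, ⟨hs, rfl⟩, hu⟩ := 𝒯.existsUnique_above t ℓ hℓ
    refine ⟨𝒯.orb s, ⟨𝒯.condensedLE_orb.2 ⟨s, rfl, hs⟩, rfl⟩, ?_⟩
    rintro ε ⟨h, hε⟩
    obtain ⟨v, rfl, htv⟩ := 𝒯.condensedLE_orb.1 h
    rw [hu v ⟨htv, hε⟩]
  exists_common δ ε := by
    obtain ⟨t, rfl⟩ := 𝒯.exists_orb δ
    obtain ⟨u, rfl⟩ := 𝒯.exists_orb ε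
    obtain ⟨ℓ, h₁, h₂, s, hts, hus, hs⟩ := 𝒯.exists_common t u
    exact ⟨ℓ, h₁, h₂, 𝒯.orb s, 𝒯.condensedLE_orb.2 ⟨s, rfl, hts⟩,
      𝒯.condensedLE_orb.2 ⟨s, rfl, hus⟩, hs⟩

/-- An `L`-tree is special if its condensed tree is still an `L`-tree. -/
def IsSpecial (𝒯 : WeakLTree L T) : Prop := 𝒯.condensed.IsLTree

end WeakLTree

/-! ## Skeletons and generalized sequences -/

/-- The cardinal `n ≤ ω` as the set `{i | i < n}` of smaller natural numbers. -/
abbrev Label (n : ℕ∞) : Type := {i : ℕ // (i : ℕ∞) < n}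

/-- `⟨Δ, N⟩` is a countable treeable skeleton: `Δ` is a nonempty countable partial order, the labels
`N δ ≤ ω` are nonzero, and `Δ` carries the structure of a pruned `L`-tree for some linear
order `L`. (Since `Δ` is countable and maps onto `L`, it is enough to consider `L : Type`.) -/
structure IsCountableTreeableSkeleton (Δ : Type*) [PartialOrder Δ] (N : Δ → ℕ∞) : Prop where
  nonempty : Nonempty Δ
  countable : Countable Δ
  label_ne_zero : ∀ δ, N δ ≠ 0
  treeable : ∃ (L : Type) (_ : LinearOrder L) (𝒯 : WeakLTree L Δ), 𝒯.IsLTree ∧ 𝒯.IsPruned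

section Sequences

variable {Δ : Type*} [PartialOrder Δ]

/-- The product of the `N γ` over all `γ ≥ δ`. -/
abbrev LocSeq (N : Δ → ℕ∞) (δ : Δ) : Type _ := (γ : {γ : Δ // δ ≤ γ}) → Label (N γ.1)

/-- The restriction `z|_γ`, for `γ ≥ δ`. -/
def LocSeq.restrict {N : Δ → ℕ∞} {δ γ : Δ} (h : δ ≤ γ) (z : LocSeq N δ) : LocSeq N γ :=
  fun β => z ⟨β.1, h.trans β.2⟩

open Classical in
/-- `z^δ_i`: the sequence `z` with its value at `δ` replaced by `i`. -/
noncomputable def LocSeq.perturb {N : Δ → ℕ∞} {δ : Δ} (z : LocSeq N δ) (i : Label (N δ)) :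
    LocSeq N δ :=
  Function.update z ⟨δ, le_rfl⟩ i

/-- The support of a global sequence. -/
def seqSupport {N : Δ → ℕ∞} (x : (γ : Δ) → Label (N γ)) : Set Δ := {γ | (x γ).1 ≠ 0}

/-- For a family `A` of admissible supports, the set of all `x|_δ` with `supp x ∈ A`. -/
def admissibleLocal (N : Δ → ℕ∞) (A : Set (Set Δ)) (δ : Δ) : Set (LocSeq N δ) :=
  {z | ∃ x : (γ : Δ) → Label (N γ), seqSupport x ∈ A ∧ ∀ γ, z γ = x γ.1}

/-- Locally finite supports. -/
def suppLF (Δ : Type*) [PartialOrder Δ] : Set (Set Δ) :=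
  {A | ∀ δ : Δ, (A ∩ Set.Ici δ).Finite}

/-- Supports with the maximum condition: every nonempty subset has a maximal element. -/
def suppMax (Δ : Type*) [PartialOrder Δ] : Set (Set Δ) :=
  {A | ∀ B ⊆ A, B.Nonempty → ∃ m, Maximal (· ∈ B) m}

end Sequences

/-! ## Projective wreath products -/

/-- A system of projections over `⟨Δ, N⟩`. A set of generalized sequences is given by its
parts `S δ`, consisting of the members with domain `{γ | γ ≥ δ}`. -/
structure ProjSystem {Δ : Type*} [PartialOrder Δ] (N : Δ → ℕ∞) where
  S : (δ : Δ) → Set (LocSeq N δ)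
  nonempty : ∀ δ, (S δ).Nonempty
  perturb_mem : ∀ (δ : Δ) (z : LocSeq N δ), z ∈ S δ → ∀ i : Label (N δ), z.perturb i ∈ S δ
  proj : ∀ {δ γ : Δ}, δ ≤ γ → S δ → S γ
  proj_surjective : ∀ {δ γ : Δ} (h : δ ≤ γ), Function.Surjective (proj h)
  proj_eq_iff : ∀ {δ γ : Δ} (h : δ ≤ γ) (z w : S δ),
    proj h z = proj h w ↔ z.1.restrict h = w.1.restrict h
  proj_comp : ∀ {δ γ β : Δ} (h₁ : δ ≤ γ) (h₂ : γ ≤ β) (z : S δ),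
    proj h₂ (proj h₁ z) = proj (h₁.trans h₂) z

namespace ProjSystem

variable {Δ : Type*} [PartialOrder Δ] {N : Δ → ℕ∞}

/-- The (disjoint) union of all `S δ`. -/
abbrev Point (P : ProjSystem N) : Type _ := (δ : Δ) × P.S δ

/-- `π_{δγ}(z)`, as an element of the union, where `z ∈ S δ`. -/
def up (P : ProjSystem N) (p : P.Point) {γ : Δ} (h : p.1 ≤ γ) : P.Point := ⟨γ, P.proj h p.2⟩

/-- `z^δ_i`, as an element of the union, where `z ∈ S δ`. -/
noncomputable def pert (P : ProjSystem N) (p : P.Point) (i : Label (N p.1)) : P.Point :=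
  ⟨p.1, p.2.1.perturb i, P.perturb_mem _ _ p.2.2 i⟩

/-- First condition on the elements of the wreath product: `g` maps each `S δ` to itself and
commutes with the projections. -/
def PreservesProj (P : ProjSystem N) (g : Equiv.Perm P.Point) : Prop :=
  (∀ p, (g p).1 = p.1) ∧
    ∀ (p : P.Point) (γ : Δ) (h : p.1 ≤ γ) (h' : (g p).1 ≤ γ), g (P.up p h) = P.up (g p) h'

/-- Second condition on the elements of the wreath product: for `z ∈ S δ` the map
`i ↦ g(z^δ_i)(δ)` is a permutation of `N δ` that belongs to `H δ`. (The hypothesis `h` only serves to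
form the value at `δ`; it holds for all `g` that map each `S δ` to itself.) -/
def ActsThrough (P : ProjSystem N) (H : (δ : Δ) → Subgroup (Equiv.Perm (Label (N δ))))
    (g : Equiv.Perm P.Point) : Prop :=
  ∀ p : P.Point, ∃ σ ∈ H p.1, ∀ (i : Label (N p.1)) (h : (g (P.pert p i)).1 ≤ p.1),
    (g (P.pert p i)).2.1 ⟨p.1, h⟩ = σ i

theorem point_ext (P : ProjSystem N) {δ : Δ} {z w : P.S δ} (h₀ : z.1 ⟨δ, le_rfl⟩ = w.1 ⟨δ, le_rfl⟩)
    (h : ∀ γ, ∀ h : δ < γ, z.1.restrict h.le = w.1.restrict h.le) : z = w := by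
  apply Subtype.ext
  funext γ
  obtain ⟨γ, hγ⟩ := γ
  rcases (show δ ≤ γ from hγ).eq_or_lt with rfl | hlt
  · exact h₀
  · exact congrFun (h γ hlt) ⟨γ, le_rfl⟩

open Classical in
theorem pert_restrict {δ γ : Δ} (z : LocSeq N δ) (i : Label (N δ)) (h : δ < γ) :
    (z.perturb i).restrict h.le = z.restrict h.le := by
  funext β
  refine Function.update_of_ne ?_ _ _
  intro hb
  have hb' : β.1 = δ := congrArg Subtype.val hb
  exact absurd (h.trans_le β.2) (by rw [hb']; exact lt_irrefl _)

open Classical in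
theorem pert_self {δ : Δ} (z : LocSeq N δ) (i : Label (N δ)) :
    z.perturb i ⟨δ, le_rfl⟩ = i := Function.update_self ..

theorem exists_map_eq (P : ProjSystem N) {g : Equiv.Perm P.Point} (hg : P.PreservesProj g)
    {δ : Δ} (z : P.S δ) : ∃ w : P.S δ, g ⟨δ, z⟩ = ⟨δ, w⟩ := by
  have h := hg.1 ⟨δ, z⟩
  rcases hq : g ⟨δ, z⟩ with ⟨ε, v⟩
  rw [hq] at h
  obtain rfl : ε = δ := h
  exact ⟨v, rfl⟩

theorem PreservesProj.mul {P : ProjSystem N} {g k : Equiv.Perm P.Point} (hg : P.PreservesProj g)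
    (hk : P.PreservesProj k) : P.PreservesProj (g * k) := by
  refine ⟨fun p => (hg.1 (k p)).trans (hk.1 p), fun p γ h h' => ?_⟩
  have h₁ : (k p).1 ≤ γ := (hk.1 p).trans_le h
  rw [Equiv.Perm.mul_apply, hk.2 p γ h h₁]
  exact hg.2 (k p) γ h₁ h'

theorem PreservesProj.inv {P : ProjSystem N} {g : Equiv.Perm P.Point} (hg : P.PreservesProj g) :
    P.PreservesProj g⁻¹ := by
  constructor
  · intro p
    obtain ⟨q, rfl⟩ := g.surjective p
    simpa using (hg.1 q).symm
  · intro p γ h h'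
    obtain ⟨q, rfl⟩ := g.surjective p
    have hq : q.1 ≤ γ := (hg.1 q).symm.trans_le h
    rw [← hg.2 q γ hq h]
    simp

/-- An element of the wreath product sends `z^δ_i` to `g(z)^δ_j`, where `j` is its value at `δ`. -/
theorem map_pert (P : ProjSystem N) {g : Equiv.Perm P.Point} (hg : P.PreservesProj g)
    {δ : Δ} {z w : P.S δ} (hzw : g ⟨δ, z⟩ = ⟨δ, w⟩) (i j : Label (N δ))
    (hj : ∀ h : (g (P.pert ⟨δ, z⟩ i)).1 ≤ δ, (g (P.pert ⟨δ, z⟩ i)).2.1 ⟨δ, h⟩ = j) :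
    g (P.pert ⟨δ, z⟩ i) = P.pert ⟨δ, w⟩ j := by
  obtain ⟨v, hv⟩ := P.exists_map_eq hg (P.pert ⟨δ, z⟩ i).2
  change g (P.pert ⟨δ, z⟩ i) = ⟨δ, v⟩ at hv
  rw [hv] at hj ⊢
  have hj' := hj le_rfl
  have : v = ⟨w.1.perturb j, P.perturb_mem _ _ w.2 j⟩ := by
    refine P.point_ext (hj'.trans (pert_self w.1 j).symm) fun γ h => ?_
    have e₁ := hg.2 (P.pert ⟨δ, z⟩ i) γ h.le (by rw [hv]; exact h.le)
    have e₂ := hg.2 ⟨δ, z⟩ γ h.le (by rw [hzw]; exact h.le)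
    have e₃ : P.up (P.pert ⟨δ, z⟩ i) (γ := γ) h.le = P.up ⟨δ, z⟩ (γ := γ) h.le :=
      congrArg (Sigma.mk γ) ((P.proj_eq_iff h.le _ _).2 (pert_restrict z.1 i h))
    have e₄ : P.proj h.le v = P.proj h.le w := by
      have e₅ : P.up ⟨δ, v⟩ (γ := γ) h.le = P.up ⟨δ, w⟩ (γ := γ) h.le := by
        rw [e₃, e₂] at e₁
        simp only [hv, hzw] at e₁
        exact e₁.symm
      exact eq_of_heq (Sigma.mk.inj e₅).2
    rw [(P.proj_eq_iff h.le v w).1 e₄]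
    exact (pert_restrict w.1 j h).symm
  rw [this]
  rfl

/-- The projective wreath product of the permutation groups `H δ`, with the topology inherited from
the symmetric group of the union of all `S δ`. -/
def wr (P : ProjSystem N) (H : (δ : Δ) → Subgroup (Equiv.Perm (Label (N δ)))) :
    Subgroup (Equiv.Perm P.Point) where
  carrier := {g | P.PreservesProj g ∧ P.ActsThrough H g}
  mul_mem' := by
    rintro g k ⟨hg, hg'⟩ ⟨hk, hk'⟩
    refine ⟨hg.mul hk, ?_⟩
    rintro ⟨δ, z⟩
    obtain ⟨w, hw⟩ := P.exists_map_eq hk z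
    obtain ⟨σ, hσ, hσ'⟩ := hk' ⟨δ, z⟩
    obtain ⟨τ, hτ, hτ'⟩ := hg' ⟨δ, w⟩
    refine ⟨τ * σ, mul_mem hτ hσ, fun i => ?_⟩
    rw [Equiv.Perm.mul_apply, P.map_pert hk hw i (σ i) (hσ' i)]
    exact hτ' (σ i)
  one_mem' :=
    ⟨⟨fun _ => rfl, fun _ _ _ _ => rfl⟩,
      fun p => ⟨1, one_mem _, fun i _ => pert_self p.2.1 i⟩⟩
  inv_mem' := by
    rintro g ⟨hg, hg'⟩
    refine ⟨hg.inv, ?_⟩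
    rintro ⟨δ, z⟩
    obtain ⟨w, hw⟩ := P.exists_map_eq hg.inv z
    obtain ⟨σ, hσ, hσ'⟩ := hg' ⟨δ, w⟩
    have hw' : g ⟨δ, w⟩ = ⟨δ, z⟩ := by rw [← hw]; simp
    refine ⟨σ⁻¹, inv_mem hσ, fun i => ?_⟩
    have e := P.map_pert hg hw' (σ⁻¹ i) (σ (σ⁻¹ i)) (hσ' (σ⁻¹ i))
    have e' : g⁻¹ (P.pert ⟨δ, z⟩ i) = P.pert ⟨δ, w⟩ (σ⁻¹ i) := by
      rw [Equiv.Perm.inv_eq_iff_eq, e]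
      simp
    rw [e']
    exact fun _ => pert_self w.1 (σ⁻¹ i)

/-- The projective wreath product of the full symmetric groups `Sym(N δ)`. -/
abbrev wrSym (P : ProjSystem N) : Subgroup (Equiv.Perm P.Point) := P.wr fun _ => ⊤

/-- The projective wreath product of the groups `Sym(N δ)` acts transitively on each `S δ`. -/
def IsLocallyHomogeneous (P : ProjSystem N) : Prop :=
  ∀ (δ : Δ) (z w : P.S δ), ∃ g ∈ P.wrSym, g ⟨δ, z⟩ = ⟨δ, w⟩

/-- Every cone `{γ | γ ≥ δ}` can be partitioned into finitely many convex sets on each of which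
all projections are restrictions. -/
def HasFiniteCharacter (P : ProjSystem N) : Prop :=
  ∀ δ : Δ, ∃ (n : ℕ) (C : Fin n → Set Δ),
    (⋃ k, C k) = Set.Ici δ ∧ Pairwise (Function.onFun Disjoint C) ∧
      ∀ k, (C k).OrdConnected ∧
        ∀ γ ∈ C k, ∀ β ∈ C k, ∀ (h : γ ≤ β) (z : P.S γ), (P.proj h z).1 = z.1.restrict h

end ProjSystem

/-! ## Generalized wreath products over local domains -/

/-- A family of local domains over `⟨Δ, N⟩`. -/
structure LocalDomains {Δ : Type*} [PartialOrder Δ] (N : Δ → ℕ∞) where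
  S : (δ : Δ) → Set (LocSeq N δ)
  nonempty : ∀ δ, (S δ).Nonempty
  restrict_image : ∀ {δ γ : Δ} (h : δ ≤ γ), S γ = LocSeq.restrict h '' S δ
  perturb_mem : ∀ (δ : Δ) (z : LocSeq N δ), z ∈ S δ → ∀ i : Label (N δ), z.perturb i ∈ S δ

namespace LocalDomains

variable {Δ : Type*} [PartialOrder Δ] {N : Δ → ℕ∞}

/-- A family of local domains together with the trivial projections (restrictions). -/
def toProjSystem (D : LocalDomains N) : ProjSystem N where
  S := D.S
  nonempty := D.nonempty
  perturb_mem := D.perturb_mem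
  proj h z := ⟨z.1.restrict h, by rw [D.restrict_image h]; exact ⟨z.1, z.2, rfl⟩⟩
  proj_surjective h w := by
    obtain ⟨w, hw⟩ := w
    have hw' := hw
    rw [D.restrict_image h] at hw'
    obtain ⟨z, hz, rfl⟩ := hw'
    exact ⟨⟨z, hz⟩, rfl⟩
  proj_eq_iff h z w := Subtype.ext_iff
  proj_comp h₁ h₂ z := rfl

/-- The generalized wreath product over a family of local domains: all permutations `g` of the union
of the `S δ` that map each `S δ` to itself, satisfy `g(z|_γ) = g(z)|_γ`, and act through `H δ` on
the coordinate `δ`. -/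
abbrev wr (D : LocalDomains N) (H : (δ : Δ) → Subgroup (Equiv.Perm (Label (N δ)))) :
    Subgroup (Equiv.Perm D.toProjSystem.Point) := D.toProjSystem.wr H

/-- The generalized wreath product of the full symmetric groups `Sym(N δ)`. -/
abbrev wrSym (D : LocalDomains N) : Subgroup (Equiv.Perm D.toProjSystem.Point) :=
  D.wr fun _ => ⊤

end LocalDomains

/-! ## Continuity and isomorphism criteria -/

/-! The nine descriptions are linked by passages between ultrametric spaces and trees in both
directions, and by choices of coordinates on trees.

From a space to a tree: open balls with radii in a countable set `C` form an `L`-tree. By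
completeness an automorphism acts on points, since a branch of balls shrinks to a point; if `C`
contains all positive distances, this action is isometric. Two balls of radius `ρ` lie in one orbit
iff the infimum of the distances between isometric images of their centres is below `ρ`. Adding
these infima (`orbitDist`) to `C` therefore makes the condensed tree an `L`-tree as well.
Separability keeps `C` countable, because positive distances are locally constant. With the positive
rationals added, `C` is a copy of `ℚ`; for a uniformly discrete space it can be given a minimum
instead (`BallTree.exists_special_tree`).

From a tree to a space: every node `t` sprouts points `(t, n)`, and every level is refined into a
descending sequence of sublevels. The point `(t, n)` leaves the stem of `t` at a depth coding `n`
and a colour of `t`. Isometries see this depth, so they are exactly the colour-preserving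
automorphisms acting on the first factor (`LevelledForest.exists_uniformlyDiscrete`). Only greatest
levels of disagreement are needed, hence the construction also applies to the sequences of a
projective wreath product: the maximum condition on supports supplies the greatest disagreements,
and the colours name the coordinates `δ`. Blowing up the points to rigid Cantor sets gives the
perfect locally compact space.

From a special tree to a wreath product: the skeleton is the condensed tree, and `N δ` counts the
siblings of a node of `δ`, that is, the nodes of the same orbit with the same strict upper bounds.
Siblings are labelled so that only finitely many nonzero labels occur above any node
(`WeakLTree.exists_labelling`). The labels above a node are its coordinates, and restriction
corresponds to going up; this gives local domains. To obtain all of `S^LF`, each orbit is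
recoordinatized by back-and-forth with all finitely supported sequences. This destroys the
compatibility between orbits, which the projections absorb. If every orbit inherits its coordinates
from the orbit of least index below it, compatibility fails only finitely often along each cone,
which is finite character. -/

theorem continuous_perm_subgroup_iff {X Z : Type*} [TopologicalSpace Z]
    {H : Subgroup (Equiv.Perm X)} {φ : Z → H} :
    Continuous φ ↔ ∀ x y, IsOpen {z | (φ z : Equiv.Perm X) x = y} := by
  let _ : TopologicalSpace X := ⊥
  have : DiscreteTopology X := ⟨rfl⟩
  rw [continuous_induced_rng, continuous_induced_rng, continuous_pi_iff]
  exact forall_congr' fun x => continuous_discrete_rng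

theorem isOpen_apply_eq {X : Type*} (H : Subgroup (Equiv.Perm X)) (x y : X) :
    IsOpen {f : H | (f : Equiv.Perm X) x = y} :=
  continuous_perm_subgroup_iff.1 (continuous_id (X := H)) x y

theorem isOpen_setOf_apply_mem {U : Type*} [MetricSpace U] (x : U) {B : Set U} (hB : IsOpen B) :
    IsOpen {f : U ≃ᵢ U | f x ∈ B} :=
  hB.preimage ((continuous_apply x).comp continuous_induced_dom)

/-- Conjugation by a bijection as an isomorphism of permutation groups. -/
theorem nonempty_continuousMulEquiv_of_equiv {X Y : Type*} {H : Subgroup (Equiv.Perm X)}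
    {K : Subgroup (Equiv.Perm Y)} (e : X ≃ Y)
    (h : ∀ f : Equiv.Perm X, f ∈ H ↔ (e.symm.trans f).trans e ∈ K) : Nonempty (H ≃ₜ* K) := by
  have h' : ∀ g : Equiv.Perm Y, g ∈ K ↔ (e.trans g).trans e.symm ∈ H := fun g => by
    rw [h]
    have : (e.symm.trans ((e.trans g).trans e.symm)).trans e = g := by ext; simp
    rw [this]
  refine ⟨{ toFun := fun f => ⟨(e.symm.trans f.1).trans e, (h f.1).1 f.2⟩
            invFun := fun g => ⟨(e.trans g.1).trans e.symm, (h' g.1).1 g.2⟩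
            left_inv := fun f => by ext; simp
            right_inv := fun f => by ext; simp
            map_mul' := fun f g => by ext; simp
            continuous_toFun := ?_
            continuous_invFun := ?_ }⟩
  · refine continuous_perm_subgroup_iff.2 fun x y => ?_
    convert isOpen_apply_eq H (e.symm x) (e.symm y) using 3
    simp [Equiv.eq_symm_apply]
  · refine continuous_perm_subgroup_iff.2 fun x y => ?_
    convert isOpen_apply_eq K (e x) (e y) using 3
    simp [Equiv.symm_apply_eq]

/-! ## Uniformly discrete spaces from agreement relations -/

/-- The distance of two points only has to encode their greatest index of disagreement. A countable
linear order embeds into the interval `(1, 2)`, and since no positive distance falls below 1 the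
space is uniformly discrete, hence complete. -/
theorem exists_uniformlyDiscrete_of_agreement {Γ U : Type} [LinearOrder Γ] [Countable Γ]
    [Countable U] [Nonempty U] (R : Γ → U → U → Prop) (hrefl : ∀ g p, R g p p)
    (hsymm : ∀ g p q, R g p q → R g q p) (htrans : ∀ g p q r, R g p q → R g q r → R g p r)
    (hmono : ∀ g g' p q, g ≤ g' → R g p q → R g' p q)
    (hmax : ∀ p q, p ≠ q → ∃ g, IsGreatest {g | ¬ R g p q} g) :
    ∃ _ : MetricSpace U, IsPolishUltrametric U ∧ IsUniformlyDiscrete U ∧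
      ∀ p q p' q', dist p q = dist p' q' ↔ ∀ g, R g p q ↔ R g p' q' := by
  classical
  have : Nontrivial (Set.Ioo (1 : ℝ) 2) :=
    ⟨⟨⟨5/4, by norm_num, by norm_num⟩, ⟨3/2, by norm_num, by norm_num⟩, by
      intro h; have := congrArg Subtype.val h; norm_num at this⟩⟩
  obtain ⟨e⟩ := Order.embedding_from_countable_to_dense Γ (Set.Ioo (1 : ℝ) 2)
  choose m hm using hmax
  let d : U → U → ℝ := fun p q => if h : p = q then 0 else (e (m p q h)).1
  have hdself : ∀ p, d p p = 0 := fun p => dif_pos rfl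
  have hdne : ∀ p q (h : p ≠ q), d p q = (e (m p q h)).1 := fun p q h => dif_neg h
  have hd1 : ∀ p q, p ≠ q → 1 < d p q := fun p q h => by
    rw [hdne p q h]; exact (e (m p q h)).2.1
  -- This is the only link between metric and relations. It turns comparison of distances into
  -- inclusion of agreement sets, so symmetry and the ultrametric inequality are those of the
  -- equivalence relations `R g`.
  have hlt : ∀ g p q, d p q < (e g).1 ↔ R g p q := by
    intro g p q
    by_cases h : p = q
    · subst h
      rw [hdself]
      exact iff_of_true (zero_lt_one.trans (e g).2.1) (hrefl g p)
    · rw [hdne p q h, Subtype.coe_lt_coe, e.lt_iff_lt]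
      constructor
      · intro hg
        by_contra hR
        exact absurd ((hm p q h).2 hR) (not_le.2 hg)
      · intro hR
        by_contra hg
        exact (hm p q h).1 (hmono _ _ _ _ (not_lt.1 hg) hR)
  have hiff : ∀ p q p' q', d p q ≤ d p' q' ↔ ∀ g, R g p' q' → R g p q := by
    intro p q p' q'
    constructor
    · intro h g hR
      rw [← hlt] at hR ⊢
      exact h.trans_lt hR
    · intro h
      by_contra hlt'
      push Not at hlt'
      have hne : p ≠ q := by
        rintro rfl
        rw [hdself] at hlt'
        by_cases h' : p' = q'
        · subst h'; rw [hdself] at hlt'; exact lt_irrefl _ hlt'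
        · exact absurd (zero_lt_one.trans (hd1 _ _ h')) (not_lt.2 hlt'.le)
      rw [hdne p q hne, hlt] at hlt'
      exact (hm p q hne).1 (h _ hlt')
  have hcomm : ∀ p q, d p q = d q p := fun p q =>
    le_antisymm ((hiff _ _ _ _).2 fun g h => hsymm _ _ _ h)
      ((hiff _ _ _ _).2 fun g h => hsymm _ _ _ h)
  have hultra : ∀ p q r, d p r ≤ max (d p q) (d q r) := by
    intro p q r
    rw [le_max_iff]
    rcases le_total (d p q) (d q r) with h | h
    · right
      exact (hiff _ _ _ _).2 fun g hR => htrans g _ _ _ ((hiff _ _ _ _).1 h g hR) hR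
    · left
      exact (hiff _ _ _ _).2 fun g hR => htrans g _ _ _ hR ((hiff _ _ _ _).1 h g hR)
  have hnonneg : ∀ p q, 0 ≤ d p q := fun p q => by
    by_cases h : p = q
    · subst h; exact (hdself p).ge
    · exact (zero_lt_one.trans (hd1 p q h)).le
  let inst : MetricSpace U :=
    { dist := d
      dist_self := hdself
      dist_comm := hcomm
      dist_triangle := fun p q r => (hultra p q r).trans
        (max_le_add_of_nonneg (hnonneg _ _) (hnonneg _ _))
      eq_of_dist_eq_zero := fun {p q} h => by
        by_contra hne
        exact absurd (hd1 p q hne) (by rw [show d p q = 0 from h]; norm_num) }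
  have hball : ∀ x : U, Metric.ball x 1 = {x} := by
    intro x
    ext y
    simp only [Metric.mem_ball, Set.mem_singleton_iff]
    constructor
    · intro h
      by_contra hne
      exact absurd (hd1 y x hne) (not_lt.2 h.le)
    · rintro rfl
      simp
  have hdisc : DiscreteTopology U :=
    discreteTopology_iff_isOpen_singleton.2 fun x => hball x ▸ Metric.isOpen_ball
  refine ⟨inst, ⟨inferInstance, ⟨hultra⟩, ?_, inferInstance⟩, ⟨1, one_pos, hball⟩, ?_⟩
  · refine Metric.complete_of_cauchySeq_tendsto fun u hu => ?_
    obtain ⟨n, hn⟩ := Metric.cauchySeq_iff'.1 hu 1 one_pos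
    refine ⟨u n, tendsto_const_nhds.congr' ?_⟩
    filter_upwards [Filter.eventually_ge_atTop n] with k hk
    have : u k ∈ Metric.ball (u n) 1 := hn k hk
    rw [hball] at this
    exact this.symm
  · intro p q p' q'
    rw [le_antisymm_iff]
    change d p q ≤ d p' q' ∧ d p' q' ≤ d p q ↔ _
    rw [hiff, hiff]
    exact ⟨fun h g => ⟨h.2 g, h.1 g⟩, fun h => ⟨fun g => (h g).2, fun g => (h g).1⟩⟩

/-! ## Coloured forests -/

/-- A partial order levelled by `L` in which every node has a unique upper bound on each higher
level and any two incomparable nodes have a greatest level of disagreement. -/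
structure LevelledForest (L T : Type*) [LinearOrder L] where
  rel : T → T → Prop
  lam : T → L
  rel_refl : ∀ t, rel t t
  rel_trans : ∀ t u v, rel t u → rel u v → rel t v
  lam_mono : ∀ t u, rel t u → lam t ≤ lam u
  existsUnique_above : ∀ t ℓ, lam t ≤ ℓ → ∃! s, rel t s ∧ lam s = ℓ
  exists_greatest : ∀ t u, ¬ rel t u → ¬ rel u t →
    ∃ m, IsGreatest {ℓ | lam t ≤ ℓ ∧ lam u ≤ ℓ ∧ ¬ ∃ s, rel t s ∧ rel u s ∧ lam s = ℓ} m

namespace LevelledForest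

variable {L T : Type} [LinearOrder L] (F : LevelledForest L T) (κ : T → ℕ)

/-- The automorphisms that preserve the levels and the colouring `κ`. -/
def colouredAut : Subgroup (Equiv.Perm T) where
  carrier := {f | (∀ t, F.lam (f t) = F.lam t ∧ κ (f t) = κ t) ∧
    ∀ t u, F.rel t u ↔ F.rel (f t) (f u)}
  mul_mem' := by
    rintro f g ⟨hf, hf'⟩ ⟨hg, hg'⟩
    exact ⟨fun t => ⟨(hf _).1.trans (hg _).1, (hf _).2.trans (hg _).2⟩,
      fun t u => (hg' _ _).trans (hf' _ _)⟩
  one_mem' := ⟨fun _ => ⟨rfl, rfl⟩, fun _ _ => Iff.rfl⟩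
  inv_mem' := by
    rintro f ⟨hf, hf'⟩
    exact ⟨fun t => ⟨by simpa using (hf (f⁻¹ t)).1.symm, by simpa using (hf (f⁻¹ t)).2.symm⟩,
      fun t u => by simpa using (hf' (f⁻¹ t) (f⁻¹ u)).symm⟩

variable {F} in
theorem eq_of_rel {t u : T} (h : F.rel t u) (hl : F.lam u = F.lam t) : u = t :=
  (F.existsUnique_above t (F.lam t) le_rfl).unique ⟨h, hl⟩ ⟨F.rel_refl t, rfl⟩

/-- The point `(t, n)` leaves the stem of `t` immediately below the sublevel coded by the colour
of `t` and by `n`; above that sublevel it runs through `s`. -/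
def OnStem (p : T × ℕ) (ℓ : L) (r : ℕ) (s : T) : Prop :=
  F.rel p.1 s ∧ F.lam s = ℓ ∧ (p.1 = s → r ≤ Nat.pair (κ p.1) p.2)

/-- Agreement of two points at a sublevel. -/
def Agree (g : L ×ₗ ℕᵒᵈ) (p q : T × ℕ) : Prop :=
  p = q ∨ ∃ s, F.OnStem κ p (ofLex g).1 (OrderDual.ofDual (ofLex g).2) s ∧
    F.OnStem κ q (ofLex g).1 (OrderDual.ofDual (ofLex g).2) s

variable {F κ}

theorem OnStem.unique {p : T × ℕ} {ℓ : L} {r r' : ℕ} {s s' : T} (h : F.OnStem κ p ℓ r s)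
    (h' : F.OnStem κ p ℓ r' s') : s = s' :=
  (F.existsUnique_above p.1 ℓ (h.2.1 ▸ F.lam_mono _ _ h.1)).unique ⟨h.1, h.2.1⟩ ⟨h'.1, h'.2.1⟩

theorem Agree.symm {g : L ×ₗ ℕᵒᵈ} {p q : T × ℕ} (h : F.Agree κ g p q) : F.Agree κ g q p := by
  rcases h with rfl | ⟨s, h₁, h₂⟩
  · exact Or.inl rfl
  · exact Or.inr ⟨s, h₂, h₁⟩

theorem Agree.trans {g : L ×ₗ ℕᵒᵈ} {p q r : T × ℕ} (h : F.Agree κ g p q) (h' : F.Agree κ g q r) :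
    F.Agree κ g p r := by
  rcases h with rfl | ⟨s, h₁, h₂⟩
  · exact h'
  rcases h' with rfl | ⟨s', h₃, h₄⟩
  · exact Or.inr ⟨s, h₁, h₂⟩
  · obtain rfl := h₂.unique h₃
    exact Or.inr ⟨s, h₁, h₄⟩

theorem OnStem.mono {p : T × ℕ} {ℓ ℓ' : L} {r r' : ℕ} {s s' : T} (h : F.OnStem κ p ℓ r s)
    (hss : F.rel s s') (hl : F.lam s' = ℓ') (hr : ℓ = ℓ' → r' ≤ r) : F.OnStem κ p ℓ' r' s' := by
  refine ⟨F.rel_trans _ _ _ h.1 hss, hl, fun hp => ?_⟩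
  have h₁ := F.lam_mono _ _ h.1
  have h₂ := F.lam_mono _ _ hss
  rw [hp] at h₁
  have h₃ := eq_of_rel hss (le_antisymm h₁ h₂)
  subst h₃
  exact (hr (h.2.1.symm.trans hl)).trans (h.2.2 hp)

theorem Agree.mono {g g' : L ×ₗ ℕᵒᵈ} {p q : T × ℕ} (hg : g ≤ g') (h : F.Agree κ g p q) :
    F.Agree κ g' p q := by
  rcases h with rfl | ⟨s, h₁, h₂⟩
  · exact Or.inl rfl
  have hl : (ofLex g).1 ≤ (ofLex g').1 := by
    rcases Prod.Lex.le_iff.1 hg with h | h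
    exacts [h.le, h.1.le]
  have hr : (ofLex g).1 = (ofLex g').1 →
      OrderDual.ofDual (ofLex g').2 ≤ OrderDual.ofDual (ofLex g).2 := by
    rcases Prod.Lex.le_iff.1 hg with h | h
    exacts [fun e => absurd h (by rw [e]; exact lt_irrefl _), fun _ => h.2]
  obtain ⟨s', ⟨hss, hl'⟩, -⟩ := F.existsUnique_above s _ (h₁.2.1.trans_le hl)
  exact Or.inr ⟨s', h₁.mono hss hl' hr, h₂.mono hss hl' hr⟩

/-- Disagreement of comparable points. -/
theorem isGreatest_disagree_of_rel {t u : T} {n m : ℕ} (h : F.rel t u) (hne : (t, n) ≠ (u, m))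
    (hnm : t = u → m ≤ n) :
    IsGreatest {g | ¬ F.Agree κ g (t, n) (u, m)}
      (toLex (F.lam u, OrderDual.toDual (Nat.pair (κ u) m + 1))) := by
  -- The point `(u, m)` stays on its stem down to sublevel `Nat.pair (κ u) m` of its level, so the
  -- next sublevel is the first one where it is isolated. Until then `(t, n)` runs along with it:
  -- either `t` lies strictly below `u`, or `t = u` and `n ≥ m` leaves no earlier.
  constructor
  · rintro (h' | ⟨s, h₁, h₂⟩)
    · exact hne h'
    · have : s = u := eq_of_rel h₂.1 h₂.2.1
      have := h₂.2.2 this.symm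
      simp at this
  · intro g hg
    induction g using Lex.rec with | _ g =>
    obtain ⟨ℓ, r⟩ := g
    induction r using OrderDual.rec with | _ r =>
    rw [Prod.Lex.toLex_le_toLex]
    by_contra hcon
    push Not at hcon
    obtain ⟨hcon₁, hcon₂⟩ := hcon
    apply hg
    obtain ⟨s, ⟨hus, hs⟩, -⟩ := F.existsUnique_above u ℓ hcon₁
    have hr : u = s → r ≤ Nat.pair (κ u) m := by
      rintro rfl
      have := hcon₂ hs.symm
      have := OrderDual.toDual_lt_toDual.1 this
      omega
    refine Or.inr ⟨s, ⟨F.rel_trans _ _ _ h hus, hs, fun hts => ?_⟩, hus, hs, hr⟩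
    change t = s at hts
    subst hts
    obtain rfl : u = t := (eq_of_rel hus (le_antisymm (F.lam_mono _ _ h) (F.lam_mono _ _ hus))).symm
    refine (hr rfl).trans ?_
    rcases (hnm rfl).eq_or_lt with rfl | hlt
    · exact le_rfl
    · exact (Nat.pair_lt_pair_right _ hlt).le

theorem exists_isGreatest_disagree (p q : T × ℕ) (hne : p ≠ q) :
    ∃ g, IsGreatest {g | ¬ F.Agree κ g p q} g := by
  obtain ⟨t, n⟩ := p
  obtain ⟨u, m⟩ := q
  have hsymm : {g | ¬ F.Agree κ g (t, n) (u, m)} = {g | ¬ F.Agree κ g (u, m) (t, n)} :=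
    Set.ext fun g => not_congr ⟨Agree.symm, Agree.symm⟩
  by_cases htu : F.rel t u
  · by_cases hn : t = u → m ≤ n
    · exact ⟨_, isGreatest_disagree_of_rel htu hne hn⟩
    · push Not at hn
      obtain ⟨rfl, hn⟩ := hn
      exact ⟨_, hsymm ▸ isGreatest_disagree_of_rel htu hne.symm fun _ => hn.le⟩
  by_cases hut : F.rel u t
  · exact ⟨_, hsymm ▸ isGreatest_disagree_of_rel hut hne.symm fun h =>
      absurd (by rw [h]; exact F.rel_refl t) htu⟩
  obtain ⟨M, ⟨hM₁, hM₂, hM₃⟩, hM₄⟩ := F.exists_greatest t u htu hut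
  -- In `ℕᵒᵈ` the number 0 is greatest, so this is the top sublevel of the greatest level of
  -- disagreement of the nodes.
  refine ⟨toLex (M, OrderDual.toDual 0), ?_, ?_⟩
  · rintro (h' | ⟨s, h₁, h₂⟩)
    · exact hne h'
    · exact hM₃ ⟨s, h₁.1, h₂.1, h₁.2.1⟩
  · intro g hg
    induction g using Lex.rec with | _ g =>
    obtain ⟨ℓ, r⟩ := g
    induction r using OrderDual.rec with | _ r =>
    rw [Prod.Lex.toLex_le_toLex]
    by_contra hcon
    push Not at hcon
    obtain ⟨hcon₁, hcon₂⟩ := hcon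
    rcases hcon₁.eq_or_lt with rfl | hlt
    · exact absurd (hcon₂ rfl) (not_lt.2 (OrderDual.toDual_le_toDual.2 (Nat.zero_le _)))
    · apply hg
      by_contra hR
      refine absurd (hM₄ (a := ℓ) ⟨hM₁.trans hcon₁, hM₂.trans hcon₁, ?_⟩) (not_le.2 hlt)
      rintro ⟨s, hs₁, hs₂, hs₃⟩
      refine hR (Or.inr ⟨s, ⟨hs₁, hs₃, ?_⟩, hs₂, hs₃, ?_⟩)
      · intro h
        exact absurd hs₃ (by rw [← show t = s from h]; exact (hM₁.trans_lt hlt).ne)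
      · intro h
        exact absurd hs₃ (by rw [← show u = s from h]; exact (hM₂.trans_lt hlt).ne)

/-- The sublevels at which a point is still on the stem are those at which it is not isolated. -/
theorem exists_onStem_iff (p : T × ℕ) (ℓ : L) (r : ℕ) :
    (∃ s, F.OnStem κ p ℓ r s) ↔
      ∃ q, q ≠ p ∧ F.Agree κ (toLex (ℓ, OrderDual.toDual r)) p q := by
  constructor
  · rintro ⟨s, hs⟩
    -- The second component exceeds `p.2`, so the point is new, and it is at least `r`, so the point
    -- is still on the stem at sublevel `r`. This is why each node carries infinitely many points.
    refine ⟨(s, p.2 + 1 + r), fun h => ?_, Or.inr ⟨s, hs, F.rel_refl s, hs.2.1, fun _ => ?_⟩⟩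
    · have := congrArg Prod.snd h
      simp only at this
      omega
    · have := Nat.right_le_pair (κ s) (p.2 + 1 + r)
      change r ≤ Nat.pair (κ s) (p.2 + 1 + r)
      omega
  · rintro ⟨q, hq, h | ⟨s, hs, -⟩⟩
    · exact absurd h.symm hq
    · exact ⟨s, hs⟩

theorem exists_onStem_iff_lt (p : T × ℕ) (ℓ : L) (r : ℕ) :
    (∃ s, F.OnStem κ p ℓ r s) ↔
      F.lam p.1 < ℓ ∨ (F.lam p.1 = ℓ ∧ r ≤ Nat.pair (κ p.1) p.2) := by
  constructor
  · rintro ⟨s, h₁, rfl, h₃⟩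
    rcases (F.lam_mono _ _ h₁).eq_or_lt with h | h
    · obtain rfl := eq_of_rel h₁ h.symm
      exact Or.inr ⟨rfl, h₃ rfl⟩
    · exact Or.inl h
  · rintro (h | ⟨h, hr⟩)
    · obtain ⟨s, ⟨hs, rfl⟩, -⟩ := F.existsUnique_above p.1 ℓ h.le
      exact ⟨s, hs, rfl, fun e => absurd h (by rw [e]; exact lt_irrefl _)⟩
    · exact ⟨p.1, F.rel_refl _, h, fun _ => hr⟩

/-- The sublevels on the stem form a final segment with least element `(F.lam p.1, Nat.pair (κ p.1)
p.2)`, from which level, colour and number are decoded. -/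
theorem eq_of_onStem_iff {p q : T × ℕ}
    (h : ∀ ℓ r, (∃ s, F.OnStem κ p ℓ r s) ↔ ∃ s, F.OnStem κ q ℓ r s) :
    F.lam p.1 = F.lam q.1 ∧ κ p.1 = κ q.1 ∧ p.2 = q.2 := by
  simp only [exists_onStem_iff_lt] at h
  have hl : F.lam p.1 = F.lam q.1 := by
    have h₁ := (h (F.lam p.1) 0).1 (Or.inr ⟨rfl, Nat.zero_le _⟩)
    have h₂ := (h (F.lam q.1) 0).2 (Or.inr ⟨rfl, Nat.zero_le _⟩)
    refine le_antisymm ?_ ?_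
    · rcases h₂ with h | h
      exacts [h.le, h.1.le]
    · rcases h₁ with h | h
      exacts [h.le, h.1.le]
  have hp : Nat.pair (κ p.1) p.2 = Nat.pair (κ q.1) q.2 := by
    have h₁ := (h (F.lam p.1) _).1 (Or.inr ⟨rfl, le_rfl⟩)
    have h₂ := (h (F.lam q.1) _).2 (Or.inr ⟨rfl, le_rfl⟩)
    rw [hl] at h₁ h₂
    simp only [lt_self_iff_false, true_and, false_or] at h₁ h₂
    exact le_antisymm h₁ h₂
  exact ⟨hl, Nat.pair_eq_pair.1 hp⟩

/-- Every point is on its stem at the top sublevel of its own level, so agreement there sees the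
order and ignores colours and numbers. -/
theorem rel_iff_agree (p q : T × ℕ) :
    F.rel p.1 q.1 ↔ F.Agree κ (toLex (F.lam q.1, OrderDual.toDual 0)) p q := by
  constructor
  · intro h
    exact Or.inr ⟨q.1, ⟨h, rfl, fun _ => Nat.zero_le _⟩, F.rel_refl _, rfl, fun _ => Nat.zero_le _⟩
  · rintro (rfl | ⟨s, h₁, h₂⟩)
    · exact F.rel_refl _
    · obtain rfl := eq_of_rel h₂.1 h₂.2.1
      exact h₁.1

theorem agree_map (f : F.colouredAut κ) (g : L ×ₗ ℕᵒᵈ) {p q : T × ℕ} (h : F.Agree κ g p q) :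
    F.Agree κ g (f.1 p.1, p.2) (f.1 q.1, q.2) := by
  have key : ∀ {p : T × ℕ} {ℓ r s}, F.OnStem κ p ℓ r s →
      F.OnStem κ (f.1 p.1, p.2) ℓ r (f.1 s) := by
    rintro p ℓ r s ⟨h₁, h₂, h₃⟩
    refine ⟨(f.2.2 _ _).1 h₁, (f.2.1 s).1.trans h₂, fun h => ?_⟩
    simp only [(f.2.1 p.1).2]
    exact h₃ (f.1.injective h)
  rcases h with rfl | ⟨s, h₁, h₂⟩
  · exact Or.inl rfl
  · exact Or.inr ⟨f.1 s, key h₁, key h₂⟩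

/-- Coloured automorphism groups of countable forests are isometry groups of uniformly discrete
spaces. -/
theorem exists_uniformlyDiscrete (F : LevelledForest L T) (κ : T → ℕ) [Countable L] [Countable T]
    [Nonempty T] : ∃ (U : Type) (_ : MetricSpace U), IsPolishUltrametric U ∧
      IsUniformlyDiscrete U ∧ Nonempty (F.colouredAut κ ≃ₜ* (U ≃ᵢ U)) := by
  have : Countable (L ×ₗ ℕᵒᵈ) := inferInstanceAs (Countable (L × ℕ))
  obtain ⟨inst, hP, hD, hdist⟩ := exists_uniformlyDiscrete_of_agreement (F.Agree κ)
    (fun _ _ => Or.inl rfl) (fun _ _ _ => Agree.symm) (fun _ _ _ _ => Agree.trans)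
    (fun _ _ _ _ => Agree.mono) exists_isGreatest_disagree
  refine ⟨T × ℕ, inst, hP, hD, ?_⟩
  have hdisc : DiscreteTopology (T × ℕ) := by
    obtain ⟨r, hr, hb⟩ := hD
    exact discreteTopology_iff_isOpen_singleton.2 fun x => hb x ▸ Metric.isOpen_ball
  have hag : ∀ (f : (T × ℕ) ≃ᵢ (T × ℕ)) g p q, F.Agree κ g p q ↔ F.Agree κ g (f p) (f q) :=
    fun f g p q => ((hdist p q (f p) (f q)).1 (f.dist_eq p q).symm) g
  have hinv : ∀ (f : (T × ℕ) ≃ᵢ (T × ℕ)) p,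
      F.lam (f p).1 = F.lam p.1 ∧ κ (f p).1 = κ p.1 ∧ (f p).2 = p.2 := by
    intro f p
    refine eq_of_onStem_iff fun ℓ r => ?_
    rw [exists_onStem_iff, exists_onStem_iff]
    constructor
    · rintro ⟨q, hq, h⟩
      refine ⟨f.symm q, fun e => hq (by rw [← e]; simp), ?_⟩
      rw [hag f]
      simpa using h
    · rintro ⟨q, hq, h⟩
      exact ⟨f q, fun e => hq (f.injective e), (hag f _ _ _).1 h⟩
  have hrel : ∀ (f : (T × ℕ) ≃ᵢ (T × ℕ)) p q, F.rel p.1 q.1 ↔ F.rel (f p).1 (f q).1 := by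
    intro f p q
    rw [rel_iff_agree (κ := κ), rel_iff_agree (κ := κ), (hinv f q).1]
    exact hag f _ _ _
  -- Points over one node are related and of equal level; both properties are invariant, so their
  -- images lie over one node.
  have hfst : ∀ (f : (T × ℕ) ≃ᵢ (T × ℕ)) t n m, (f (t, n)).1 = (f (t, m)).1 := by
    intro f t n m
    refine (eq_of_rel ((hrel f (t, n) (t, m)).1 (F.rel_refl t)) ?_).symm
    rw [(hinv f _).1, (hinv f _).1]
  have happ : ∀ (f : (T × ℕ) ≃ᵢ (T × ℕ)) p, f p = ((f (p.1, 0)).1, p.2) := fun f p =>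
    Prod.ext (hfst f p.1 p.2 0) (hinv f p).2.2
  let toIso : F.colouredAut κ → ((T × ℕ) ≃ᵢ (T × ℕ)) := fun f =>
    { toEquiv := f.1.prodCongr (Equiv.refl ℕ)
      isometry_toFun := Isometry.of_dist_eq fun p q => by
        rw [hdist]
        intro g
        refine ⟨fun h => ?_, agree_map f g⟩
        have := agree_map f⁻¹ g h
        simpa using this }
  let ofIso : ((T × ℕ) ≃ᵢ (T × ℕ)) → F.colouredAut κ := fun f =>
    ⟨{ toFun := fun t => (f (t, 0)).1
       invFun := fun t => (f.symm (t, 0)).1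
       left_inv := fun t => by
        have h : ((f (t, 0)).1, 0) = f (t, 0) := (happ f (t, 0)).symm
        change (f.symm ((f (t, 0)).1, 0)).1 = t
        rw [h]; simp
       right_inv := fun t => by
        have h : ((f.symm (t, 0)).1, 0) = f.symm (t, 0) := (happ f.symm (t, 0)).symm
        change (f ((f.symm (t, 0)).1, 0)).1 = t
        rw [h]; simp },
      fun t => ⟨(hinv f (t, 0)).1, (hinv f (t, 0)).2.1⟩, fun t u => hrel f (t, 0) (u, 0)⟩
  refine ⟨{ toFun := toIso, invFun := ofIso, left_inv := fun f => rfl,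
            right_inv := fun f => ?_, map_mul' := fun f g => ?_,
            continuous_toFun := ?_, continuous_invFun := ?_ }⟩
  · ext1 p
    exact (happ f p).symm
  · ext1 p
    rfl
  · refine continuous_induced_rng.2 (continuous_pi fun p => continuous_discrete_rng.2 fun q => ?_)
    by_cases h : p.2 = q.2
    · convert isOpen_apply_eq (F.colouredAut κ) p.1 q.1 using 1
      ext f
      exact ⟨fun e => congrArg Prod.fst e, fun e => Prod.ext e h⟩
    · convert isOpen_empty
      refine Set.eq_empty_of_forall_notMem fun f hf => h ?_
      exact (Prod.ext_iff.1 (show toIso f p = q from hf)).2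
  · refine continuous_perm_subgroup_iff.2 fun t u => ?_
    exact isOpen_setOf_apply_mem (t, 0) (B := {q | q.1 = u}) (isOpen_discrete _)

end LevelledForest

/-! ## A rigid perfect compact ultrametric -/

namespace CantorTree

/-- The number of the node `x|n` of the binary tree, where the root has number `1` and the children
of the node `k` have the numbers `2k` and `2k + 1`. -/
def heap (x : ℕ → Bool) : ℕ → ℕ
  | 0 => 1
  | n + 1 => 2 * heap x n + (x n).toNat

theorem heap_congr {x y : ℕ → Bool} {n : ℕ} (h : ∀ i < n, x i = y i) : heap x n = heap y n := by
  induction n with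
  | zero => rfl
  | succ n ih => rw [heap, heap, ih fun i hi => h i (by omega), h n (by omega)]

theorem lt_heap (x : ℕ → Bool) (n : ℕ) : n < heap x n := by
  induction n with
  | zero => exact one_pos
  | succ n ih => rw [heap]; omega

theorem heap_mono (x : ℕ → Bool) : Monotone (heap x) :=
  monotone_nat_of_le_succ fun n => by rw [heap]; omega

theorem heap_injective {x y : ℕ → Bool} : ∀ {n m : ℕ}, heap x n = heap y m →
    n = m ∧ ∀ i < n, x i = y i
  | 0, 0, _ => ⟨rfl, fun i hi => absurd hi (Nat.not_lt_zero i)⟩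
  | 0, m + 1, h => by
    have := lt_heap y m
    simp only [heap] at h
    omega
  | n + 1, 0, h => by
    have := lt_heap x n
    simp only [heap] at h
    omega
  | n + 1, m + 1, h => by
    simp only [heap] at h
    have h₁ : (x n).toNat ≤ 1 := Bool.toNat_le _
    have h₂ : (y m).toNat ≤ 1 := Bool.toNat_le _
    obtain ⟨rfl, hi⟩ := heap_injective (x := x) (y := y) (n := n) (m := m) (by omega)
    refine ⟨rfl, fun i hin => ?_⟩
    rcases Nat.lt_succ_iff_lt_or_eq.1 hin with h' | rfl
    · exact hi i h'
    · have : (x i).toNat = (y i).toNat := by omega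
      revert this
      cases x i <;> cases y i <;> simp

open Classical in
/-- Distances in the binary tree, with all splitting distances different. -/
noncomputable def cdist (c : ℝ) (x y : ℕ → Bool) : ℝ :=
  if x = y then 0 else c / heap x (PiNat.firstDiff x y)

variable {c : ℝ}

theorem cdist_self (x : ℕ → Bool) : cdist c x x = 0 := if_pos rfl

theorem cdist_of_ne {x y : ℕ → Bool} (h : x ≠ y) :
    cdist c x y = c / heap x (PiNat.firstDiff x y) := if_neg h

theorem heap_pos (x : ℕ → Bool) (n : ℕ) : (0 : ℝ) < heap x n := by
  exact_mod_cast (Nat.zero_le n).trans_lt (lt_heap x n)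

theorem cdist_pos (hc : 0 < c) {x y : ℕ → Bool} (h : x ≠ y) : 0 < cdist c x y := by
  rw [cdist_of_ne h]
  exact div_pos hc (heap_pos _ _)

theorem cdist_nonneg (hc : 0 < c) (x y : ℕ → Bool) : 0 ≤ cdist c x y := by
  by_cases h : x = y
  · subst h; exact (cdist_self x).ge
  · exact (cdist_pos hc h).le

theorem cdist_comm (x y : ℕ → Bool) : cdist c x y = cdist c y x := by
  by_cases h : x = y
  · subst h; rfl
  · rw [cdist_of_ne h, cdist_of_ne (Ne.symm h), PiNat.firstDiff_comm y x,
      heap_congr fun i hi => PiNat.apply_eq_of_lt_firstDiff hi]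

theorem cdist_le_of_agree (hc : 0 < c) {x y : ℕ → Bool} {n : ℕ} (h : ∀ i < n, x i = y i) :
    cdist c x y ≤ c / heap x n := by
  by_cases hxy : x = y
  · subst hxy
    rw [cdist_self]
    exact (div_pos hc (heap_pos _ _)).le
  · rw [cdist_of_ne hxy]
    refine div_le_div_of_nonneg_left hc.le (heap_pos _ _) ?_
    refine Nat.cast_le.2 (heap_mono x ?_)
    by_contra hlt
    exact PiNat.apply_firstDiff_ne hxy (h _ (not_le.1 hlt))

theorem cdist_le (hc : 0 < c) (x y : ℕ → Bool) : cdist c x y ≤ c := by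
  have := cdist_le_of_agree hc (x := x) (y := y) (n := 0) fun i hi => absurd hi (Nat.not_lt_zero i)
  simpa [heap] using this

theorem cdist_ultra (hc : 0 < c) (x y z : ℕ → Bool) :
    cdist c x z ≤ max (cdist c x y) (cdist c y z) := by
  by_cases hxy : x = y
  · subst hxy; exact le_max_right _ _
  by_cases hyz : y = z
  · subst hyz; exact le_max_left _ _
  by_cases hxz : x = z
  · subst hxz; rw [cdist_self]; exact (cdist_nonneg hc _ _).trans (le_max_left _ _)
  rcases min_le_iff.1 (PiNat.min_firstDiff_le x y z hxz) with h | h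
  · refine le_max_of_le_left ?_
    rw [cdist_of_ne hxy]
    exact cdist_le_of_agree hc fun i hi => PiNat.apply_eq_of_lt_firstDiff (hi.trans_le h)
  · refine le_max_of_le_right ?_
    rw [cdist_comm x, cdist_comm y, cdist_of_ne (Ne.symm hyz), PiNat.firstDiff_comm z y]
    exact cdist_le_of_agree hc fun i hi => (PiNat.apply_eq_of_lt_firstDiff (hi.trans_le h)).symm

theorem exists_agree_cdist_lt (hc : 0 < c) (x : ℕ → Bool) {ε : ℝ} (hε : 0 < ε) :
    ∃ n, ∀ y, (∀ i < n, x i = y i) → cdist c x y < ε := by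
  obtain ⟨n, hn⟩ := exists_nat_gt (c / ε)
  refine ⟨n, fun y hy => (cdist_le_of_agree hc hy).trans_lt ?_⟩
  rw [div_lt_comm₀ (heap_pos _ _) hε]
  exact hn.trans (Nat.cast_lt.2 (lt_heap x n))

/-- Distance-preserving maps are trivial. -/
theorem eq_of_cdist_eq (hc : 0 < c) {φ : (ℕ → Bool) → ℕ → Bool}
    (h : ∀ x y, cdist c (φ x) (φ y) = cdist c x y) (x : ℕ → Bool) : φ x = x := by
  funext n
  -- The distance of two points determines the node at which they split, because nodes have
  -- different numbers. As `x` and `y` split beyond coordinate `n`, the common initial segment of `φ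
  -- x` and `φ y` contains `x n`.
  let y : ℕ → Bool := Function.update x (n + 1) (!x (n + 1))
  have hy : ∀ i < n + 1, x i = y i := fun i hi => (Function.update_of_ne hi.ne _ _).symm
  have hne : x ≠ y := fun e => by
    have := congrFun e (n + 1)
    simp [y] at this
  have hfd : n < PiNat.firstDiff x y := by
    by_contra hlt
    exact PiNat.apply_firstDiff_ne hne (hy _ (by omega))
  have hne' : φ x ≠ φ y := fun e => by
    have := h x y
    rw [e, cdist_self] at this
    exact (cdist_pos hc hne).ne this
  have := h x y
  rw [cdist_of_ne hne, cdist_of_ne hne', div_eq_div_iff (heap_pos _ _).ne' (heap_pos _ _).ne',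
    mul_right_inj' hc.ne'] at this
  have := (Nat.cast_injective this).symm
  have := heap_injective this
  exact this.2 n (this.1 ▸ hfd)

end CantorTree

/-- The points of `V` replaced by copies of the Cantor space. -/
@[ext]
structure CantorBlowup (V : Type) where
  base : V
  pt : ℕ → Bool

open CantorTree in
/-- Replacing the points of a uniformly discrete space by small copies of a rigid perfect compact
space does not change the isometry group. -/
theorem exists_perfect_locallyCompact (V : Type) [MetricSpace V] (hV : IsPolishUltrametric V)
    (hD : IsUniformlyDiscrete V) :
    ∃ (U : Type) (_ : MetricSpace U), IsPolishUltrametric U ∧ PerfectSpace U ∧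
      LocallyCompactSpace U ∧ Nonempty ((V ≃ᵢ V) ≃ₜ* (U ≃ᵢ U)) := by
  classical
  obtain ⟨r, hr, hb⟩ := hD
  have hV₁ := hV.ultrametric
  have hV₂ := hV.secondCountable
  have hVne := hV.nonempty
  have hdisc : DiscreteTopology V :=
    discreteTopology_iff_isOpen_singleton.2 fun x => hb x ▸ Metric.isOpen_ball
  have hcount : Countable V := TopologicalSpace.separableSpace_iff_countable.1 inferInstance
  have hdr : ∀ u v : V, u ≠ v → r ≤ dist u v := fun u v h => by
    by_contra hlt
    have : u ∈ Metric.ball v r := not_le.1 hlt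
    rw [hb] at this
    exact h this
  -- Fibres have diameter at most `c < r`, while different fibres are at distance at least `r`.
  -- Hence the fibres are the `r`-balls and isometries permute them.
  obtain ⟨c, hc, hcr⟩ := exists_between hr
  let d : CantorBlowup V → CantorBlowup V → ℝ := fun p q =>
    if p.1 = q.1 then cdist c p.2 q.2 else dist p.1 q.1
  have hd₁ : ∀ p q, p.1 = q.1 → d p q = cdist c p.2 q.2 := fun p q h => if_pos h
  have hd₂ : ∀ p q, p.1 ≠ q.1 → d p q = dist p.1 q.1 := fun p q h => if_neg h
  have hself : ∀ p, d p p = 0 := fun p => (hd₁ p p rfl).trans (cdist_self _)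
  have hcomm : ∀ p q, d p q = d q p := fun p q => by
    by_cases h : p.1 = q.1
    · rw [hd₁ p q h, hd₁ q p h.symm, cdist_comm]
    · rw [hd₂ p q h, hd₂ q p (Ne.symm h), dist_comm]
  have hlt : ∀ p q, d p q < r ↔ p.1 = q.1 := fun p q => by
    by_cases h : p.1 = q.1
    · rw [hd₁ p q h]
      exact iff_of_true ((cdist_le hc _ _).trans_lt hcr) h
    · rw [hd₂ p q h]
      exact iff_of_false (not_lt.2 (hdr _ _ h)) h
  have hultra : ∀ p q s, d p s ≤ max (d p q) (d q s) := by
    intro p q s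
    by_cases h₁ : p.1 = q.1
    · by_cases h₂ : q.1 = s.1
      · rw [hd₁ p q h₁, hd₁ q s h₂, hd₁ p s (h₁.trans h₂)]
        exact cdist_ultra hc _ _ _
      · rw [hd₂ q s h₂, hd₂ p s (h₁ ▸ h₂), h₁]
        exact le_max_right _ _
    · by_cases h₂ : q.1 = s.1
      · rw [hd₂ p q h₁, hd₂ p s (h₂ ▸ h₁), h₂]
        exact le_max_left _ _
      · by_cases h₃ : p.1 = s.1
        · exact ((hlt p s).2 h₃).le.trans
            ((not_lt.1 fun h => h₁ ((hlt p q).1 h)).trans (le_max_left _ _))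
        · rw [hd₂ p q h₁, hd₂ q s h₂, hd₂ p s h₃]
          exact dist_triangle_max _ _ _
  have hnonneg : ∀ p q, 0 ≤ d p q := fun p q => by
    by_cases h : p.1 = q.1
    · rw [hd₁ p q h]; exact cdist_nonneg hc _ _
    · rw [hd₂ p q h]; exact dist_nonneg
  let inst : MetricSpace (CantorBlowup V) :=
    { dist := d
      dist_self := hself
      dist_comm := hcomm
      dist_triangle := fun p q s => (hultra p q s).trans
        (max_le_add_of_nonneg (hnonneg _ _) (hnonneg _ _))
      eq_of_dist_eq_zero := fun {p q} h => by
        have h' : d p q = 0 := h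
        have h₁ : p.1 = q.1 := (hlt p q).1 (h'.trans_lt hr)
        refine CantorBlowup.ext h₁ ?_
        by_contra hne
        rw [hd₁ p q h₁] at h'
        exact (cdist_pos hc hne).ne' h' }
  have hdist : ∀ p q : CantorBlowup V, dist p q = d p q := fun _ _ => rfl
  have hdlt : ∀ p q : CantorBlowup V, dist p q < r ↔ p.1 = q.1 := hlt
  have hcont : ∀ u : V, Continuous (CantorBlowup.mk u) := by
    intro u
    refine continuous_iff_continuousAt.2 fun x => Metric.tendsto_nhds.2 fun ε hε => ?_
    obtain ⟨n, hn⟩ := exists_agree_cdist_lt hc x hε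
    filter_upwards [(PiNat.isOpen_cylinder (fun _ => Bool) x n).mem_nhds
      (PiNat.self_mem_cylinder x n)] with y hy
    rw [dist_comm, hdist, hd₁ ⟨u, x⟩ ⟨u, y⟩ rfl]
    exact hn y fun i hi => (PiNat.mem_cylinder_iff.1 hy i hi).symm
  have hball : ∀ p : CantorBlowup V, Metric.ball p r = Set.range (CantorBlowup.mk p.1) := by
    intro p
    ext q
    rw [Metric.mem_ball, hdlt]
    constructor
    · intro h
      exact ⟨q.2, CantorBlowup.ext h.symm rfl⟩
    · rintro ⟨x, rfl⟩
      rfl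
  have hcompact : ∀ p : CantorBlowup V, IsCompact (Metric.ball p r) := fun p => by
    rw [hball]
    exact isCompact_range (hcont p.1)
  have hloc : LocallyCompactSpace (CantorBlowup V) := by
    have : WeaklyLocallyCompactSpace (CantorBlowup V) :=
      ⟨fun p => ⟨_, hcompact p, Metric.ball_mem_nhds p hr⟩⟩
    infer_instance
  have hsigma : SigmaCompactSpace (CantorBlowup V) := by
    refine SigmaCompactSpace.of_countable
      (Set.range fun u : V => Metric.ball (CantorBlowup.mk u fun _ => false) r)
      (Set.countable_range _) ?_ ?_
    · rintro _ ⟨u, rfl⟩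
      exact hcompact _
    · refine Set.eq_univ_of_forall fun p => ⟨_, ⟨p.1, rfl⟩, ?_⟩
      exact (hdlt _ _).2 rfl
  have hcomplete : CompleteSpace (CantorBlowup V) := by
    refine Metric.complete_of_cauchySeq_tendsto fun u hu => ?_
    obtain ⟨n, hn⟩ := Metric.cauchySeq_iff'.1 hu r hr
    obtain ⟨v, -, hv⟩ := cauchySeq_tendsto_of_isComplete (hcompact (u n)).isComplete
      (u := fun k => u (k + n)) (fun k => hn _ (Nat.le_add_left _ _))
      (hu.comp_tendsto (Filter.tendsto_add_atTop_nat n))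
    exact ⟨v, (Filter.tendsto_add_atTop_iff_nat n).1 hv⟩
  have hperfect : PerfectSpace (CantorBlowup V) := by
    refine perfectSpace_iff_forall_not_isolated.2 fun p => ?_
    rw [← mem_closure_iff_nhdsWithin_neBot, Metric.mem_closure_iff]
    intro ε hε
    obtain ⟨n, hn⟩ := exists_agree_cdist_lt hc p.2 hε
    refine ⟨⟨p.1, Function.update p.2 n (!p.2 n)⟩, fun h => ?_, ?_⟩
    · have := congrFun (CantorBlowup.ext_iff.1 h).2 n
      simp at this
    · rw [hdist, hd₁ p ⟨p.1, Function.update p.2 n (!p.2 n)⟩ rfl]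
      exact hn _ fun i hi => (Function.update_of_ne hi.ne _ _).symm
  have hfst : ∀ (f : CantorBlowup V ≃ᵢ CantorBlowup V) (p q), p.1 = q.1 ↔ (f p).1 = (f q).1 :=
      fun f p q => by
    rw [← hdlt, ← hdlt, f.dist_eq]
  have hsnd : ∀ (f : CantorBlowup V ≃ᵢ CantorBlowup V) (p), (f p).2 = p.2 :=
      fun f p => by
    -- Between two fibres `f` is a distance-preserving map of the rigid space to itself, hence the
    -- identity on the second component.
    refine eq_of_cdist_eq hc (φ := fun x => (f ⟨p.1, x⟩).2) (fun x y => ?_) p.2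
    rw [← hd₁ (f ⟨p.1, x⟩) (f ⟨p.1, y⟩) ((hfst f ⟨p.1, x⟩ ⟨p.1, y⟩).1 rfl),
      ← hdist, f.dist_eq, hdist, hd₁ ⟨p.1, x⟩ ⟨p.1, y⟩ rfl]
  let o : ℕ → Bool := fun _ => false
  have happ : ∀ (f : CantorBlowup V ≃ᵢ CantorBlowup V) (p), f p = ⟨(f ⟨p.1, o⟩).1, p.2⟩ :=
      fun f p =>
    CantorBlowup.ext ((hfst f p ⟨p.1, o⟩).1 rfl) (hsnd f p)
  have hmk : ∀ (f : CantorBlowup V ≃ᵢ CantorBlowup V) (u : V), ⟨(f ⟨u, o⟩).1, o⟩ = f ⟨u, o⟩ :=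
      fun f u =>
    (happ f ⟨u, o⟩).symm
  let toIso : (V ≃ᵢ V) → (CantorBlowup V ≃ᵢ CantorBlowup V) := fun f =>
    { toEquiv := ⟨fun p => ⟨f p.1, p.2⟩, fun p => ⟨f.symm p.1, p.2⟩,
        fun p => CantorBlowup.ext (f.symm_apply_apply _) rfl,
        fun p => CantorBlowup.ext (f.apply_symm_apply _) rfl⟩
      isometry_toFun := Isometry.of_dist_eq fun p q => by
        change d ⟨f p.1, p.2⟩ ⟨f q.1, q.2⟩ = d p q
        by_cases h : p.1 = q.1
        · rw [hd₁ p q h, hd₁ _ _ (congrArg f h)]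
        · rw [hd₂ p q h, hd₂ _ _ (fun e => h (f.injective e)), f.dist_eq] }
  let ofIso : (CantorBlowup V ≃ᵢ CantorBlowup V) → (V ≃ᵢ V) := fun f =>
    { toFun := fun u => (f ⟨u, o⟩).1
      invFun := fun u => (f.symm ⟨u, o⟩).1
      left_inv := fun u => by
        change (f.symm ⟨(f ⟨u, o⟩).1, o⟩).1 = u
        rw [hmk, f.symm_apply_apply]
      right_inv := fun u => by
        change (f ⟨(f.symm ⟨u, o⟩).1, o⟩).1 = u
        rw [hmk, f.apply_symm_apply]
      isometry_toFun := Isometry.of_dist_eq fun u v => by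
        by_cases h : u = v
        · subst h; rw [dist_self, dist_self]
        · have h' : (f ⟨u, o⟩).1 ≠ (f ⟨v, o⟩).1 := fun e =>
            h ((hfst f ⟨u, o⟩ ⟨v, o⟩).2 e)
          change dist (f ⟨u, o⟩).1 (f ⟨v, o⟩).1 = dist u v
          rw [← hd₂ _ _ h', ← hdist, f.dist_eq, hdist, hd₂ _ _ h] }
  refine ⟨CantorBlowup V, inst, ⟨⟨⟨Classical.arbitrary V, o⟩⟩, ⟨hultra⟩, hcomplete,
    EMetric.secondCountable_of_sigmaCompact (CantorBlowup V)⟩, hperfect, hloc,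
    ⟨{ toFun := toIso, invFun := ofIso, left_inv := fun f => ?_,
       right_inv := fun f => ?_, map_mul' := fun f g => ?_,
       continuous_toFun := ?_, continuous_invFun := ?_ }⟩⟩
  · ext1 u
    rfl
  · ext1 p
    exact (happ f p).symm
  · ext1 p
    rfl
  · refine continuous_induced_rng.2 (continuous_pi fun p => ?_)
    have h : Continuous fun u : V => CantorBlowup.mk u p.2 := continuous_of_discreteTopology
    exact h.comp ((continuous_apply p.1).comp continuous_induced_dom)
  · refine continuous_induced_rng.2 (continuous_pi fun u => continuous_discrete_rng.2 fun v => ?_)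
    have hB : IsOpen {q : CantorBlowup V | q.1 = v} := by
      convert Metric.isOpen_ball (x := CantorBlowup.mk v o) (ε := r) using 1
      ext q
      exact (hdlt q ⟨v, o⟩).symm
    exact isOpen_setOf_apply_mem ⟨u, o⟩ hB

/-! ## The tree of open balls -/

section OrbitDist

variable {U : Type} [MetricSpace U]

/-- The distance between the orbits of two points under the isometry group. -/
noncomputable def orbitDist (x y : U) : ℝ := ⨅ f : U ≃ᵢ U, dist (f x) y

theorem orbitDist_lt_iff {x y : U} {r : ℝ} : orbitDist x y < r ↔ ∃ f : U ≃ᵢ U, dist (f x) y < r :=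
  ciInf_lt_iff ⟨0, by rintro _ ⟨f, rfl⟩; exact dist_nonneg⟩

theorem orbitDist_comm (x y : U) : orbitDist x y = orbitDist y x := by
  refine eq_of_forall_gt_iff fun r => ?_
  rw [orbitDist_lt_iff, orbitDist_lt_iff]
  constructor <;> rintro ⟨f, hf⟩ <;> refine ⟨f.symm, ?_⟩
  · rw [← f.dist_eq, f.apply_symm_apply, dist_comm]; exact hf
  · rw [← f.dist_eq, f.apply_symm_apply, dist_comm]; exact hf

/-- An isometry that brings `x` within `r` of `y` also brings it within `r` of every `z` in the
`r`-ball of `y`. So the isosceles property of ultrametrics passes to distances of orbits. -/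
theorem orbitDist_eq_of_dist_lt [IsUltrametricDist U] {x y z : U} (h : dist y z < orbitDist x y) :
    orbitDist x z = orbitDist x y := by
  have key : ∀ r y z, dist y z < r → orbitDist x y < r → orbitDist x z < r := by
    intro r y z h₁ h₂
    obtain ⟨f, hf⟩ := orbitDist_lt_iff.1 h₂
    exact orbitDist_lt_iff.2 ⟨f, (dist_triangle_max _ _ _).trans_lt (max_lt hf h₁)⟩
  refine eq_of_forall_gt_iff fun r => ⟨fun hr => ?_, fun hr => key r y z (h.trans hr) hr⟩
  by_contra hle
  exact lt_irrefl _ (key _ z y (by rwa [dist_comm]) (hr.trans_le (not_lt.1 hle)))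

theorem dist_eq_of_dist_lt [IsUltrametricDist U] {x y z : U} (h : dist y z < dist x y) :
    dist x z = dist x y := by
  refine le_antisymm ((dist_triangle_max x y z).trans (max_le le_rfl h.le)) ?_
  rcases le_max_iff.1 (dist_triangle_max x z y) with h' | h'
  · exact h'
  · exact absurd (h'.trans_lt (by rwa [dist_comm])) (lt_irrefl _)

/-- By the isosceles property a positive value does not change when both arguments are replaced by
sufficiently close terms of a dense sequence. It is stated for a general `s` so as to cover `dist`
and `orbitDist`. -/
theorem countable_pos_values [SecondCountableTopology U] {s : U → U → ℝ}
    (hcomm : ∀ x y, s x y = s y x) (hs : ∀ x y z, dist y z < s x y → s x z = s x y) :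
    {r : ℝ | 0 < r ∧ ∃ x y, s x y = r}.Countable := by
  rcases isEmpty_or_nonempty U with hU | hU
  · refine Set.Countable.mono ?_ Set.countable_empty
    rintro r ⟨-, x, -⟩
    exact (hU.false x).elim
  let e := TopologicalSpace.denseSeq U
  refine (Set.countable_range fun p : ℕ × ℕ => s (e p.1) (e p.2)).mono ?_
  rintro r ⟨hr, x, y, rfl⟩
  obtain ⟨n, hn⟩ := (TopologicalSpace.denseRange_denseSeq U).exists_dist_lt y hr
  have h₁ := hs x y _ hn
  have hr' : 0 < s (e n) x := by rw [hcomm, h₁]; exact hr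
  obtain ⟨m, hm⟩ := (TopologicalSpace.denseRange_denseSeq U).exists_dist_lt x hr'
  have h₂ := hs _ _ _ hm
  exact ⟨(m, n), by rw [← h₁, hcomm x, ← h₂, hcomm]⟩

end OrbitDist

namespace BallTree

variable {L U : Type} [MetricSpace U]

/-- Open balls together with their radius. -/
abbrev Node (U : Type) [MetricSpace U] (ρ : L → ℝ) : Type :=
  {p : L × Set U // ∃ x, p.2 = Metric.ball x (ρ p.1)}

variable {ρ : L → ℝ}

/-- The ball of radius `ρ ℓ` around `x`. -/
def node (ρ : L → ℝ) (x : U) (ℓ : L) : Node U ρ := ⟨(ℓ, Metric.ball x (ρ ℓ)), x, rfl⟩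

theorem exists_node (t : Node U ρ) : ∃ x ℓ, t = node ρ x ℓ := by
  obtain ⟨x, hx⟩ := t.2
  exact ⟨x, t.1.1, Subtype.ext (Prod.ext rfl hx)⟩

theorem node_eq_iff [IsUltrametricDist U] (hpos : ∀ ℓ, 0 < ρ ℓ) {x y : U} {ℓ : L} :
    node ρ x ℓ = node ρ y ℓ ↔ dist x y < ρ ℓ := by
  constructor
  · intro h
    have h' : Metric.ball x (ρ ℓ) = Metric.ball y (ρ ℓ) := congrArg (fun t => t.1.2) h
    have : x ∈ Metric.ball x (ρ ℓ) := Metric.mem_ball_self (hpos ℓ)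
    rwa [h'] at this
  · intro h
    have : Metric.ball y (ρ ℓ) = Metric.ball x (ρ ℓ) := IsUltrametricDist.ball_eq_of_mem h
    simp only [node, this]

theorem node_le_iff [LinearOrder L] [IsUltrametricDist U] (hρ : Monotone ρ)
    (hpos : ∀ ℓ, 0 < ρ ℓ) {x y : U} {ℓ ℓ' : L} : node ρ x ℓ ≤ node ρ y ℓ' ↔ ℓ ≤ ℓ' ∧ dist x y < ρ ℓ' := by
  refine and_congr_right fun hℓ => ⟨fun h => h (Metric.mem_ball_self (hpos ℓ)), fun h => ?_⟩
  have : Metric.ball y (ρ ℓ') = Metric.ball x (ρ ℓ') := IsUltrametricDist.ball_eq_of_mem h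
  change Metric.ball x (ρ ℓ) ⊆ Metric.ball y (ρ ℓ')
  rw [this]
  exact Metric.ball_subset_ball (hρ hℓ)

theorem countable_node [SecondCountableTopology U] [IsUltrametricDist U] [Countable L]
    (hpos : ∀ ℓ, 0 < ρ ℓ) : Countable (Node U ρ) := by
  rcases isEmpty_or_nonempty U with hU | hU
  · have : IsEmpty (Node U ρ) := ⟨fun t => by obtain ⟨x, -⟩ := t.2; exact hU.false x⟩
    infer_instance
  refine Function.Surjective.countable
    (f := fun p : L × ℕ => node ρ (TopologicalSpace.denseSeq U p.2) p.1) fun t => ?_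
  obtain ⟨x, ℓ, rfl⟩ := exists_node t
  obtain ⟨n, hn⟩ := (TopologicalSpace.denseRange_denseSeq U).exists_dist_lt x (hpos ℓ)
  exact ⟨(ℓ, n), ((node_eq_iff hpos).2 hn).symm⟩

/-- The weak tree of open balls. -/
def tree [LinearOrder L] (U : Type) [MetricSpace U] [IsUltrametricDist U] [Nonempty U] (ρ : L → ℝ)
    (hρ : Monotone ρ) (hpos : ∀ ℓ, 0 < ρ ℓ) (hunb : ∀ x y : U, ∃ ℓ, dist x y < ρ ℓ) :
    WeakLTree L (Node U ρ) where
  lam t := t.1.1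
  lam_surjective ℓ := ⟨node ρ (Classical.arbitrary U) ℓ, rfl⟩
  lam_lt t u h := by
    obtain ⟨x, ℓ, rfl⟩ := exists_node t
    obtain ⟨y, ℓ', rfl⟩ := exists_node u
    obtain ⟨h₁, h₂⟩ := (node_le_iff hρ hpos).1 h.le
    refine lt_of_le_of_ne h₁ fun e => h.ne ?_
    change ℓ = ℓ' at e
    subst e
    exact (node_eq_iff hpos).2 h₂
  existsUnique_above t ℓ' h := by
    obtain ⟨x, ℓ, rfl⟩ := exists_node t
    refine ⟨node ρ x ℓ', ⟨(node_le_iff hρ hpos).2 ⟨h, by rw [dist_self]; exact hpos _⟩, rfl⟩, ?_⟩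
    rintro s ⟨hs, rfl⟩
    obtain ⟨y, ℓ', rfl⟩ := exists_node s
    rw [eq_comm]
    exact (node_eq_iff hpos).2 ((node_le_iff hρ hpos).1 hs).2
  exists_common t u := by
    obtain ⟨x, ℓ, rfl⟩ := exists_node t
    obtain ⟨y, ℓ', rfl⟩ := exists_node u
    obtain ⟨k, hk⟩ := hunb x y
    have h₁ : ℓ ≤ max k (max ℓ ℓ') := (le_max_left _ _).trans (le_max_right _ _)
    have h₂ : ℓ' ≤ max k (max ℓ ℓ') := (le_max_right _ _).trans (le_max_right _ _)
    exact ⟨max k (max ℓ ℓ'), h₁, h₂, node ρ y _,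
      (node_le_iff hρ hpos).2 ⟨h₁, hk.trans_le (hρ (le_max_left _ _))⟩,
      (node_le_iff hρ hpos).2 ⟨h₂, by rw [dist_self]; exact hpos _⟩, rfl⟩

/-- The action of an isometry on the balls. -/
def mapNode (ρ : L → ℝ) (f : U ≃ᵢ U) (t : Node U ρ) : Node U ρ :=
  ⟨(t.1.1, f '' t.1.2), by
    obtain ⟨x, hx⟩ := t.2
    exact ⟨f x, by rw [hx]; exact f.image_ball x _⟩⟩

theorem mapNode_node (f : U ≃ᵢ U) (x : U) (ℓ : L) : mapNode ρ f (node ρ x ℓ) = node ρ (f x) ℓ :=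
  Subtype.ext (Prod.ext rfl (f.image_ball x _))

/-- The isometry group is the automorphism group of a tree of open balls, provided that the radii
comprise all distances and separate the points. The tree is special if the radii comprise also
the distances between orbits. -/
theorem exists_special_tree [LinearOrder L] [Countable L] (hU : IsPolishUltrametric U) (ρ : L → ℝ)
    (hρ : StrictMono ρ) (hpos : ∀ ℓ, 0 < ρ ℓ) (hd : ∀ x y : U, 0 < dist x y → ∃ ℓ, ρ ℓ = dist x y)
    (hs : ∀ x y : U, 0 < orbitDist x y → ∃ ℓ, ρ ℓ = orbitDist x y)
    (hunb : ∀ x y : U, ∃ ℓ, dist x y < ρ ℓ)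
    (hfine : ∀ ε > 0, ∃ ℓ, ∀ x y : U, dist x y < ρ ℓ → dist x y < ε) :
    ∃ (T : Type) (_ : PartialOrder T) (𝒯 : WeakLTree L T), 𝒯.IsLTree ∧ Countable T ∧
      𝒯.IsPruned ∧ 𝒯.IsSpecial ∧ Nonempty ((U ≃ᵢ U) ≃ₜ* 𝒯.aut) := by
  have h₁ := hU.ultrametric
  have h₂ := hU.secondCountable
  have h₃ := hU.nonempty
  have h₄ := hU.complete
  have hLne : Nonempty L := ⟨(hfine 1 one_pos).choose⟩
  let 𝒯 := tree U ρ hρ.monotone hpos hunb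
  have hle : ∀ {x y : U} {ℓ ℓ' : L}, node ρ x ℓ ≤ node ρ y ℓ' ↔ ℓ ≤ ℓ' ∧ dist x y < ρ ℓ' :=
    node_le_iff hρ.monotone hpos
  have heq : ∀ {x y : U} {ℓ : L}, node ρ x ℓ = node ρ y ℓ ↔ dist x y < ρ ℓ := node_eq_iff hpos
  have hsep : ∀ x y : U, (∀ ℓ, node ρ x ℓ = node ρ y ℓ) → x = y := by
    intro x y h
    refine eq_of_forall_dist_le fun ε hε => ?_
    obtain ⟨ℓ, hℓ⟩ := hfine ε hε
    exact (hℓ x y (heq.1 (h ℓ))).le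
  have hself : ∀ (x : U) (ℓ : L), dist x x < ρ ℓ := fun x ℓ => by rw [dist_self]; exact hpos ℓ
  let act : (U ≃ᵢ U) → 𝒯.aut := fun f =>
    ⟨{ toFun := mapNode ρ f
       invFun := mapNode ρ f.symm
       left_inv := fun t => by
        obtain ⟨x, ℓ, rfl⟩ := exists_node t
        rw [mapNode_node, mapNode_node, f.symm_apply_apply]
       right_inv := fun t => by
        obtain ⟨x, ℓ, rfl⟩ := exists_node t
        rw [mapNode_node, mapNode_node, f.apply_symm_apply] },
      fun t => rfl, fun t u => by
        obtain ⟨x, ℓ, rfl⟩ := exists_node t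
        obtain ⟨y, ℓ', rfl⟩ := exists_node u
        change _ ↔ mapNode ρ f _ ≤ mapNode ρ f _
        rw [mapNode_node, mapNode_node, hle, hle, f.dist_eq]⟩
  have hact : ∀ f x ℓ, (act f).1 (node ρ x ℓ) = node ρ (f x) ℓ := mapNode_node
  -- The images of the balls around `x` form a chain; their centres converge as the level decreases,
  -- and the limit stays in every ball of the chain because balls are closed. The hypothesis `hfine`
  -- does not ask for small radii: in a uniformly discrete space the least radius, whose balls are
  -- points, suffices.
  have hlim : ∀ (g : 𝒯.aut) (x : U), ∃ y, ∀ ℓ, g.1 (node ρ x ℓ) = node ρ y ℓ := by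
    intro g x
    have h : ∀ ℓ, ∃ y, g.1 (node ρ x ℓ) = node ρ y ℓ := fun ℓ => by
      obtain ⟨y, ℓ', hy⟩ := exists_node (g.1 (node ρ x ℓ))
      obtain rfl : ℓ' = ℓ := by
        have := g.2.1 (node ρ x ℓ)
        rwa [hy] at this
      exact ⟨y, hy⟩
    choose b hb using h
    have hbd : ∀ ℓ ℓ', ℓ ≤ ℓ' → dist (b ℓ) (b ℓ') < ρ ℓ' := fun ℓ ℓ' h => by
      have := (g.2.2 (node ρ x ℓ) (node ρ x ℓ')).1 (hle.2 ⟨h, hself _ _⟩)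
      rw [hb, hb] at this
      exact (hle.1 this).2
    have hcauchy : Cauchy (Filter.map b Filter.atBot) := by
      rw [Metric.cauchy_iff]
      refine ⟨inferInstance, fun ε hε => ?_⟩
      obtain ⟨ℓ, hℓ⟩ := hfine ε hε
      refine ⟨b '' Set.Iic ℓ, Filter.image_mem_map (Filter.Iic_mem_atBot ℓ), ?_⟩
      rintro _ ⟨k, hk, rfl⟩ _ ⟨k', hk', rfl⟩
      refine hℓ _ _ ((dist_triangle_max _ (b ℓ) _).trans_lt (max_lt (hbd _ _ hk) ?_))
      rw [dist_comm]
      exact hbd _ _ hk'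
    obtain ⟨y, hy⟩ := CompleteSpace.complete hcauchy
    refine ⟨y, fun ℓ => ?_⟩
    rw [hb, heq, dist_comm]
    change y ∈ Metric.ball (b ℓ) (ρ ℓ)
    refine (IsUltrametricDist.isClosed_ball (b ℓ) (ρ ℓ)).mem_of_tendsto (f := b)
      (b := Filter.atBot) hy ?_
    filter_upwards [Filter.Iic_mem_atBot ℓ] with k hk
    exact hbd k ℓ hk
  choose pt hpt using hlim
  have hpt_unique : ∀ (g : 𝒯.aut) x y, (∀ ℓ, g.1 (node ρ x ℓ) = node ρ y ℓ) → pt g x = y :=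
    fun g x y h => hsep _ _ fun ℓ => (hpt g x ℓ).symm.trans (h ℓ)
  have hpt_mul : ∀ g k x, pt (g * k) x = pt g (pt k x) := fun g k x =>
    hpt_unique _ _ _ fun ℓ => by
      rw [← hpt, ← hpt]; rfl
  have hpt_one : ∀ x, pt 1 x = x := fun x => hpt_unique _ _ _ fun ℓ => rfl
  -- The open balls of radius `dist x y` around `x` and `y` are different nodes, so their images are
  -- different; this needs the distance to be one of the radii. The reverse inequality comes from
  -- `g⁻¹`.
  have hdle : ∀ (g : 𝒯.aut) x y, dist x y ≤ dist (pt g x) (pt g y) := by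
    intro g x y
    by_contra hlt
    push Not at hlt
    obtain ⟨ℓ, hℓ⟩ := hd x y (dist_nonneg.trans_lt hlt)
    rw [← hℓ, ← heq, ← hpt, ← hpt] at hlt
    exact absurd (heq.1 (g.1.injective hlt)) (by rw [hℓ]; exact lt_irrefl _)
  have hinv_left : ∀ (g : 𝒯.aut) x, pt g⁻¹ (pt g x) = x := fun g x => by
    rw [← hpt_mul, inv_mul_cancel, hpt_one]
  have hinv_right : ∀ (g : 𝒯.aut) x, pt g (pt g⁻¹ x) = x := fun g x => by
    rw [← hpt_mul, mul_inv_cancel, hpt_one]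
  let iso : 𝒯.aut → (U ≃ᵢ U) := fun g =>
    { toFun := pt g
      invFun := pt g⁻¹
      left_inv := hinv_left g
      right_inv := hinv_right g
      isometry_toFun := Isometry.of_dist_eq fun x y => by
        refine le_antisymm ?_ (hdle g x y)
        have := hdle g⁻¹ (pt g x) (pt g y)
        rwa [hinv_left, hinv_left] at this }
  have hiso_act : ∀ f, iso (act f) = f := fun f => by
    ext1 x
    exact hpt_unique _ _ _ (hact f x)
  have hact_iso : ∀ g, act (iso g) = g := fun g => by
    refine Subtype.ext (Equiv.ext fun t => ?_)
    obtain ⟨x, ℓ, rfl⟩ := exists_node t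
    rw [hact, hpt]
    rfl
  have horb : ∀ {x y : U} {ℓ : L}, 𝒯.orb (node ρ x ℓ) = 𝒯.orb (node ρ y ℓ) ↔
      orbitDist x y < ρ ℓ := by
    intro x y ℓ
    rw [𝒯.orb_eq_iff, orbitDist_lt_iff]
    constructor
    · rintro ⟨g, hg, h⟩
      refine ⟨iso ⟨g, hg⟩, heq.1 ?_⟩
      rw [← hact, hact_iso]
      exact h
    · rintro ⟨f, hf⟩
      exact ⟨(act f).1, (act f).2, by rw [hact]; exact heq.2 hf⟩
  have horble : ∀ {x : U} {ℓ ℓ' : L}, ℓ ≤ ℓ' → 𝒯.orb (node ρ x ℓ) ≤ 𝒯.orb (node ρ x ℓ') :=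
    fun h => 𝒯.condensedLE_orb.2 ⟨_, rfl, hle.2 ⟨h, hself _ _⟩⟩
  refine ⟨Node U ρ, inferInstance, 𝒯, ?_, countable_node hpos, ?_, ?_, ⟨?_⟩⟩
  · intro t u htu hut
    obtain ⟨x, ℓ, rfl⟩ := exists_node t
    obtain ⟨y, ℓ', rfl⟩ := exists_node u
    have hagree : ∀ k, ℓ ≤ k → ℓ' ≤ k →
        (𝒯.AgreeAt (node ρ x ℓ) (node ρ y ℓ') k ↔ dist x y < ρ k) := by
      intro k hk hk'
      constructor
      · rintro ⟨s, hs₁, hs₂, rfl⟩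
        obtain ⟨z, k, rfl⟩ := exists_node s
        refine (dist_triangle_max x z y).trans_lt (max_lt (hle.1 hs₁).2 ?_)
        rw [dist_comm]
        exact (hle.1 hs₂).2
      · intro h
        exact ⟨node ρ y k, hle.2 ⟨hk, h⟩, hle.2 ⟨hk', hself _ _⟩, rfl⟩
    -- Incomparable balls are disjoint, so the level of radius `dist x y` lies above both. As balls
    -- are open, it is the last level of disagreement.
    have hmax : ρ (max ℓ ℓ') ≤ dist x y := by
      by_contra hlt
      rw [not_le] at hlt
      rcases le_total ℓ ℓ' with h | h
      · rw [max_eq_right h] at hlt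
        exact htu (hle.2 ⟨h, hlt⟩)
      · rw [max_eq_left h, dist_comm] at hlt
        exact hut (hle.2 ⟨h, hlt⟩)
    obtain ⟨m, hm⟩ := hd x y ((hpos _).trans_le hmax)
    rw [← hm, hρ.le_iff_le, max_le_iff] at hmax
    refine ⟨m, ⟨hmax.1, hmax.2, ?_⟩, ?_⟩
    · rw [hagree m hmax.1 hmax.2, hm]
      exact lt_irrefl _
    · rintro k ⟨hk, hk', hne⟩
      rw [hagree k hk hk', ← hm, hρ.lt_iff_lt, not_lt] at hne
      exact hne
  · intro t
    obtain ⟨x, ℓ, rfl⟩ := exists_node t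
    exact ⟨node ρ x, ⟨fun _ => rfl, fun _ _ h => hle.2 ⟨h, hself _ _⟩⟩, rfl⟩
  · intro δ ε hδε hεδ
    obtain ⟨t, rfl⟩ := 𝒯.exists_orb δ
    obtain ⟨u, rfl⟩ := 𝒯.exists_orb ε
    obtain ⟨x, ℓ, rfl⟩ := exists_node t
    obtain ⟨y, ℓ', rfl⟩ := exists_node u
    have hagree : ∀ k, ℓ ≤ k → ℓ' ≤ k →
        (𝒯.condensed.AgreeAt (𝒯.orb (node ρ x ℓ)) (𝒯.orb (node ρ y ℓ')) k ↔
          orbitDist x y < ρ k) := by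
      intro k hk hk'
      rw [← horb]
      constructor
      · rintro ⟨s, hs₁, hs₂, hs₃⟩
        have e₁ := (𝒯.condensed.existsUnique_above (𝒯.orb (node ρ x ℓ)) k hk).unique
          ⟨hs₁, hs₃⟩ ⟨horble hk, rfl⟩
        have e₂ := (𝒯.condensed.existsUnique_above (𝒯.orb (node ρ y ℓ')) k hk').unique
          ⟨hs₂, hs₃⟩ ⟨horble hk', rfl⟩
        exact e₁.symm.trans e₂
      · intro h
        exact ⟨_, horble hk, h ▸ horble hk', rfl⟩
    -- The same argument with `orbitDist` in place of `dist`; this is where the radii have to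
    -- comprise the distances between orbits.
    have hmax : ρ (max ℓ ℓ') ≤ orbitDist x y := by
      by_contra hlt
      rw [not_le] at hlt
      rcases le_total ℓ ℓ' with h | h
      · rw [max_eq_right h, ← horb] at hlt
        exact hδε (hlt ▸ horble h)
      · rw [max_eq_left h, ← horb] at hlt
        exact hεδ (hlt ▸ horble h)
    obtain ⟨m, hm⟩ := hs x y ((hpos _).trans_le hmax)
    rw [← hm, hρ.le_iff_le, max_le_iff] at hmax
    refine ⟨m, ⟨hmax.1, hmax.2, ?_⟩, ?_⟩
    · rw [hagree m hmax.1 hmax.2, hm]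
      exact lt_irrefl _
    · rintro k ⟨hk, hk', hne⟩
      rw [hagree k hk hk', ← hm, hρ.lt_iff_lt, not_lt] at hne
      exact hne
  · refine { toFun := act, invFun := iso, left_inv := hiso_act, right_inv := hact_iso,
             map_mul' := fun f g => ?_, continuous_toFun := ?_, continuous_invFun := ?_ }
    · refine Subtype.ext (Equiv.ext fun t => ?_)
      obtain ⟨x, ℓ, rfl⟩ := exists_node t
      change (act (f * g)).1 (node ρ x ℓ) = (act f).1 ((act g).1 (node ρ x ℓ))
      rw [hact, hact, hact]
      rfl
    · refine continuous_perm_subgroup_iff.2 fun t u => ?_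
      obtain ⟨x, ℓ, rfl⟩ := exists_node t
      obtain ⟨y, ℓ', rfl⟩ := exists_node u
      by_cases h : ℓ = ℓ'
      · subst h
        convert isOpen_setOf_apply_mem x (Metric.isOpen_ball (x := y) (ε := ρ ℓ)) using 3
        rw [hact, heq]
        rfl
      · convert isOpen_empty
        refine Set.eq_empty_of_forall_notMem fun f hf => h ?_
        exact congrArg (fun t => t.1.1) ((hact f x ℓ).symm.trans hf)
    · refine continuous_induced_rng.2 (continuous_pi fun x => ?_)
      refine continuous_iff_continuousAt.2 fun g => Metric.tendsto_nhds.2 fun ε hε => ?_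
      obtain ⟨ℓ, hℓ⟩ := hfine ε hε
      filter_upwards [(isOpen_apply_eq 𝒯.aut (node ρ x ℓ) (g.1 (node ρ x ℓ))).mem_nhds rfl]
        with k hk
      refine hℓ _ _ (heq.1 ?_)
      change node ρ (pt k x) ℓ = node ρ (pt g x) ℓ
      rw [← hpt, ← hpt]
      exact hk

/-- The tree of all open balls whose radius belongs to a suitable countable dense set. -/
theorem exists_special_rat_tree (hU : IsPolishUltrametric U) :
    ∃ (T : Type) (_ : PartialOrder T) (𝒯 : WeakLTree ℚ T), 𝒯.IsLTree ∧ Countable T ∧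
      𝒯.IsPruned ∧ 𝒯.IsSpecial ∧ Nonempty ((U ≃ᵢ U) ≃ₜ* 𝒯.aut) := by
  have h₁ := hU.ultrametric
  have h₂ := hU.secondCountable
  -- The positive rationals make `C` dense, unbounded and without a minimum, so that Cantor's
  -- theorem identifies it with `ℚ`.
  let C : Set ℝ := {r | 0 < r ∧ ∃ x y : U, dist x y = r} ∪
    {r | 0 < r ∧ ∃ x y : U, orbitDist x y = r} ∪ {r | 0 < r ∧ ∃ q : ℚ, (q : ℝ) = r}
  have hC : C.Countable :=
    ((countable_pos_values dist_comm fun _ _ _ => dist_eq_of_dist_lt).union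
      (countable_pos_values orbitDist_comm fun _ _ _ => orbitDist_eq_of_dist_lt)).union
      ((Set.countable_range fun q : ℚ => (q : ℝ)).mono fun r hr => hr.2)
  have hpos : ∀ c ∈ C, 0 < c := by
    rintro c ((h | h) | h) <;> exact h.1
  have hbetween : ∀ a b : ℝ, 0 ≤ a → a < b → ∃ c ∈ C, a < c ∧ c < b := fun a b ha hab => by
    obtain ⟨q, hq₁, hq₂⟩ := exists_rat_btwn hab
    exact ⟨q, Or.inr ⟨ha.trans_lt hq₁, q, rfl⟩, hq₁, hq₂⟩
  have : Countable C := hC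
  have : Nonempty C := by
    obtain ⟨c, hc, -⟩ := hbetween 0 1 le_rfl one_pos
    exact ⟨⟨c, hc⟩⟩
  have : DenselyOrdered C := ⟨fun a b hab => by
    obtain ⟨c, hc, h⟩ := hbetween a b (hpos _ a.2).le hab
    exact ⟨⟨c, hc⟩, h⟩⟩
  have : NoMinOrder C := ⟨fun a => by
    obtain ⟨c, hc, h⟩ := hbetween 0 a le_rfl (hpos _ a.2)
    exact ⟨⟨c, hc⟩, h.2⟩⟩
  have : NoMaxOrder C := ⟨fun a => by
    obtain ⟨c, hc, h⟩ := hbetween a (a + 1) (hpos _ a.2).le (lt_add_one _)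
    exact ⟨⟨c, hc⟩, h.1⟩⟩
  obtain ⟨e⟩ := Order.iso_of_countable_dense ℚ C
  have hval : ∀ c ∈ C, ∃ q, (e q : ℝ) = c := fun c hc => ⟨e.symm ⟨c, hc⟩, by simp⟩
  refine exists_special_tree hU (fun q => (e q : ℝ)) (fun p q h => e.lt_iff_lt.2 h)
    (fun q => hpos _ (e q).2) (fun x y h => hval _ (Or.inl (Or.inl ⟨h, x, y, rfl⟩)))
    (fun x y h => hval _ (Or.inl (Or.inr ⟨h, x, y, rfl⟩))) (fun x y => ?_) (fun ε hε => ?_)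
  · obtain ⟨c, hc, h, -⟩ := hbetween (dist x y) (dist x y + 1) dist_nonneg (lt_add_one _)
    obtain ⟨q, rfl⟩ := hval c hc
    exact ⟨q, h⟩
  · obtain ⟨c, hc, -, h⟩ := hbetween 0 ε le_rfl hε
    obtain ⟨q, rfl⟩ := hval c hc
    exact ⟨q, fun x y hxy => hxy.trans h⟩

/-- If all `r`-balls are points, no positive distance, of points or of orbits, is below `r`. So `r`
can serve as the least radius, and the radii `r + n` make the set of radii unbounded. -/
theorem exists_special_tree_with_bot (hU : IsPolishUltrametric U) (hD : IsUniformlyDiscrete U) :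
    ∃ (L T : Type) (_ : LinearOrder L) (_ : PartialOrder T) (𝒯 : WeakLTree L T),
      (∃ m : L, IsBot m) ∧ 𝒯.IsLTree ∧ Countable T ∧ 𝒯.IsPruned ∧ 𝒯.IsSpecial ∧
      Nonempty ((U ≃ᵢ U) ≃ₜ* 𝒯.aut) := by
  have h₁ := hU.ultrametric
  have h₂ := hU.secondCountable
  obtain ⟨r, hr, hb⟩ := hD
  have hdr : ∀ x y : U, dist x y < r ↔ x = y := fun x y => by
    rw [← Metric.mem_ball, hb, Set.mem_singleton_iff]
  let C : Set ℝ := {r | 0 < r ∧ ∃ x y : U, dist x y = r} ∪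
    {r | 0 < r ∧ ∃ x y : U, orbitDist x y = r} ∪ Set.range fun n : ℕ => r + n
  have hC : Countable C :=
    ((countable_pos_values dist_comm fun _ _ _ => dist_eq_of_dist_lt).union
      (countable_pos_values orbitDist_comm fun _ _ _ => orbitDist_eq_of_dist_lt)).union
      (Set.countable_range _)
  have hrC : ∀ c ∈ C, r ≤ c := by
    rintro c ((⟨hc, x, y, rfl⟩ | ⟨hc, x, y, rfl⟩) | ⟨n, rfl⟩)
    · by_contra hlt
      rw [not_le, hdr] at hlt
      rw [hlt, dist_self] at hc
      exact lt_irrefl _ hc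
    · by_contra hlt
      rw [not_le, orbitDist_lt_iff] at hlt
      obtain ⟨f, hf⟩ := hlt
      rw [hdr] at hf
      refine hc.not_ge (le_of_forall_pos_lt_add fun ε hε => ?_)
      refine orbitDist_lt_iff.2 ⟨f, ?_⟩
      rwa [hf, dist_self, zero_add]
    · simp
  obtain ⟨T, i, 𝒯, h⟩ := exists_special_tree (L := C) hU Subtype.val (fun _ _ h => h)
    (fun c => hr.trans_le (hrC c c.2)) (fun x y h => ⟨⟨_, Or.inl (Or.inl ⟨h, x, y, rfl⟩)⟩, rfl⟩)
    (fun x y h => ⟨⟨_, Or.inl (Or.inr ⟨h, x, y, rfl⟩)⟩, rfl⟩)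
    (fun x y => by
      obtain ⟨n, hn⟩ := exists_nat_gt (dist x y)
      exact ⟨⟨r + n, Or.inr ⟨n, rfl⟩⟩, hn.trans (by simpa using hr)⟩)
    (fun ε hε => ⟨⟨r, Or.inr ⟨0, by simp⟩⟩, fun x y h => by
      rw [(hdr x y).1 h, dist_self]; exact hε⟩)
  exact ⟨C, T, inferInstance, i, 𝒯, ⟨⟨r, Or.inr ⟨0, by simp⟩⟩, fun c => hrC c c.2⟩, h⟩

end BallTree

/-! ## Trees and projective wreath products as forests -/

theorem nonempty_continuousMulEquiv_of_subsingleton (G H : Type*) [Group G] [TopologicalSpace G]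
    [Group H] [TopologicalSpace H] [Subsingleton G] [Subsingleton H] : Nonempty (G ≃ₜ* H) :=
  ⟨{ toFun := fun _ => 1, invFun := fun _ => 1, left_inv := fun _ => Subsingleton.elim _ _,
     right_inv := fun _ => Subsingleton.elim _ _, map_mul' := fun _ _ => Subsingleton.elim _ _,
     continuous_toFun := continuous_const, continuous_invFun := continuous_const }⟩

/-- The forest underlying an `L`-tree. -/
def WeakLTree.toForest {L T : Type} [LinearOrder L] [PartialOrder T] (𝒯 : WeakLTree L T)
    (h : 𝒯.IsLTree) : LevelledForest L T where
  rel t u := t ≤ u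
  lam := 𝒯.lam
  rel_refl := le_refl
  rel_trans _ _ _ := le_trans
  lam_mono _ _ := 𝒯.lam_mono
  existsUnique_above := 𝒯.existsUnique_above
  exists_greatest := h

/-- A constant colour suffices, as automorphisms of a tree only respect order and levels. The empty
tree over the empty order is admitted and corresponds to the one-point space. -/
theorem WeakLTree.exists_uniformlyDiscrete {L T : Type} [LinearOrder L] [PartialOrder T]
    (𝒯 : WeakLTree L T) (h : 𝒯.IsLTree) [Countable T] :
    ∃ (U : Type) (_ : MetricSpace U), IsPolishUltrametric U ∧ IsUniformlyDiscrete U ∧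
      Nonempty (𝒯.aut ≃ₜ* (U ≃ᵢ U)) := by
  rcases isEmpty_or_nonempty T with hT | hT
  · refine ⟨Unit, inferInstance, ⟨inferInstance, ⟨fun _ _ _ => by simp⟩, inferInstance,
      inferInstance⟩, ⟨1, one_pos, fun x => ?_⟩, ?_⟩
    · exact Set.eq_singleton_iff_unique_mem.2
        ⟨Metric.mem_ball_self one_pos, fun _ _ => Subsingleton.elim _ _⟩
    · have : Subsingleton (Unit ≃ᵢ Unit) := ⟨fun f g => by ext1 x; rfl⟩
      exact nonempty_continuousMulEquiv_of_subsingleton _ _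
  · have : Countable L := 𝒯.lam_surjective.countable
    obtain ⟨U, i, h₁, h₂, h₃⟩ := (𝒯.toForest h).exists_uniformlyDiscrete fun _ => 0
    refine ⟨U, i, h₁, h₂, ?_⟩
    have e : 𝒯.aut = (𝒯.toForest h).colouredAut fun _ => 0 := by
      ext f
      exact ⟨fun hf => ⟨fun t => ⟨hf.1 t, rfl⟩, hf.2⟩, fun hf => ⟨fun t => (hf.1 t).1, hf.2⟩⟩
    rw [e]
    exact h₃

/-! ### The sequences of a projective wreath product, ordered by the projections -/

namespace ProjSystem

variable {Δ : Type} [PartialOrder Δ] {N : Δ → ℕ∞} (P : ProjSystem N)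

theorem proj_self {δ : Δ} (h : δ ≤ δ) (z : P.S δ) : P.proj h z = z := by
  obtain ⟨w, rfl⟩ := P.proj_surjective h z
  exact P.proj_comp h h w

theorem up_up (p : P.Point) {γ β : Δ} (h : p.1 ≤ γ) (h' : γ ≤ β) :
    P.up (P.up p h) (γ := β) h' = P.up p (h.trans h') :=
  congrArg (Sigma.mk β) (P.proj_comp h h' p.2)

/-- For the full symmetric groups, the condition on the action on single coordinates is void. -/
theorem mem_wrSym_iff {g : Equiv.Perm P.Point} : g ∈ P.wrSym ↔ P.PreservesProj g := by
  refine ⟨fun h => h.1, fun hg => ⟨hg, ?_⟩⟩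
  have val : ∀ {k : Equiv.Perm P.Point}, P.PreservesProj k → ∀ {δ : Δ} {z w : P.S δ},
      k ⟨δ, z⟩ = ⟨δ, w⟩ → ∀ i, ∃ j, k (P.pert ⟨δ, z⟩ i) = P.pert ⟨δ, w⟩ j := by
    intro k hk δ z w hzw i
    obtain ⟨v, hv⟩ := P.exists_map_eq hk (P.pert ⟨δ, z⟩ i).2
    change k (P.pert ⟨δ, z⟩ i) = ⟨δ, v⟩ at hv
    refine ⟨v.1 ⟨δ, le_rfl⟩, P.map_pert hk hzw i _ ?_⟩
    rw [hv]
    exact fun _ => rfl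
  have pert_inj : ∀ {δ : Δ} (z : P.S δ) {i j : Label (N δ)},
      P.pert ⟨δ, z⟩ i = P.pert ⟨δ, z⟩ j → i = j := by
    intro δ z i j h
    have h' := congrArg Subtype.val (eq_of_heq (Sigma.mk.inj h).2)
    have := congrFun h' ⟨δ, le_rfl⟩
    simpa [pert_self] using this
  rintro ⟨δ, z⟩
  obtain ⟨w, hw⟩ := P.exists_map_eq hg z
  have hw' : g⁻¹ ⟨δ, w⟩ = ⟨δ, z⟩ := by rw [← hw]; simp
  choose σ hσ using val hg hw
  -- The inverse permutation of labels is induced by `g⁻¹` at the image of `z`.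
  choose τ hτ using val hg.inv hw'
  refine ⟨⟨σ, τ, fun i => pert_inj z ?_, fun i => pert_inj w ?_⟩, trivial, fun i => ?_⟩
  · rw [← hτ, ← hσ]; simp
  · rw [← hσ, ← hτ]; simp
  · change ∀ h : (g (P.pert ⟨δ, z⟩ i)).1 ≤ δ, (g (P.pert ⟨δ, z⟩ i)).2.1 ⟨δ, h⟩ = σ i
    rw [hσ]
    exact fun _ => pert_self w.1 (σ i)

/-- The order of the union of the `S δ` given by the projections. -/
def PointLE (p q : P.Point) : Prop := ∃ h : p.1 ≤ q.1, P.up p h = q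

theorem pointLE_up (p : P.Point) {γ : Δ} (h : p.1 ≤ γ) : P.PointLE p (P.up p h) := ⟨h, rfl⟩

variable {P} in
theorem PointLE.exists_up {p q : P.Point} (h : P.PointLE p q) :
    ∃ (γ : Δ) (h : p.1 ≤ γ), P.up p h = q :=
  ⟨q.1, h⟩

theorem preservesProj_iff {g : Equiv.Perm P.Point} : P.PreservesProj g ↔
    (∀ p, (g p).1 = p.1) ∧ ∀ p q, P.PointLE p q ↔ P.PointLE (g p) (g q) := by
  have half : ∀ {k : Equiv.Perm P.Point}, P.PreservesProj k → ∀ p q,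
      P.PointLE p q → P.PointLE (k p) (k q) := by
    intro k hk p q hpq
    obtain ⟨γ, h, rfl⟩ := hpq.exists_up
    have h' : (k p).1 ≤ (P.up p h).1 := (hk.1 p).trans_le h
    rw [hk.2 p _ h h']
    exact P.pointLE_up _ _
  constructor
  · intro hg
    refine ⟨hg.1, fun p q => ⟨half hg p q, fun h => ?_⟩⟩
    simpa using half hg.inv _ _ h
  · rintro ⟨h₁, h₂⟩
    refine ⟨h₁, fun p γ h h' => ?_⟩
    obtain ⟨h₃, h₄⟩ := (h₂ p (P.up p h)).1 (P.pointLE_up p h)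
    rw [← h₄]
    have e : (g (P.up p h)).1 = γ := h₁ _
    revert h₃
    rw [e]
    exact fun _ _ => rfl

/-- Sequences with the maximum condition have a greatest coordinate of disagreement. -/
theorem exists_greatest_disagreement (hS : ∀ δ, P.S δ ⊆ admissibleLocal N (suppMax Δ) δ)
    {γ : Δ} (htot : ∀ α β : Δ, γ ≤ α → γ ≤ β → α ≤ β ∨ β ≤ α) {z w : P.S γ} (hne : z ≠ w) :
    ∃ (α : Δ) (h : γ ≤ α), z.1 ⟨α, h⟩ ≠ w.1 ⟨α, h⟩ ∧
      ∀ (β : Δ) (h : γ ≤ β), z.1 ⟨β, h⟩ ≠ w.1 ⟨β, h⟩ → β ≤ α := by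
  obtain ⟨x, hx, hzx⟩ := hS γ z.2
  obtain ⟨y, hy, hwy⟩ := hS γ w.2
  let B : Set Δ := {α | ∃ h : γ ≤ α, z.1 ⟨α, h⟩ ≠ w.1 ⟨α, h⟩}
  have hBne : B.Nonempty := by
    by_contra hB
    refine hne (Subtype.ext (funext fun α => ?_))
    by_contra h
    exact hB ⟨α.1, α.2, h⟩
  -- Where both sequences vanish they agree. The cone is a chain, so maximal elements of the two
  -- parts of `B` are greatest, and the larger of the two is the greatest element of `B`.
  have hBsub : B ⊆ seqSupport x ∪ seqSupport y := by
    rintro α ⟨h, hα⟩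
    by_contra hcon
    simp only [seqSupport, Set.mem_union, Set.mem_ofPred_eq, not_or, not_not] at hcon
    refine hα (Subtype.ext ?_)
    rw [hzx, hwy, hcon.1, hcon.2]
  have hmax : ∀ A : Set Δ, A ∈ suppMax Δ → (B ∩ A).Nonempty →
      ∃ m ∈ B ∩ A, ∀ b ∈ B ∩ A, b ≤ m := by
    intro A hA hne
    obtain ⟨m, hm⟩ := hA (B ∩ A) Set.inter_subset_right hne
    refine ⟨m, hm.prop, fun b hb => ?_⟩
    rcases htot b m hb.1.1 hm.prop.1.1 with h | h
    · exact h
    · exact hm.le_of_ge hb h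
  suffices ∃ m ∈ B, ∀ b ∈ B, b ≤ m by
    obtain ⟨m, ⟨hm, hm'⟩, h⟩ := this
    exact ⟨m, hm, hm', fun β hβ hβ' => h β ⟨hβ, hβ'⟩⟩
  by_cases h₁ : (B ∩ seqSupport x).Nonempty
  · obtain ⟨m, hm, hm'⟩ := hmax _ hx h₁
    by_cases h₂ : (B ∩ seqSupport y).Nonempty
    · obtain ⟨k, hk, hk'⟩ := hmax _ hy h₂
      rcases htot m k hm.1.1 hk.1.1 with h | h
      · refine ⟨k, hk.1, fun b hb => ?_⟩
        rcases hBsub hb with h' | h'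
        exacts [(hm' b ⟨hb, h'⟩).trans h, hk' b ⟨hb, h'⟩]
      · refine ⟨m, hm.1, fun b hb => ?_⟩
        rcases hBsub hb with h' | h'
        exacts [hm' b ⟨hb, h'⟩, (hk' b ⟨hb, h'⟩).trans h]
    · refine ⟨m, hm.1, fun b hb => ?_⟩
      rcases hBsub hb with h' | h'
      exacts [hm' b ⟨hb, h'⟩, absurd ⟨b, hb, h'⟩ h₂]
  · have h₂ : (B ∩ seqSupport y).Nonempty := by
      obtain ⟨b, hb⟩ := hBne
      rcases hBsub hb with h' | h'
      exacts [absurd ⟨b, hb, h'⟩ h₁, ⟨b, hb, h'⟩]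
    obtain ⟨k, hk, hk'⟩ := hmax _ hy h₂
    refine ⟨k, hk.1, fun b hb => ?_⟩
    rcases hBsub hb with h' | h'
    exacts [absurd ⟨b, hb, h'⟩ h₁, hk' b ⟨hb, h'⟩]

end ProjSystem

theorem WeakLTree.le_of_le_of_le {L T : Type*} [LinearOrder L] [PartialOrder T]
    (𝒯 : WeakLTree L T) {t u v : T} (hu : t ≤ u) (hv : t ≤ v) (h : 𝒯.lam u ≤ 𝒯.lam v) :
    u ≤ v := by
  obtain ⟨w, ⟨huw, hw⟩, -⟩ := 𝒯.existsUnique_above u _ h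
  rwa [(𝒯.existsUnique_above t (𝒯.lam v) (𝒯.lam_mono hv)).unique ⟨hu.trans huw, hw⟩ ⟨hv, rfl⟩]
    at huw

theorem WeakLTree.total_above {L T : Type*} [LinearOrder L] [PartialOrder T]
    (𝒯 : WeakLTree L T) {t u v : T} (hu : t ≤ u) (hv : t ≤ v) : u ≤ v ∨ v ≤ u :=
  (le_total (𝒯.lam u) (𝒯.lam v)).imp (𝒯.le_of_le_of_le hu hv) (𝒯.le_of_le_of_le hv hu)

theorem WeakLTree.eq_of_le_of_lam_eq {L T : Type*} [LinearOrder L] [PartialOrder T]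
    (𝒯 : WeakLTree L T) {t u : T} (h : t ≤ u) (hl : 𝒯.lam t = 𝒯.lam u) : t = u :=
  h.eq_of_not_lt fun hlt => (𝒯.lam_lt _ _ hlt).ne hl

namespace ProjSystem

variable {Δ : Type} [PartialOrder Δ] {N : Δ → ℕ∞} (P : ProjSystem N)

theorem exists_greatest_level {L : Type} [LinearOrder L] (𝒯 : WeakLTree L Δ)
    (hS : ∀ δ, P.S δ ⊆ admissibleLocal N (suppMax Δ) δ) {p q : P.Point} {γ : Δ} (hp : p.1 ≤ γ)
    (hq : q.1 ≤ γ) (hne : P.up p hp ≠ P.up q hq) :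
    ∃ m, IsGreatest {ℓ | 𝒯.lam p.1 ≤ ℓ ∧ 𝒯.lam q.1 ≤ ℓ ∧
      ¬ ∃ s, P.PointLE p s ∧ P.PointLE q s ∧ 𝒯.lam s.1 = ℓ} m := by
  have key : ∀ {β : Δ} (h : γ ≤ β), (∃ s : P.Point, P.PointLE p s ∧ P.PointLE q s ∧
      𝒯.lam s.1 = 𝒯.lam β) ↔ (P.proj hp p.2).1.restrict h = (P.proj hq q.2).1.restrict h := by
    intro β h
    rw [← P.proj_eq_iff, P.proj_comp, P.proj_comp]
    constructor
    · rintro ⟨⟨β', s⟩, ⟨h₁, h₂⟩, ⟨h₃, h₄⟩, h₅⟩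
      obtain rfl : β' = β := (𝒯.existsUnique_above p.1 (𝒯.lam β) (𝒯.lam_mono (hp.trans h))).unique
        ⟨h₁, h₅⟩ ⟨hp.trans h, rfl⟩
      exact eq_of_heq (Sigma.mk.inj (h₂.trans h₄.symm)).2
    · intro e
      exact ⟨⟨β, _⟩, P.pointLE_up p (hp.trans h), ⟨hq.trans h, congrArg (Sigma.mk β) e.symm⟩, rfl⟩
  obtain ⟨α, hα, hα₁, hα₂⟩ := P.exists_greatest_disagreement hS
    (fun α β hα hβ => 𝒯.total_above hα hβ) (z := P.proj hp p.2) (w := P.proj hq q.2)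
    (fun e => hne (congrArg (Sigma.mk γ) e))
  refine ⟨𝒯.lam α, ⟨𝒯.lam_mono (hp.trans hα), 𝒯.lam_mono (hq.trans hα), ?_⟩, ?_⟩
  · rw [key hα]
    intro e
    exact hα₁ (congrFun e ⟨α, le_rfl⟩)
  · rintro ℓ ⟨hℓ₁, hℓ₂, hℓ₃⟩
    by_contra hlt
    rw [not_le] at hlt
    obtain ⟨β, ⟨hβ, rfl⟩, -⟩ := 𝒯.existsUnique_above α ℓ hlt.le
    refine hℓ₃ ((key (hα.trans hβ)).2 (funext fun ε => ?_))
    by_contra hε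
    have := hα₂ ε.1 (hα.trans (hβ.trans ε.2)) hε
    exact absurd (𝒯.lam_mono (ε.2.trans this)) (not_le.2 hlt)

/-- The forest on the union of the `S δ`. -/
def toForest {L : Type} [LinearOrder L] (𝒯 : WeakLTree L Δ) (h𝒯 : 𝒯.IsLTree)
    (hS : ∀ δ, P.S δ ⊆ admissibleLocal N (suppMax Δ) δ) : LevelledForest L P.Point where
  rel := P.PointLE
  lam p := 𝒯.lam p.1
  rel_refl p := ⟨le_rfl, congrArg (Sigma.mk p.1) (P.proj_self _ p.2)⟩
  rel_trans := by
    intro p q r hpq hqr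
    obtain ⟨γ, h₁, rfl⟩ := hpq.exists_up
    obtain ⟨β, h₂, rfl⟩ := hqr.exists_up
    rw [P.up_up p h₁ h₂]
    exact P.pointLE_up p _
  lam_mono p q h := 𝒯.lam_mono h.1
  existsUnique_above p ℓ h := by
    obtain ⟨γ, ⟨hγ, rfl⟩, hu⟩ := 𝒯.existsUnique_above p.1 ℓ h
    refine ⟨P.up p hγ, ⟨P.pointLE_up p hγ, rfl⟩, ?_⟩
    rintro ⟨γ', z⟩ ⟨⟨h₁, h₂⟩, h₃⟩
    obtain rfl : γ' = γ := hu γ' ⟨h₁, h₃⟩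
    exact h₂.symm
  exists_greatest p q hpq hqp := by
    by_cases h₁ : p.1 ≤ q.1
    · refine P.exists_greatest_level 𝒯 hS h₁ le_rfl fun e => hpq ⟨h₁, e.trans ?_⟩
      exact congrArg (Sigma.mk q.1) (P.proj_self _ q.2)
    by_cases h₂ : q.1 ≤ p.1
    · refine P.exists_greatest_level 𝒯 hS le_rfl h₂ fun e => hqp ⟨h₂, e.symm.trans ?_⟩
      exact congrArg (Sigma.mk p.1) (P.proj_self _ p.2)
    -- If the projections differ at some common upper bound, the last disagreement is one of
    -- sequences. Otherwise `p` and `q` disagree exactly at the levels where `p.1` and `q.1` do, and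
    -- the skeleton decides.
    by_cases h₃ : ∃ (γ : Δ) (hp : p.1 ≤ γ) (hq : q.1 ≤ γ), P.up p hp ≠ P.up q hq
    · obtain ⟨γ, hp, hq, hne⟩ := h₃
      exact P.exists_greatest_level 𝒯 hS hp hq hne
    · push Not at h₃
      convert h𝒯 p.1 q.1 h₁ h₂ using 6 with m ℓ
      refine and_congr_right fun _ => not_congr ?_
      constructor
      · rintro ⟨s, hs₁, hs₂, hs₃⟩
        exact ⟨s.1, hs₁.1, hs₂.1, hs₃⟩
      · rintro ⟨γ, hp, hq, rfl⟩
        exact ⟨P.up p hp, P.pointLE_up p hp, ⟨hq, (h₃ γ hp hq).symm⟩, rfl⟩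

/-- Several `δ` may share a level, and the wreath product must preserve each `S δ`; an injective
colouring of `Δ` enforces this. A forest is needed rather than a tree, since sequences may differ at
a greatest element of `Δ`. -/
theorem exists_uniformlyDiscrete (hΔ : IsCountableTreeableSkeleton Δ N)
    (hS : ∀ δ, P.S δ ⊆ admissibleLocal N (suppMax Δ) δ) [Countable P.Point] :
    ∃ (U : Type) (_ : MetricSpace U), IsPolishUltrametric U ∧ IsUniformlyDiscrete U ∧
      Nonempty (P.wrSym ≃ₜ* (U ≃ᵢ U)) := by
  obtain ⟨L, _, 𝒯, h𝒯, -⟩ := hΔ.treeable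
  have := hΔ.countable
  obtain ⟨δ⟩ := hΔ.nonempty
  have : Nonempty P.Point := ⟨⟨δ, _, (P.nonempty δ).some_mem⟩⟩
  have : Countable L := 𝒯.lam_surjective.countable
  obtain ⟨κ, hκ⟩ := exists_injective_nat Δ
  obtain ⟨U, i, h₁, h₂, h₃⟩ := (P.toForest 𝒯 h𝒯 hS).exists_uniformlyDiscrete fun p => κ p.1
  refine ⟨U, i, h₁, h₂, ?_⟩
  have e : P.wrSym = (P.toForest 𝒯 h𝒯 hS).colouredAut fun p => κ p.1 := by
    ext g
    rw [P.mem_wrSym_iff, P.preservesProj_iff]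
    exact and_congr_left fun _ => forall_congr' fun p =>
      ⟨fun h => ⟨congrArg 𝒯.lam h, congrArg κ h⟩, fun h => hκ h.2⟩
  rw [e]
  exact h₃

end ProjSystem

/-! ## Back and forth between families of sequences -/

section BackAndForth

variable {C X Y : Type} [PartialOrder C]

/-- The one-point extension step of the back-and-forth. Let `p₀` be a partner closest to `x`, and
`γ` their last disagreement. The new point copies the partner of `p₀` above `γ` and takes an unused
label at `γ`. -/
theorem exists_extension {n : C → ℕ∞} (htot : ∀ α β : C, α ≤ β ∨ β ≤ α) [Nonempty Y]
    (A : X → C → ℕ) (B : Y → C → ℕ) (hA : ∀ x γ, (A x γ : ℕ∞) < n γ)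
    (hA' : ∀ x y, x ≠ y → ∃ γ, A x γ ≠ A y γ ∧ ∀ β, γ < β → A x β = A y β)
    (hB : ∀ y γ (i : ℕ), (i : ℕ∞) < n γ → ∃ w, B w γ = i ∧ ∀ β, γ < β → B w β = B y β)
    (F : Finset (X × Y))
    (hF : ∀ p ∈ F, ∀ q ∈ F, ∀ γ, (∀ β, γ ≤ β → A p.1 β = A q.1 β) ↔
      ∀ β, γ ≤ β → B p.2 β = B q.2 β) (x : X) :
    ∃ y, ∀ p ∈ F, ∀ γ, (∀ β, γ ≤ β → A p.1 β = A x β) ↔ ∀ β, γ ≤ β → B p.2 β = B y β := by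
  classical
  by_cases hx : ∃ p ∈ F, p.1 = x
  · obtain ⟨p, hp, rfl⟩ := hx
    exact ⟨p.2, fun q hq => hF q hq p hp⟩
  push Not at hx
  rcases F.eq_empty_or_nonempty with rfl | hne
  · exact ⟨Classical.arbitrary Y, by simp⟩
  have hm : ∀ p : F, ∃ γ, A p.1.1 γ ≠ A x γ ∧ ∀ β, γ < β → A p.1.1 β = A x β :=
    fun p => hA' _ _ (hx p.1 p.2)
  choose m hm₁ hm₂ using hm
  have : Nonempty F := hne.to_subtype
  obtain ⟨p₀, hp₀⟩ := Set.finite_univ.exists_minimalFor m Set.univ Set.univ_nonempty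
  have hmin : ∀ p : F, m p₀ ≤ m p := fun p =>
    (htot _ _).elim id fun h => hp₀.2 (Set.mem_univ p) h
  set γ := m p₀ with hγ
  -- a free label in the class of `p₀`
  obtain ⟨i, hi, hfree⟩ : ∃ i : ℕ, (i : ℕ∞) < n γ ∧ ∀ p ∈ F,
      (∀ β, γ < β → B p.2 β = B p₀.1.2 β) → B p.2 γ ≠ i := by
    -- If all labels were used, `n γ` would be finite, and the first components of the pairs using
    -- them would agree above `γ` and carry pairwise different labels at `γ`. By counting, one of
    -- these is the label of `x`, so that pair is closer to `x` than `p₀`.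
    by_contra hcon
    push Not at hcon
    have hex : ∀ i : Label (n γ), ∃ p : F, (∀ β, γ < β → B p.1.2 β = B p₀.1.2 β) ∧
        B p.1.2 γ = i.1 := fun i => by
      obtain ⟨p, hp, h⟩ := hcon i.1 i.2
      exact ⟨⟨p, hp⟩, h⟩
    choose φ hφ₁ hφ₂ using hex
    have hfin : Finite (Label (n γ)) := Finite.of_injective φ fun i j h =>
      Subtype.ext (by rw [← hφ₂ i, ← hφ₂ j, h])
    have hagree : ∀ i j, ∀ β, γ < β → A (φ i).1.1 β = A (φ j).1.1 β := by
      intro i j β hβ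
      refine (hF _ (φ i).2 _ (φ j).2 β).2 (fun ε hε => ?_) β le_rfl
      rw [hφ₁ i ε (hβ.trans_le hε), hφ₁ j ε (hβ.trans_le hε)]
    have hagree₀ : ∀ i, ∀ β, γ < β → A (φ i).1.1 β = A x β := by
      intro i β hβ
      rw [← hm₂ p₀ β hβ]
      refine (hF _ (φ i).2 _ p₀.2 β).2 (fun ε hε => ?_) β le_rfl
      rw [hφ₁ i ε (hβ.trans_le hε)]
    let ψ : Label (n γ) → Label (n γ) := fun i => ⟨A (φ i).1.1 γ, hA _ _⟩
    have hψ : Function.Injective ψ := by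
      intro i j h
      have h' : A (φ i).1.1 γ = A (φ j).1.1 γ := congrArg Subtype.val h
      have := (hF _ (φ i).2 _ (φ j).2 γ).1 (fun β hβ => by
        rcases hβ.eq_or_lt with rfl | hβ
        exacts [h', hagree i j β hβ]) γ le_rfl
      exact Subtype.ext (by rw [← hφ₂ i, ← hφ₂ j, this])
    obtain ⟨i, hi⟩ := Finite.injective_iff_surjective.1 hψ ⟨A x γ, hA x γ⟩
    have hi' : A (φ i).1.1 γ = A x γ := congrArg Subtype.val hi
    refine hm₁ (φ i) ?_
    rcases (hmin (φ i)).eq_or_lt with h | h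
    · rw [← h]; exact hi'
    · exact hagree₀ i _ h
  obtain ⟨y, hy₁, hy₂⟩ := hB p₀.1.2 γ i hi
  refine ⟨y, fun p hp γ' => ?_⟩
  by_cases hγ' : γ < γ'
  · have e₁ : (∀ β, γ' ≤ β → A p.1 β = A x β) ↔ ∀ β, γ' ≤ β → A p.1 β = A p₀.1.1 β :=
      forall₂_congr fun β hβ => by rw [hm₂ p₀ β (hγ'.trans_le hβ)]
    have e₂ : (∀ β, γ' ≤ β → B p.2 β = B y β) ↔ ∀ β, γ' ≤ β → B p.2 β = B p₀.1.2 β :=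
      forall₂_congr fun β hβ => by rw [hy₂ β (hγ'.trans_le hβ)]
    rw [e₁, e₂]
    exact hF p hp p₀.1 p₀.2 γ'
  · have hle : γ' ≤ γ := (htot γ' γ).elim id fun h => (h.eq_of_not_lt hγ').ge
    refine iff_of_false (fun h => ?_) (fun h => ?_)
    · exact hm₁ ⟨p, hp⟩ (h _ (hle.trans (hmin ⟨p, hp⟩)))
    · refine hfree p hp (fun β hβ => ?_) ?_
      · rw [h β (hle.trans hβ.le), hy₂ β hβ]
      · rw [h γ hle, hy₁]

/-- Two countable families of sequences that realize all labels, and in which any two members have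
a greatest coordinate of disagreement, are isomorphic. -/
theorem exists_equiv_of_back_and_forth [Countable X] [Countable Y] [Nonempty X] [Nonempty Y]
    {n : C → ℕ∞} (htot : ∀ α β : C, α ≤ β ∨ β ≤ α) (A : X → C → ℕ) (B : Y → C → ℕ)
    (hA₁ : ∀ x γ, (A x γ : ℕ∞) < n γ) (hB₁ : ∀ y γ, (B y γ : ℕ∞) < n γ)
    (hA₂ : ∀ x y, x ≠ y → ∃ γ, A x γ ≠ A y γ ∧ ∀ β, γ < β → A x β = A y β)
    (hB₂ : ∀ x y, x ≠ y → ∃ γ, B x γ ≠ B y γ ∧ ∀ β, γ < β → B x β = B y β)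
    (hA₃ : ∀ y γ (i : ℕ), (i : ℕ∞) < n γ → ∃ w, A w γ = i ∧ ∀ β, γ < β → A w β = A y β)
    (hB₃ : ∀ y γ (i : ℕ), (i : ℕ∞) < n γ → ∃ w, B w γ = i ∧ ∀ β, γ < β → B w β = B y β) :
    ∃ e : X ≃ Y, ∀ x x' γ, (∀ β, γ ≤ β → A x β = A x' β) ↔
      ∀ β, γ ≤ β → B (e x) β = B (e x') β := by
  classical
  cases nonempty_encodable X
  cases nonempty_encodable Y
  let Part : Type := {F : Finset (X × Y) // ∀ p ∈ F, ∀ q ∈ F, ∀ γ,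
    (∀ β, γ ≤ β → A p.1 β = A q.1 β) ↔ ∀ β, γ ≤ β → B p.2 β = B q.2 β}
  have hins : ∀ (F : Part) (p : X × Y), (∀ q ∈ F.1, ∀ γ, (∀ β, γ ≤ β → A q.1 β = A p.1 β) ↔
      ∀ β, γ ≤ β → B q.2 β = B p.2 β) → ∃ F' : Part, p ∈ F'.1 ∧ F ≤ F' := by
    intro F p hp
    refine ⟨⟨insert p F.1, fun q hq r hr γ => ?_⟩, Finset.mem_insert_self _ _,
      Finset.subset_insert _ _⟩
    rw [Finset.mem_insert] at hq hr
    rcases hq with rfl | hq <;> rcases hr with rfl | hr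
    · simp
    · have := hp r hr γ
      simpa only [eq_comm] using this
    · exact hp q hq γ
    · exact F.2 q hq r hr γ
  let D : X ⊕ Y → Order.Cofinal Part := fun s =>
    { carrier := {F | Sum.elim (fun x => ∃ y, (x, y) ∈ F.1) (fun y => ∃ x, (x, y) ∈ F.1) s}
      isCofinal := fun F => by
        rcases s with x | y
        · obtain ⟨y, hy⟩ := exists_extension htot A B hA₁ hA₂ hB₃ F.1 F.2 x
          obtain ⟨F', h₁, h₂⟩ := hins F (x, y) hy
          exact ⟨F', ⟨y, h₁⟩, h₂⟩
        · obtain ⟨x, hx⟩ := exists_extension htot B A hB₁ hB₂ hA₃ (F.1.image Prod.swap)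
            (fun p hp q hq γ => by
              obtain ⟨p, hp', rfl⟩ := Finset.mem_image.1 hp
              obtain ⟨q, hq', rfl⟩ := Finset.mem_image.1 hq
              exact (F.2 p hp' q hq' γ).symm) y
          obtain ⟨F', h₁, h₂⟩ := hins F (x, y) fun q hq γ =>
            (hx q.swap (Finset.mem_image_of_mem _ hq) γ).symm
          exact ⟨F', ⟨x, h₁⟩, h₂⟩ }
  let I := Order.idealOfCofinals (⟨∅, by simp⟩ : Part) D
  have hf : ∀ x, ∃ y, ∃ F ∈ I, (x, y) ∈ F.1 := fun x => by
    obtain ⟨F, ⟨y, hy⟩, hF⟩ := Order.cofinal_meets_idealOfCofinals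
      (⟨∅, by simp⟩ : Part) D (Sum.inl x)
    exact ⟨y, F, hF, hy⟩
  have hg : ∀ y, ∃ x, ∃ F ∈ I, (x, y) ∈ F.1 := fun y => by
    obtain ⟨F, ⟨x, hx⟩, hF⟩ := Order.cofinal_meets_idealOfCofinals
      (⟨∅, by simp⟩ : Part) D (Sum.inr y)
    exact ⟨x, F, hF, hx⟩
  have hcompat : ∀ p q : X × Y, (∃ F ∈ I, p ∈ F.1) → (∃ F ∈ I, q ∈ F.1) → ∀ γ,
      (∀ β, γ ≤ β → A p.1 β = A q.1 β) ↔ ∀ β, γ ≤ β → B p.2 β = B q.2 β := by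
    rintro p q ⟨F, hF, hp⟩ ⟨F', hF', hq⟩
    obtain ⟨M, -, h₁, h₂⟩ := I.directed _ hF _ hF'
    exact M.2 p (h₁ hp) q (h₂ hq)
  choose f hf using hf
  choose g hg using hg
  refine ⟨⟨f, g, fun x => ?_, fun y => ?_⟩, fun x x' => hcompat (x, f x) (x', f x') (hf x) (hf x')⟩
  · by_contra hne
    obtain ⟨γ, h, -⟩ := hA₂ _ _ hne
    exact h ((hcompat (g (f x), f x) (x, f x) (hg _) (hf x) γ).2 (fun _ _ => rfl) γ le_rfl)
  · by_contra hne
    obtain ⟨γ, h, -⟩ := hB₂ _ _ hne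
    exact h ((hcompat (g y, f (g y)) (g y, y) (hf _) (hg y) γ).1 (fun _ _ => rfl) γ le_rfl)

end BackAndForth

/-! ## Coordinates in trees -/

/-- A nonempty countable set can be enumerated in such a way that a prescribed element comes
first. -/
theorem Set.exists_enumeration {T : Type*} [Countable T] {C : Set T} {x : T} (hx : x ∈ C) :
    ∃ f : T → ℕ, Set.InjOn f C ∧ f '' C = {i : ℕ | (i : ℕ∞) < C.encard} ∧ f x = 0 := by
  classical
  obtain ⟨e⟩ : Nonempty (C ≃ Label C.encard) := by
    rcases C.finite_or_infinite with hC | hC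
    · have : Finite C := hC
      refine ⟨(Finite.equivFin C).trans ⟨fun i => ⟨i.1, ?_⟩, fun i => ⟨i.1, ?_⟩,
        fun _ => rfl, fun _ => rfl⟩⟩
      · rw [← hC.cast_ncard_eq]
        exact_mod_cast i.2
      · have := i.2.trans_eq hC.cast_ncard_eq.symm
        exact_mod_cast this
    · have : Infinite C := hC.to_subtype
      obtain ⟨_⟩ := nonempty_denumerable C
      exact ⟨(Denumerable.eqv C).trans
        ⟨fun i => ⟨i, by rw [hC.encard_eq]; exact ENat.natCast_lt_top i⟩,
          fun i => i.1, fun _ => rfl, fun _ => rfl⟩⟩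
  have hpos : ((0 : ℕ) : ℕ∞) < C.encard := by
    rw [Nat.cast_zero, Set.encard_pos]
    exact ⟨x, hx⟩
  -- The swap gives the prescribed element the label 0.
  let e' : C ≃ Label C.encard := e.trans (Equiv.swap (e ⟨x, hx⟩) ⟨0, hpos⟩)
  have he : ∀ t (h : t ∈ C), (if h : t ∈ C then (e' ⟨t, h⟩).1 else 0) = (e' ⟨t, h⟩).1 :=
    fun t h => dif_pos h
  refine ⟨fun t => if h : t ∈ C then (e' ⟨t, h⟩).1 else 0, fun t ht u hu h => ?_, ?_, ?_⟩
  · simp only [he t ht, he u hu] at h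
    exact congrArg Subtype.val (e'.injective (Subtype.ext h))
  · ext i
    constructor
    · rintro ⟨t, ht, rfl⟩
      simp only [he t ht]
      exact (e' ⟨t, ht⟩).2
    · intro hi
      refine ⟨(e'.symm ⟨i, hi⟩).1, (e'.symm ⟨i, hi⟩).2, ?_⟩
      simp only [he _ (e'.symm ⟨i, hi⟩).2]
      simp
  · simp only [he x hx]
    simp [e']

namespace WeakLTree

variable {L T : Type} [LinearOrder L] [PartialOrder T] (𝒯 : WeakLTree L T)

theorem orb_apply {f : Equiv.Perm T} (hf : f ∈ 𝒯.aut) (t : T) : 𝒯.orb (f t) = 𝒯.orb t :=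
  (𝒯.orb_eq_iff.2 ⟨f, hf, rfl⟩).symm

theorem lam_eq_of_orb_eq {t u : T} (h : 𝒯.orb t = 𝒯.orb u) : 𝒯.lam t = 𝒯.lam u :=
  congrArg 𝒯.condensedLam h

theorem orb_mono {t u : T} (h : t ≤ u) : 𝒯.orb t ≤ 𝒯.orb u := 𝒯.condensedLE_orb.2 ⟨u, rfl, h⟩

theorem exists_le_of_orb_le {t : T} {γ : 𝒯.Condensed} (h : 𝒯.orb t ≤ γ) :
    ∃ u, t ≤ u ∧ 𝒯.orb u = γ := by
  obtain ⟨u, hu, htu⟩ := 𝒯.condensedLE_orb.1 h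
  exact ⟨u, htu, hu⟩

theorem exists_lt_of_orb_lt {t : T} {γ : 𝒯.Condensed} (h : 𝒯.orb t < γ) :
    ∃ u, t < u ∧ 𝒯.orb u = γ := by
  obtain ⟨u, htu, rfl⟩ := 𝒯.exists_le_of_orb_le h.le
  exact ⟨u, lt_of_le_of_ne htu fun e => h.ne (congrArg 𝒯.orb e), rfl⟩

theorem exists_ge_of_le_orb {u : T} {δ : 𝒯.Condensed} (h : δ ≤ 𝒯.orb u) :
    ∃ t, t ≤ u ∧ 𝒯.orb t = δ := by
  obtain ⟨t, u', rfl, hu', htu⟩ := h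
  obtain ⟨f, hf, rfl⟩ := 𝒯.orb_eq_iff.1 hu'
  exact ⟨f t, (hf.2 _ _).1 htu, 𝒯.orb_apply hf t⟩

theorem eq_of_le_of_orb_eq {t u v : T} (hu : t ≤ u) (hv : t ≤ v) (h : 𝒯.orb u = 𝒯.orb v) :
    u = v :=
  (𝒯.existsUnique_above t (𝒯.lam v) (𝒯.lam_mono hv)).unique
    ⟨hu, 𝒯.lam_eq_of_orb_eq h⟩ ⟨hv, rfl⟩

/-- Nodes of the same orbit with the same strict upper bounds. -/
def Sibling (s s' : T) : Prop := 𝒯.orb s = 𝒯.orb s' ∧ ∀ u, s < u ↔ s' < u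

variable {𝒯}

theorem Sibling.refl (s : T) : 𝒯.Sibling s s := ⟨rfl, fun _ => Iff.rfl⟩

theorem Sibling.symm {s s' : T} (h : 𝒯.Sibling s s') : 𝒯.Sibling s' s :=
  ⟨h.1.symm, fun u => (h.2 u).symm⟩

theorem Sibling.trans {s s' s'' : T} (h : 𝒯.Sibling s s') (h' : 𝒯.Sibling s' s'') :
    𝒯.Sibling s s'' :=
  ⟨h.1.trans h'.1, fun u => (h.2 u).trans (h'.2 u)⟩

theorem Sibling.map {s s' : T} (h : 𝒯.Sibling s s') {f : Equiv.Perm T} (hf : f ∈ 𝒯.aut) :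
    𝒯.Sibling (f s) (f s') := by
  refine ⟨by rw [𝒯.orb_apply hf, 𝒯.orb_apply hf, h.1], fun u => ?_⟩
  obtain ⟨u, rfl⟩ := f.surjective u
  rw [lt_iff_le_not_ge, lt_iff_le_not_ge, ← hf.2, ← hf.2, ← hf.2, ← hf.2, ← lt_iff_le_not_ge,
    ← lt_iff_le_not_ge]
  exact h.2 u

theorem setOf_sibling_map {f : Equiv.Perm T} (hf : f ∈ 𝒯.aut) (s : T) :
    {s' | 𝒯.Sibling (f s) s'} = f '' {s' | 𝒯.Sibling s s'} := by
  ext u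
  constructor
  · intro h
    refine ⟨f⁻¹ u, ?_, by simp⟩
    have := Sibling.map h (𝒯.aut.inv_mem hf)
    simpa using this
  · rintro ⟨v, hv, rfl⟩
    exact hv.map hf

/-- Automorphisms carry sibling classes to sibling classes; so the class size is a function of the
orbit and can serve as `N`. -/
theorem encard_sibling_eq {s t : T} (h : 𝒯.orb s = 𝒯.orb t) :
    {s' | 𝒯.Sibling s s'}.encard = {s' | 𝒯.Sibling t s'}.encard := by
  obtain ⟨f, hf, rfl⟩ := 𝒯.orb_eq_iff.1 h
  rw [setOf_sibling_map hf, f.injective.encard_image]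

/-- Different nodes of the same orbit lie below different siblings. -/
theorem IsLTree.exists_sibling (h𝒯 : 𝒯.IsLTree) {t t' : T} (horb : 𝒯.orb t = 𝒯.orb t')
    (hne : t ≠ t') : ∃ v v', t ≤ v ∧ t' ≤ v' ∧ v ≠ v' ∧ 𝒯.Sibling v v' := by
  have hl := 𝒯.lam_eq_of_orb_eq horb
  obtain ⟨m, ⟨hm₁, hm₂, hm₃⟩, hm₄⟩ := h𝒯 t t' (fun h => hne (𝒯.eq_of_le_of_lam_eq h hl))
    (fun h => hne (𝒯.eq_of_le_of_lam_eq h hl.symm).symm)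
  obtain ⟨v, ⟨hv, hvm⟩, -⟩ := 𝒯.existsUnique_above t m hm₁
  obtain ⟨v', ⟨hv', hvm'⟩, -⟩ := 𝒯.existsUnique_above t' m hm₂
  -- The siblings sought are the nodes above `t` and `t'` at their last level of disagreement `m`:
  -- above `m` the two branches coincide.
  have half : ∀ {a b c d : T} {m : L}, a ≤ c → b ≤ d → 𝒯.lam c = m → 𝒯.lam d = m →
      (∀ k, m < k → 𝒯.AgreeAt a b k) → ∀ u, c < u → d < u := by
    intro a b c d m hac hbd hc hd hag u hu
    have hmu : m < 𝒯.lam u := hc ▸ 𝒯.lam_lt _ _ hu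
    obtain ⟨w, haw, hbw, hw⟩ := hag _ hmu
    obtain rfl : w = u := (𝒯.existsUnique_above a (𝒯.lam u) (𝒯.lam_mono (hac.trans hu.le))).unique
      ⟨haw, hw⟩ ⟨hac.trans hu.le, rfl⟩
    refine lt_of_le_of_ne (𝒯.le_of_le_of_le hbd hbw (hd.trans_le hmu.le)) ?_
    rintro rfl
    exact hmu.ne' hd
  have hag : ∀ k, m < k → 𝒯.AgreeAt t t' k := fun k hk => by
    by_contra hcon
    exact absurd (hm₄ (a := k) ⟨hm₁.trans hk.le, hm₂.trans hk.le, hcon⟩) (not_le.2 hk)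
  have hag' : ∀ k, m < k → 𝒯.AgreeAt t' t k := fun k hk => by
    obtain ⟨w, h₁, h₂, h₃⟩ := hag k hk
    exact ⟨w, h₂, h₁, h₃⟩
  refine ⟨v, v', hv, hv', ?_, ?_, fun u => ⟨half hv hv' hvm hvm' hag u,
    half hv' hv hvm' hvm hag' u⟩⟩
  · rintro rfl
    exact hm₃ ⟨v, hv, hv', hvm⟩
  · exact (𝒯.condensed.existsUnique_above (𝒯.orb t) m hm₁).unique ⟨𝒯.orb_mono hv, hvm⟩
      ⟨horb ▸ 𝒯.orb_mono hv', hvm'⟩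

variable (𝒯)

/-- The nodes of a countable tree can be labelled in such a way that siblings get different labels
from an initial segment of `ω` and only finitely many nonzero labels occur above each node. -/
theorem exists_labelling [Countable T] : ∃ (N : 𝒯.Condensed → ℕ∞) (a : T → ℕ),
    (∀ δ, N δ ≠ 0) ∧ (∀ s, (a s : ℕ∞) < N (𝒯.orb s)) ∧
    (∀ s s', 𝒯.Sibling s s' → a s = a s' → s = s') ∧
    (∀ s (i : ℕ), (i : ℕ∞) < N (𝒯.orb s) → ∃ s', 𝒯.Sibling s s' ∧ a s' = i) ∧
    ∀ t, {s | t ≤ s ∧ a s ≠ 0}.Finite := by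
  classical
  obtain ⟨idx, hidx⟩ := exists_injective_nat T
  -- Rank a node `s` by the least index of a node below it, attained at `b s`. In each sibling class
  -- a member of least rank will get the label 0.
  have hrank : ∀ s, ∃ t, t ≤ s ∧ ∀ t', t' ≤ s → idx t ≤ idx t' := fun s =>
    exists_minimalFor_of_wellFoundedLT (· ≤ s) idx ⟨s, le_rfl⟩ |>.imp fun t ht =>
      ⟨ht.1, fun t' ht' => (le_total _ _).elim id fun h => ht.2 ht' h⟩
  choose b hb₁ hb₂ using hrank
  have hF : ∀ C : Set T, ∃ f : T → ℕ, C.Nonempty → Set.InjOn f C ∧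
      f '' C = {i : ℕ | (i : ℕ∞) < C.encard} ∧
      ∀ s ∈ C, f s ≠ 0 → ∃ s' ∈ C, s' ≠ s ∧ idx (b s') ≤ idx (b s) := by
    intro C
    by_cases hC : C.Nonempty
    · obtain ⟨x, hx⟩ := exists_minimalFor_of_wellFoundedLT (· ∈ C) (fun s => idx (b s)) hC
      obtain ⟨f, h₁, h₂, h₃⟩ := Set.exists_enumeration hx.1
      refine ⟨f, fun _ => ⟨h₁, h₂, fun s hs hfs => ⟨x, hx.1, ?_, ?_⟩⟩⟩
      · rintro rfl
        exact hfs h₃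
      · exact (le_total _ _).elim id fun h => hx.2 hs h
    · exact ⟨fun _ => 0, fun h => absurd h hC⟩
  choose F hF using hF
  let cls : T → Set T := fun s => {s' | 𝒯.Sibling s s'}
  have hcls : ∀ s, s ∈ cls s := Sibling.refl
  have hcls_eq : ∀ {s s'}, 𝒯.Sibling s s' → cls s = cls s' := fun h =>
    Set.ext fun u => ⟨h.symm.trans, h.trans⟩
  choose rep hrep using 𝒯.exists_orb
  have hN : ∀ s, (cls (rep (𝒯.orb s))).encard = (cls s).encard := fun s =>
    encard_sibling_eq (hrep _)
  have hmem : ∀ s, F (cls s) s ∈ {i : ℕ | (i : ℕ∞) < (cls s).encard} := fun s => by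
    rw [← (hF (cls s) ⟨s, hcls s⟩).2.1]
    exact ⟨s, hcls s, rfl⟩
  refine ⟨fun δ => (cls (rep δ)).encard, fun s => F (cls s) s, fun δ => ?_, fun s => ?_,
    fun s s' hss h => ?_, fun s i hi => ?_, fun t => ?_⟩
  · exact Set.encard_ne_zero.2 ⟨_, hcls _⟩
  · simp only [hN]
    exact hmem s
  · simp only [← hcls_eq hss] at h
    exact (hF (cls s) ⟨s, hcls s⟩).1 (hcls s) hss h
  · simp only [hN] at hi
    have : i ∈ {i : ℕ | (i : ℕ∞) < (cls s).encard} := hi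
    rw [← (hF (cls s) ⟨s, hcls s⟩).2.1] at this
    obtain ⟨s', hs', rfl⟩ := this
    exact ⟨s', hs', by simp only [← hcls_eq hs']⟩
  · have hex : ∀ s : {s | t ≤ s ∧ F (cls s) s ≠ 0}, ∃ s', 𝒯.Sibling s.1 s' ∧ s' ≠ s.1 ∧
        idx (b s') ≤ idx (b s.1) := fun s =>
      (hF (cls s.1) ⟨s.1, hcls s.1⟩).2.2 s.1 (hcls s.1) s.2.2
    choose σ hσ₁ hσ₂ hσ₃ using hex
    -- If `s < s'`, the sibling `σ s` also lies below `s'`. A common `b` would then lie below both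
    -- `s'` and its sibling `σ s'`, which is impossible for different nodes of one orbit. As `b (σ
    -- s)` has index at most that of `t`, only finitely many `s` remain.
    have hlt : ∀ s s' : {s | t ≤ s ∧ F (cls s) s ≠ 0}, b (σ s) = b (σ s') → ¬ s.1 < s'.1 := by
      intro s s' h hss
      have h₁ : b (σ s) ≤ s'.1 := (hb₁ _).trans (((hσ₁ s).2 _).1 hss).le
      exact hσ₂ s' (𝒯.eq_of_le_of_orb_eq (h ▸ hb₁ (σ s')) h₁ (hσ₁ s').1.symm)
    refine Set.finite_coe_iff.1 (Finite.of_injective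
      (fun s => (⟨idx (b (σ s)), Nat.lt_succ_of_le
        ((hσ₃ s).trans (hb₂ s.1 t s.2.1))⟩ : Fin (idx t + 1))) fun s s' h => ?_)
    have h' : b (σ s) = b (σ s') := hidx (congrArg Fin.val h)
    refine Subtype.ext ?_
    rcases 𝒯.total_above s.2.1 s'.2.1 with hle | hle
    · exact hle.eq_of_not_lt (hlt s s' h')
    · exact (hle.eq_of_not_lt (hlt s' s h'.symm)).symm

end WeakLTree

/-! ### Coordinates on the orbits of a tree and the systems of projections they define -/

namespace WeakLTree

variable {L T : Type} [LinearOrder L] [PartialOrder T] (𝒯 : WeakLTree L T)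

/-- `t` and `t'` have a common upper bound in the orbit `γ`. -/
def AgreeOn (t t' : T) (γ : 𝒯.Condensed) : Prop := ∃ u, 𝒯.orb u = γ ∧ t ≤ u ∧ t' ≤ u

variable {𝒯} in
-- A node has only one upper bound in a given orbit, so agreement on `γ` can be tested at any
-- intermediate nodes whose orbits are below `γ`.
theorem agreeOn_congr {s t s' t' : T} {γ : 𝒯.Condensed} (hs : s ≤ t) (hs' : s' ≤ t')
    (h : 𝒯.orb t ≤ γ) (h' : 𝒯.orb t' ≤ γ) : 𝒯.AgreeOn s s' γ ↔ 𝒯.AgreeOn t t' γ := by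
  constructor
  · rintro ⟨u, rfl, hu, hu'⟩
    obtain ⟨v, hv, e⟩ := 𝒯.exists_le_of_orb_le h
    obtain ⟨v', hv', e'⟩ := 𝒯.exists_le_of_orb_le h'
    obtain rfl := 𝒯.eq_of_le_of_orb_eq (hs.trans hv) hu e
    obtain rfl := 𝒯.eq_of_le_of_orb_eq (hs'.trans hv') hu' e'
    exact ⟨v', rfl, hv, hv'⟩
  · rintro ⟨u, rfl, hu, hu'⟩
    exact ⟨u, rfl, hs.trans hu, hs'.trans hu'⟩

/-- Coordinates for the nodes of a tree. -/
structure Coordinates (N : 𝒯.Condensed → ℕ∞) where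
  coord : T → 𝒯.Condensed → ℕ
  coord_lt : ∀ t γ, (coord t γ : ℕ∞) < N γ
  coord_eq_iff : ∀ t t' γ, 𝒯.orb t = 𝒯.orb t' → 𝒯.orb t ≤ γ →
    ((∀ β, γ ≤ β → coord t β = coord t' β) ↔ 𝒯.AgreeOn t t' γ)
  exists_perturb : ∀ t (i : ℕ), (i : ℕ∞) < N (𝒯.orb t) → ∃ t', 𝒯.orb t' = 𝒯.orb t ∧
    coord t' (𝒯.orb t) = i ∧ ∀ γ, 𝒯.orb t < γ → coord t' γ = coord t γ

namespace Coordinates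

variable {𝒯} {N : 𝒯.Condensed → ℕ∞} (Z : 𝒯.Coordinates N)

/-- The coordinates as a sequence on a cone. -/
def loc (t : T) (δ : 𝒯.Condensed) : LocSeq N δ := fun γ => ⟨Z.coord t γ.1, Z.coord_lt t γ.1⟩

theorem loc_eq_iff {t t' : T} {γ : 𝒯.Condensed} (h : 𝒯.orb t = 𝒯.orb t') (hγ : 𝒯.orb t ≤ γ) :
    Z.loc t γ = Z.loc t' γ ↔ 𝒯.AgreeOn t t' γ := by
  rw [← Z.coord_eq_iff t t' γ h hγ]
  exact ⟨fun e β hβ => congrArg Subtype.val (congrFun e ⟨β, hβ⟩),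
    fun e => funext fun β => Subtype.ext (e β.1 β.2)⟩

theorem loc_injective {t t' : T} (h : 𝒯.orb t = 𝒯.orb t')
    (e : Z.loc t (𝒯.orb t) = Z.loc t' (𝒯.orb t)) : t = t' := by
  obtain ⟨u, hu, htu, htu'⟩ := (Z.loc_eq_iff h le_rfl).1 e
  rw [𝒯.eq_of_le_of_orb_eq le_rfl htu hu.symm]
  exact (𝒯.eq_of_le_of_orb_eq le_rfl htu' (h.symm.trans hu.symm)).symm

/-- The set of sequences of coordinates of the nodes in an orbit. -/
def seqs (δ : 𝒯.Condensed) : Set (LocSeq N δ) := {z | ∃ t, 𝒯.orb t = δ ∧ z = Z.loc t δ}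

theorem seqs_nonempty (δ : 𝒯.Condensed) : (Z.seqs δ).Nonempty := by
  obtain ⟨t, rfl⟩ := 𝒯.exists_orb δ
  exact ⟨_, t, rfl, rfl⟩

theorem perturb_mem_seqs (δ : 𝒯.Condensed) (z : LocSeq N δ) (hz : z ∈ Z.seqs δ)
    (i : Label (N δ)) : z.perturb i ∈ Z.seqs δ := by
  obtain ⟨t, rfl, rfl⟩ := hz
  obtain ⟨t', h₁, h₂, h₃⟩ := Z.exists_perturb t i.1 i.2
  refine ⟨t', h₁, funext fun γ => ?_⟩
  obtain ⟨γ, hγ⟩ := γ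
  rcases (show 𝒯.orb t ≤ γ from hγ).eq_or_lt with rfl | hlt
  · rw [ProjSystem.pert_self]
    exact Subtype.ext h₂.symm
  · have := congrFun (ProjSystem.pert_restrict (Z.loc t (𝒯.orb t)) i hlt) ⟨γ, le_rfl⟩
    refine this.trans (Subtype.ext (h₃ γ hlt).symm)

theorem exists_proj {δ γ : 𝒯.Condensed} (h : δ ≤ γ) (z : Z.seqs δ) :
    ∃ w : Z.seqs γ, ∃ t u, 𝒯.orb t = δ ∧ z.1 = Z.loc t δ ∧ t ≤ u ∧ 𝒯.orb u = γ ∧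
      w.1 = Z.loc u γ := by
  obtain ⟨_, t, rfl, rfl⟩ := z
  obtain ⟨u, htu, rfl⟩ := 𝒯.exists_le_of_orb_le h
  exact ⟨⟨_, u, rfl, rfl⟩, t, u, rfl, rfl, htu, rfl, rfl⟩

/-- The projection that corresponds to passing to a larger node. -/
noncomputable def proj {δ γ : 𝒯.Condensed} (h : δ ≤ γ) (z : Z.seqs δ) : Z.seqs γ :=
  (Z.exists_proj h z).choose

theorem proj_loc {t u : T} (h : t ≤ u) {δ γ : 𝒯.Condensed} (ht : 𝒯.orb t = δ) (hu : 𝒯.orb u = γ)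
    (hle : δ ≤ γ) : Z.proj hle ⟨Z.loc t δ, t, ht, rfl⟩ = ⟨Z.loc u γ, u, hu, rfl⟩ := by
  subst ht hu
  obtain ⟨t', u', ht', he, htu', hu', hw⟩ :=
    (Z.exists_proj hle ⟨Z.loc t _, t, rfl, rfl⟩).choose_spec
  obtain rfl := Z.loc_injective ht'.symm he
  obtain rfl := 𝒯.eq_of_le_of_orb_eq htu' h hu'
  exact Subtype.ext hw

/-- The system of projections given by coordinates. -/
noncomputable def toProjSystem : ProjSystem N where
  S := Z.seqs
  nonempty := Z.seqs_nonempty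
  perturb_mem := Z.perturb_mem_seqs
  proj h z := Z.proj h z
  proj_surjective {δ γ} h w := by
    obtain ⟨_, u, rfl, rfl⟩ := w
    obtain ⟨t, htu, rfl⟩ := 𝒯.exists_ge_of_le_orb h
    exact ⟨⟨_, t, rfl, rfl⟩, Z.proj_loc htu rfl rfl h⟩
  proj_eq_iff {δ γ} h z w := by
    obtain ⟨_, t, rfl, rfl⟩ := z
    obtain ⟨_, t', ht', rfl⟩ := w
    obtain ⟨u, htu, hu⟩ := 𝒯.exists_le_of_orb_le h
    obtain ⟨u', htu', hu'⟩ := 𝒯.exists_le_of_orb_le (ht'.trans_le h)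
    rw [Z.proj_loc htu rfl hu h, Z.proj_loc htu' ht' hu' h, Subtype.ext_iff]
    change Z.loc u γ = Z.loc u' γ ↔ Z.loc t γ = Z.loc t' γ
    rw [Z.loc_eq_iff (hu.trans hu'.symm) hu.le, Z.loc_eq_iff ht'.symm h,
      agreeOn_congr htu htu' hu.le hu'.le]
  proj_comp {δ γ β} h₁ h₂ z := by
    obtain ⟨_, t, rfl, rfl⟩ := z
    obtain ⟨u, htu, rfl⟩ := 𝒯.exists_le_of_orb_le h₁
    obtain ⟨v, huv, rfl⟩ := 𝒯.exists_le_of_orb_le h₂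
    rw [Z.proj_loc htu rfl rfl h₁, Z.proj_loc huv rfl rfl h₂, Z.proj_loc (htu.trans huv) rfl rfl _]

end Coordinates

/-- An identification of the nodes of a tree with the members of a system of projections. -/
theorem mem_aut_iff_mem_wrSym {N : 𝒯.Condensed → ℕ∞} (P : ProjSystem N) (e : T ≃ P.Point)
    (he : ∀ t, (e t).1 = 𝒯.orb t) (hle : ∀ t u, t ≤ u → P.PointLE (e t) (e u))
    (f : Equiv.Perm T) : f ∈ 𝒯.aut ↔ (e.symm.trans f).trans e ∈ P.wrSym := by
  -- One direction implies the other: the node above `t` in the orbit of `u` and `u` itself are both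
  -- sent to the projection of `e t`.
  have hle' : ∀ t u, t ≤ u ↔ P.PointLE (e t) (e u) := by
    refine fun t u => ⟨hle t u, fun h => ?_⟩
    have h₁ := h.1
    rw [he, he] at h₁
    obtain ⟨v, htv, hv⟩ := 𝒯.exists_le_of_orb_le h₁
    have hv' : (e v).1 = (e u).1 := by rw [he, he, hv]
    obtain ⟨h₂, h₃⟩ := hle t v htv
    obtain ⟨h₄, h₅⟩ := h
    have : e v = e u := by
      rw [← h₃, ← h₅]
      revert h₂
      rw [hv']
      exact fun _ _ => rfl
    rwa [← e.injective this]
  rw [P.mem_wrSym_iff, P.preservesProj_iff]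
  constructor
  · intro hf
    refine ⟨fun p => ?_, fun p q => ?_⟩
    · obtain ⟨t, rfl⟩ := e.surjective p
      simp [he, 𝒯.orb_apply hf]
    · obtain ⟨t, rfl⟩ := e.surjective p
      obtain ⟨u, rfl⟩ := e.surjective q
      simpa [← hle'] using hf.2 t u
  · rintro ⟨h₁, h₂⟩
    refine ⟨fun t => ?_, fun t u => ?_⟩
    · have := h₁ (e t)
      simp only [Equiv.trans_apply, Equiv.symm_apply_apply, he] at this
      exact 𝒯.lam_eq_of_orb_eq this
    · have := h₂ (e t) (e u)
      simpa [← hle'] using this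

namespace Coordinates

variable {𝒯} {N : 𝒯.Condensed → ℕ∞} (Z : 𝒯.Coordinates N)

theorem exists_equiv_point (P : ProjSystem N) (hS : P.S = Z.seqs)
    (hproj : ∀ {t u : T} (_ : t ≤ u) (hle : 𝒯.orb t ≤ 𝒯.orb u) (ht hu),
      P.proj hle ⟨Z.loc t (𝒯.orb t), ht⟩ = ⟨Z.loc u (𝒯.orb u), hu⟩) :
    ∃ e : T ≃ P.Point, (∀ t, ∃ h, e t = ⟨𝒯.orb t, Z.loc t (𝒯.orb t), h⟩) ∧
      ∀ f, f ∈ 𝒯.aut ↔ (e.symm.trans f).trans e ∈ P.wrSym := by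
  have hmem : ∀ t, Z.loc t (𝒯.orb t) ∈ P.S (𝒯.orb t) := fun t => by
    rw [hS]
    exact ⟨t, rfl, rfl⟩
  let e₀ : T → P.Point := fun t => ⟨𝒯.orb t, Z.loc t (𝒯.orb t), hmem t⟩
  have hbij : Function.Bijective e₀ := by
    constructor
    · intro t t' h
      have h₁ : 𝒯.orb t = 𝒯.orb t' := congrArg Sigma.fst h
      refine Z.loc_injective h₁ ?_
      have key : ∀ (δ : 𝒯.Condensed) (h : 𝒯.orb t' = δ) (w : P.S δ),
          (⟨δ, w⟩ : P.Point) = e₀ t' → w.1 = Z.loc t' δ := by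
        rintro _ rfl w hw
        exact congrArg Subtype.val (eq_of_heq (Sigma.mk.inj hw).2)
      exact key _ h₁.symm _ h
    · rintro ⟨δ, z, hz⟩
      have hz' := hz
      rw [hS] at hz'
      obtain ⟨t, rfl, rfl⟩ := hz'
      exact ⟨t, rfl⟩
  refine ⟨Equiv.ofBijective e₀ hbij, fun t => ⟨hmem t, rfl⟩,
    𝒯.mem_aut_iff_mem_wrSym P _ (fun _ => rfl) fun t u h => ⟨𝒯.orb_mono h, ?_⟩⟩
  exact congrArg (Sigma.mk (𝒯.orb u)) (hproj h (𝒯.orb_mono h) (hmem t) (hmem u))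

end Coordinates

theorem IsPruned.condensed {𝒯 : WeakLTree L T} (h : 𝒯.IsPruned) : 𝒯.condensed.IsPruned := by
  intro δ
  obtain ⟨t, rfl⟩ := 𝒯.exists_orb δ
  obtain ⟨b, hb, hbt⟩ := h t
  exact ⟨fun ℓ => 𝒯.orb (b ℓ), ⟨fun ℓ => hb.1 ℓ, fun ℓ ℓ' hℓ => 𝒯.orb_mono (hb.2 ℓ ℓ' hℓ)⟩,
    congrArg 𝒯.orb hbt⟩

/-- Specialness is needed only here: it says that the set of orbits is an `L`-tree. -/
theorem isCountableTreeableSkeleton_condensed [Nonempty T] [Countable T] (hp : 𝒯.IsPruned)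
    (hs : 𝒯.IsSpecial) {N : 𝒯.Condensed → ℕ∞} (hN : ∀ δ, N δ ≠ 0) :
    IsCountableTreeableSkeleton 𝒯.Condensed N where
  nonempty := ⟨𝒯.orb (Classical.arbitrary T)⟩
  countable := Function.Surjective.countable (f := 𝒯.orb) 𝒯.exists_orb
  label_ne_zero := hN
  treeable := ⟨L, inferInstance, 𝒯.condensed, hs, hp.condensed⟩

/-- Coordinates that are compatible with restrictions and have finite supports. -/
theorem exists_coordinates [Countable T] (h𝒯 : 𝒯.IsLTree) :
    ∃ (N : 𝒯.Condensed → ℕ∞) (Z : 𝒯.Coordinates N), (∀ δ, N δ ≠ 0) ∧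
      (∀ t u γ, t ≤ u → 𝒯.orb u ≤ γ → Z.coord t γ = Z.coord u γ) ∧
      (∀ t, {γ | Z.coord t γ ≠ 0}.Finite) ∧
      (∀ t t', 𝒯.orb t = 𝒯.orb t' → t ≠ t' → ∃ γ, 𝒯.orb t ≤ γ ∧ Z.coord t γ ≠ Z.coord t' γ ∧
        ∀ β, γ < β → Z.coord t β = Z.coord t' β) ∧
      ∀ t γ (i : ℕ), 𝒯.orb t ≤ γ → (i : ℕ∞) < N γ → ∃ t', 𝒯.orb t' = 𝒯.orb t ∧
        Z.coord t' γ = i ∧ ∀ β, γ < β → Z.coord t' β = Z.coord t β := by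
  classical
  obtain ⟨N, a, hN, ha₁, ha₂, ha₃, ha₄⟩ := 𝒯.exists_labelling
  -- The coordinate at `γ` is the label of the unique node above `t` in `γ`. Outside the cone it is
  -- 0, so the support comes from the finitely many nodes above `t` with nonzero label.
  let z : T → 𝒯.Condensed → ℕ := fun t γ => if h : ∃ u, t ≤ u ∧ 𝒯.orb u = γ then a h.choose else 0
  have hz : ∀ {t u}, t ≤ u → z t (𝒯.orb u) = a u := by
    intro t u htu
    have h : ∃ v, t ≤ v ∧ 𝒯.orb v = 𝒯.orb u := ⟨u, htu, rfl⟩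
    have e : h.choose = u := 𝒯.eq_of_le_of_orb_eq h.choose_spec.1 htu h.choose_spec.2
    change dite _ _ _ = _
    rw [dif_pos h, e]
  have hz₀ : ∀ t γ, z t γ ≠ 0 → ∃ u, t ≤ u ∧ 𝒯.orb u = γ := by
    intro t γ h
    by_contra hcon
    exact h (dif_neg hcon)
  have hmono : ∀ t u γ, t ≤ u → 𝒯.orb u ≤ γ → z t γ = z u γ := by
    intro t u γ htu hγ
    obtain ⟨v, huv, rfl⟩ := 𝒯.exists_le_of_orb_le hγ
    rw [hz huv, hz (htu.trans huv)]
  have hsib : ∀ {t u u'}, 𝒯.Sibling u u' → ∀ {t'}, t ≤ u → t' ≤ u' → ∀ β, 𝒯.orb u < β →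
      z t β = z t' β := by
    intro t u u' hu t' ht ht' β hβ
    obtain ⟨v, huv, rfl⟩ := 𝒯.exists_lt_of_orb_lt hβ
    rw [hz (ht.trans huv.le), hz (ht'.trans ((hu.2 v).1 huv).le)]
  have hdiff : ∀ t t', 𝒯.orb t = 𝒯.orb t' → t ≠ t' → ∃ γ, 𝒯.orb t ≤ γ ∧ z t γ ≠ z t' γ ∧
        ∀ β, γ < β → z t β = z t' β := by
    intro t t' h hne
    obtain ⟨v, v', hv, hv', hvv, hs⟩ := h𝒯.exists_sibling h hne
    refine ⟨𝒯.orb v, 𝒯.orb_mono hv, fun e => hvv (ha₂ v v' hs ?_), hsib hs hv hv'⟩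
    rw [hz hv, hs.1, hz hv'] at e
    exact e
  have hpert : ∀ t γ (i : ℕ), 𝒯.orb t ≤ γ → (i : ℕ∞) < N γ → ∃ t', 𝒯.orb t' = 𝒯.orb t ∧
        z t' γ = i ∧ ∀ β, γ < β → z t' β = z t β := by
    intro t γ i hγ hi
    obtain ⟨u, htu, rfl⟩ := 𝒯.exists_le_of_orb_le hγ
    obtain ⟨u', hu', rfl⟩ := ha₃ u i hi
    rw [hu'.1] at hγ
    obtain ⟨t', htu', ht'⟩ := 𝒯.exists_ge_of_le_orb hγ
    refine ⟨t', ht', ?_, fun β hβ => (hsib hu' htu htu' β hβ).symm⟩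
    rw [hu'.1, hz htu']
  refine ⟨N, ⟨z, fun t γ => ?_, fun t t' γ h hγ => ⟨fun e => ?_, ?_⟩, fun t i hi => ?_⟩, hN, hmono,
    fun t => ?_, hdiff, hpert⟩
  · by_cases h : z t γ = 0
    · rw [h]
      exact pos_iff_ne_zero.2 (hN γ)
    · obtain ⟨u, htu, rfl⟩ := hz₀ t γ h
      rw [hz htu]
      exact ha₁ u
  · obtain ⟨u, htu, hu⟩ := 𝒯.exists_le_of_orb_le hγ
    obtain ⟨u', htu', hu'⟩ := 𝒯.exists_le_of_orb_le (h ▸ hγ)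
    have : u = u' := by
      by_contra hne
      obtain ⟨β, hβ, hβ', -⟩ := hdiff u u' (hu.trans hu'.symm) hne
      rw [← hmono t u β htu hβ, ← hmono t' u' β htu' (hu'.trans_le (hu ▸ hβ))] at hβ'
      exact hβ' (e β (hu ▸ hβ))
    subst this
    exact ⟨u, hu, htu, htu'⟩
  · rintro ⟨u, rfl, htu, htu'⟩ β hβ
    rw [hmono t u β htu hβ, hmono t' u β htu' hβ]
  · exact hpert t _ i le_rfl hi
  · refine ((ha₄ t).image 𝒯.orb).subset fun γ h => ?_
    obtain ⟨u, htu, rfl⟩ := hz₀ t γ h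
    change z t (𝒯.orb u) ≠ 0 at h
    rw [hz htu] at h
    exact ⟨u, ⟨htu, h⟩, rfl⟩

end WeakLTree

/-! ### Locally finite supports -/

theorem suppLF_subset_suppMax (Δ : Type*) [PartialOrder Δ] : suppLF Δ ⊆ suppMax Δ := by
  intro A hA B hB ⟨b, hb⟩
  obtain ⟨m, hbm, hm⟩ := ((hA b).subset (Set.inter_subset_inter_left _ hB)).exists_le_maximal
    ⟨hb, le_refl b⟩
  exact ⟨m, hm.prop.1, fun c hc hmc => hm.le_of_ge ⟨hc, hbm.trans hmc⟩ hmc⟩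

theorem admissibleLocal_mono {Δ : Type*} [PartialOrder Δ] (N : Δ → ℕ∞) {A B : Set (Set Δ)}
    (h : A ⊆ B) (δ : Δ) : admissibleLocal N A δ ⊆ admissibleLocal N B δ := fun _ ⟨x, hx, hz⟩ =>
  ⟨x, h hx, hz⟩

theorem countable_admissibleLocal_suppLF {Δ : Type*} [PartialOrder Δ] [Countable Δ] (N : Δ → ℕ∞)
    (δ : Δ) : Countable (admissibleLocal N (suppLF Δ) δ) := by
  have hfin : ∀ z : admissibleLocal N (suppLF Δ) δ, {γ | (z.1 γ).1 ≠ 0}.Finite := by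
    rintro ⟨z, x, hx, hz⟩
    refine Set.Finite.of_finite_image (f := Subtype.val) ((hx δ).subset ?_)
      Subtype.val_injective.injOn
    rintro _ ⟨γ, hγ, rfl⟩
    refine ⟨?_, γ.2⟩
    rw [seqSupport, Set.mem_ofPred_eq, ← hz]
    exact hγ
  refine Function.Injective.countable (f := fun z : admissibleLocal N (suppLF Δ) δ =>
    (Finsupp.ofSupportFinite (fun γ => (z.1 γ).1) (hfin z))) fun z w h => ?_
  refine Subtype.ext (funext fun γ => Subtype.ext ?_)
  exact DFunLike.congr_fun h γ

/-! ### The local domains formed by the labels above the nodes -/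

namespace WeakLTree

variable {L T : Type} [LinearOrder L] [PartialOrder T] (𝒯 : WeakLTree L T)

theorem exists_localDomains [Nonempty T] [Countable T] (h𝒯 : 𝒯.IsLTree) (hp : 𝒯.IsPruned)
    (hs : 𝒯.IsSpecial) :
    ∃ (Δ : Type) (_ : PartialOrder Δ) (N : Δ → ℕ∞), IsCountableTreeableSkeleton Δ N ∧
      ∃ D : LocalDomains N, (∀ δ, D.S δ ⊆ admissibleLocal N (suppMax Δ) δ) ∧
        Countable ((δ : Δ) × D.S δ) ∧ Nonempty (𝒯.aut ≃ₜ* D.wrSym) := by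
  obtain ⟨N, Z, hN, hmono, hfin, -⟩ := 𝒯.exists_coordinates h𝒯
  have hloc : ∀ {t u γ}, t ≤ u → 𝒯.orb u = γ → Z.loc t γ = Z.loc u γ := fun htu hu =>
    funext fun β => Subtype.ext (hmono _ _ β.1 htu (hu.trans_le β.2))
  let D : LocalDomains N :=
    { S := Z.seqs
      nonempty := Z.seqs_nonempty
      restrict_image := fun {δ γ} h => by
        ext z
        constructor
        · rintro ⟨u, rfl, rfl⟩
          obtain ⟨t, htu, rfl⟩ := 𝒯.exists_ge_of_le_orb h
          exact ⟨Z.loc t _, ⟨t, rfl, rfl⟩, hloc htu rfl⟩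
        · rintro ⟨_, ⟨t, rfl, rfl⟩, rfl⟩
          obtain ⟨u, htu, rfl⟩ := 𝒯.exists_le_of_orb_le h
          exact ⟨u, rfl, hloc htu rfl⟩
      perturb_mem := Z.perturb_mem_seqs }
  obtain ⟨e, -, he⟩ := Z.exists_equiv_point D.toProjSystem rfl
    fun htu _ _ _ => Subtype.ext (hloc htu rfl)
  refine ⟨𝒯.Condensed, inferInstance, N, 𝒯.isCountableTreeableSkeleton_condensed hp hs hN, D,
    fun δ => ?_, e.symm.injective.countable, nonempty_continuousMulEquiv_of_equiv e he⟩
  refine Set.Subset.trans ?_ (admissibleLocal_mono N (suppLF_subset_suppMax _) δ)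
  rintro _ ⟨t, -, rfl⟩
  exact ⟨fun γ => ⟨Z.coord t γ, Z.coord_lt t γ⟩, fun β => (hfin t).subset Set.inter_subset_left,
    fun _ => rfl⟩

end WeakLTree

/-! ### Realizing all locally finite sequences -/

namespace WeakLTree

variable {L T : Type} [LinearOrder L] [PartialOrder T] (𝒯 : WeakLTree L T)

/-- The sequences of finite support on a cone. -/
abbrev FinSeq {Δ : Type} [PartialOrder Δ] (N : Δ → ℕ∞) (δ : Δ) : Type :=
  {y : Δ → ℕ // (∀ γ, (y γ : ℕ∞) < N γ) ∧ (∀ γ, y γ ≠ 0 → δ ≤ γ) ∧ {γ | y γ ≠ 0}.Finite}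

theorem countable_finSeq {Δ : Type} [PartialOrder Δ] [Countable Δ] (N : Δ → ℕ∞) (δ : Δ) :
    Countable (FinSeq N δ) :=
  Function.Injective.countable (f := fun y : FinSeq N δ => Finsupp.ofSupportFinite y.1 y.2.2.2)
    fun _ _ h => Subtype.ext (funext fun γ => DFunLike.congr_fun h γ)

theorem exists_finSeq_update {Δ : Type} [PartialOrder Δ] {N : Δ → ℕ∞} {δ γ : Δ} (y : FinSeq N δ)
    (hγ : δ ≤ γ) {i : ℕ} (hi : (i : ℕ∞) < N γ) :
    ∃ w : FinSeq N δ, w.1 γ = i ∧ ∀ β, β ≠ γ → w.1 β = y.1 β := by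
  classical
  refine ⟨⟨Function.update y.1 γ i, fun β => ?_, fun β hβ => ?_, ?_⟩,
    Function.update_self γ i y.1, fun β hβ => Function.update_of_ne hβ i y.1⟩
  · rcases eq_or_ne β γ with rfl | h
    · rw [Function.update_self]; exact hi
    · rw [Function.update_of_ne h]; exact y.2.1 β
  · rcases eq_or_ne β γ with rfl | h
    · exact hγ
    · rw [Function.update_of_ne h] at hβ
      exact y.2.2.1 β hβ
  · refine (y.2.2.2.insert γ).subset fun β hβ => ?_
    rcases eq_or_ne β γ with rfl | h
    · exact Set.mem_insert _ _
    · rw [Set.mem_ofPred_eq, Function.update_of_ne h] at hβ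
      exact Set.mem_insert_of_mem _ hβ

/-- In each orbit separately, the nodes can be identified with all sequences of finite support. -/
theorem exists_orbit_coordinates [Countable T] (h𝒯 : 𝒯.IsLTree) :
    ∃ (N : 𝒯.Condensed → ℕ∞) (y : T → 𝒯.Condensed → ℕ), (∀ δ, N δ ≠ 0) ∧
      (∀ t γ, (y t γ : ℕ∞) < N γ) ∧ (∀ t, {γ | y t γ ≠ 0}.Finite) ∧
      (∀ t t' γ, 𝒯.orb t = 𝒯.orb t' → 𝒯.orb t ≤ γ →
        ((∀ β, γ ≤ β → y t β = y t' β) ↔ 𝒯.AgreeOn t t' γ)) ∧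
      ∀ δ (w : FinSeq N δ), ∃ t, 𝒯.orb t = δ ∧ y t = w.1 := by
  classical
  obtain ⟨N, Z, hN, -, -, hdiff, hpert⟩ := 𝒯.exists_coordinates h𝒯
  have : Countable 𝒯.Condensed := Function.Surjective.countable (f := 𝒯.orb) 𝒯.exists_orb
  -- The labels realize only some finitely supported sequences. Both families are countable, realize
  -- every label at every coordinate and have greatest disagreements, so back-and-forth along the
  -- cone of `δ` matches them. The matchings for different `δ` are unrelated.
  have key : ∀ δ, ∃ e : {t // 𝒯.orb t = δ} ≃ FinSeq N δ, ∀ t t' (γ : {γ // δ ≤ γ}),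
      (∀ β : {γ // δ ≤ γ}, γ ≤ β → Z.coord t.1 β.1 = Z.coord t'.1 β.1) ↔
        ∀ β : {γ // δ ≤ γ}, γ ≤ β → (e t).1 β.1 = (e t').1 β.1 := by
    intro δ
    have := countable_finSeq N δ
    have : Nonempty {t // 𝒯.orb t = δ} := by
      obtain ⟨t, ht⟩ := 𝒯.exists_orb δ
      exact ⟨⟨t, ht⟩⟩
    have hpos : ∀ γ, ((0 : ℕ) : ℕ∞) < N γ := fun γ => by
      rw [Nat.cast_zero]
      exact pos_iff_ne_zero.2 (hN γ)
    have : Nonempty (FinSeq N δ) :=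
      ⟨⟨fun _ => 0, hpos, fun _ h => absurd rfl h, by simp⟩⟩
    refine exists_equiv_of_back_and_forth (n := fun γ : {γ // δ ≤ γ} => N γ.1)
      (fun α β => 𝒯.condensed.total_above α.2 β.2)
      (fun (t : {t // 𝒯.orb t = δ}) γ => Z.coord t.1 γ.1) (fun (y : FinSeq N δ) γ => y.1 γ.1)
      (fun t γ => Z.coord_lt _ _) (fun y γ => y.2.1 _) ?_ ?_ ?_ ?_
    · rintro ⟨t, rfl⟩ ⟨t', ht'⟩ hne
      obtain ⟨γ, hγ, h₁, h₂⟩ := hdiff t t' ht'.symm fun e => hne (Subtype.ext e)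
      exact ⟨⟨γ, hγ⟩, h₁, fun β hβ => h₂ β.1 hβ⟩
    · intro y y' hne
      have hfin : {γ : {γ // δ ≤ γ} | y.1 γ.1 ≠ y'.1 γ.1}.Finite := by
        refine Set.Finite.of_finite_image (f := Subtype.val)
          ((y.2.2.2.union y'.2.2.2).subset ?_) Subtype.val_injective.injOn
        rintro _ ⟨γ, hγ, rfl⟩
        by_contra hcon
        simp only [Set.mem_union, Set.mem_ofPred_eq, not_or, not_not] at hcon
        exact hγ (hcon.1.trans hcon.2.symm)
      have hnonempty : {γ : {γ // δ ≤ γ} | y.1 γ.1 ≠ y'.1 γ.1}.Nonempty := by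
        by_contra hcon
        refine hne (Subtype.ext (funext fun γ => ?_))
        by_cases hγ : δ ≤ γ
        · by_contra h
          exact hcon ⟨⟨γ, hγ⟩, h⟩
        · rw [not_not.1 fun h => hγ (y.2.2.1 γ h), not_not.1 fun h => hγ (y'.2.2.1 γ h)]
      obtain ⟨γ, hγ⟩ := hfin.exists_maximal hnonempty
      refine ⟨γ, hγ.prop, fun β hβ => ?_⟩
      by_contra h
      exact absurd (hγ.le_of_ge h hβ.le) (not_le_of_gt hβ)
    · rintro ⟨t, rfl⟩ ⟨γ, hγ⟩ i hi
      obtain ⟨t', h₁, h₂, h₃⟩ := hpert t γ i hγ hi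
      exact ⟨⟨t', h₁⟩, h₂, fun β hβ => h₃ β.1 hβ⟩
    · rintro y ⟨γ, hγ⟩ i hi
      obtain ⟨w, h₁, h₂⟩ := exists_finSeq_update y hγ hi
      exact ⟨w, h₁, fun β hβ => h₂ β.1 fun e => hβ.ne' (Subtype.ext e)⟩
  choose e he using key
  have hcast : ∀ {t δ} (h : 𝒯.orb t = δ), (e δ ⟨t, h⟩).1 = (e (𝒯.orb t) ⟨t, rfl⟩).1 := by
    rintro t _ rfl
    rfl
  refine ⟨N, fun t => (e (𝒯.orb t) ⟨t, rfl⟩).1, hN, fun t => (e _ _).2.1, fun t => (e _ _).2.2.2,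
    fun t t' γ h hγ => ?_, fun δ w => ?_⟩
  · rw [← Z.coord_eq_iff t t' γ h hγ]
    have := he (𝒯.orb t) ⟨t, rfl⟩ ⟨t', h.symm⟩ ⟨γ, hγ⟩
    simp only [hcast h.symm] at this
    exact ⟨fun k β hβ => this.2 (fun β' hβ' => k β'.1 hβ') ⟨β, hγ.trans hβ⟩ hβ,
      fun k β hβ => this.1 (fun β' hβ' => k β'.1 hβ') ⟨β, hγ.trans hβ⟩ hβ⟩
  · refine ⟨((e δ).symm w).1, ((e δ).symm w).2, ?_⟩
    refine (hcast ((e δ).symm w).2).symm.trans ?_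
    exact congrArg Subtype.val ((e δ).apply_symm_apply w)

theorem exists_projSystem_LF [Nonempty T] [Countable T] (h𝒯 : 𝒯.IsLTree) (hp : 𝒯.IsPruned)
    (hs : 𝒯.IsSpecial) :
    ∃ (Δ : Type) (_ : PartialOrder Δ) (N : Δ → ℕ∞), IsCountableTreeableSkeleton Δ N ∧
      ∃ P : ProjSystem N, (∀ δ, P.S δ = admissibleLocal N (suppLF Δ) δ) ∧
        P.IsLocallyHomogeneous ∧ P.HasFiniteCharacter ∧ Nonempty (𝒯.aut ≃ₜ* P.wrSym) := by
  classical
  obtain ⟨N, y, hN, hy₁, hy₂, hy₃, hy₄⟩ := 𝒯.exists_orbit_coordinates h𝒯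
  have hΔ := 𝒯.isCountableTreeableSkeleton_condensed hp hs hN
  have := hΔ.countable
  have hpos : ∀ γ, ((0 : ℕ) : ℕ∞) < N γ := fun γ => by
    rw [Nat.cast_zero]
    exact pos_iff_ne_zero.2 (hN γ)
  -- the coordinates of an orbit are inherited from the first orbit below it
  obtain ⟨idx, hidx⟩ := exists_injective_nat 𝒯.Condensed
  have hbase : ∀ γ : 𝒯.Condensed, ∃ δ ≤ γ, ∀ δ' ≤ γ, idx δ ≤ idx δ' := fun γ =>
    exists_minimalFor_of_wellFoundedLT (· ≤ γ) idx ⟨γ, le_rfl⟩ |>.imp fun δ hδ =>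
      ⟨hδ.1, fun δ' hδ' => (le_total _ _).elim id fun h => hδ.2 hδ' h⟩
  choose base hbase₁ hbase₂ using hbase
  have hroot : ∀ t, ∃ s, s ≤ t ∧ 𝒯.orb s = base (𝒯.orb t) := fun t =>
    𝒯.exists_ge_of_le_orb (hbase₁ _)
  choose root hroot₁ hroot₂ using hroot
  -- The sequence of `root t` may be nonzero at orbits below `𝒯.orb t`; cutting it off there leaves
  -- a finitely supported sequence on the smaller cone. The choice of `root t` below `t` does not
  -- affect the result, since any two candidates agree from `𝒯.orb t` upwards.
  let c : T → 𝒯.Condensed → ℕ := fun t γ => if 𝒯.orb t ≤ γ then y (root t) γ else 0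
  have hc : ∀ {t γ}, 𝒯.orb t ≤ γ → c t γ = y (root t) γ := fun h => if_pos h
  have hc₀ : ∀ t γ, c t γ ≠ 0 → 𝒯.orb t ≤ γ := fun t γ h => by
    by_contra hcon
    exact h (if_neg hcon)
  have hc_lt : ∀ t γ, (c t γ : ℕ∞) < N γ := fun t γ => by
    by_cases h : 𝒯.orb t ≤ γ
    · rw [hc h]; exact hy₁ _ _
    · rw [show c t γ = 0 from if_neg h]; exact hpos γ
  have hc_fin : ∀ t, {γ | c t γ ≠ 0}.Finite := fun t => (hy₂ (root t)).subset fun γ h => by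
    have h' : c t γ ≠ 0 := h
    rw [hc (hc₀ t γ h)] at h'
    exact h'
  have hc_root : ∀ {s t}, s ≤ t → 𝒯.orb s = base (𝒯.orb t) → ∀ γ, 𝒯.orb t ≤ γ →
      c t γ = y s γ := by
    intro s t hst hs γ hγ
    rw [hc hγ]
    exact (hy₃ (root t) s (𝒯.orb t) ((hroot₂ t).trans hs.symm) (𝒯.orb_mono (hroot₁ t))).2
      ⟨t, rfl, hroot₁ t, hst⟩ γ hγ
  have hc_agree : ∀ t t' γ, 𝒯.orb t = 𝒯.orb t' → 𝒯.orb t ≤ γ →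
      ((∀ β, γ ≤ β → c t β = c t' β) ↔ 𝒯.AgreeOn t t' γ) := by
    intro t t' γ h hγ
    have h' : 𝒯.orb (root t) = 𝒯.orb (root t') := by rw [hroot₂, hroot₂, h]
    rw [← agreeOn_congr (hroot₁ t) (hroot₁ t') hγ (h ▸ hγ),
      ← hy₃ _ _ γ h' ((𝒯.orb_mono (hroot₁ t)).trans hγ)]
    refine forall₂_congr fun β hβ => ?_
    rw [hc (hγ.trans hβ), hc (h ▸ hγ.trans hβ)]
  have hc_surj : ∀ δ (w : FinSeq N δ), ∃ t, 𝒯.orb t = δ ∧ c t = w.1 := by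
    intro δ w
    -- A sequence on the cone of `δ` is also one on the larger cone of `base δ`. It is realized
    -- there by some `s`, and then by the node above `s` in `δ`.
    obtain ⟨s, hs, hsw⟩ := hy₄ (base δ) ⟨w.1, w.2.1, fun γ h => (hbase₁ δ).trans (w.2.2.1 γ h),
      w.2.2.2⟩
    obtain ⟨t, hst, rfl⟩ := 𝒯.exists_le_of_orb_le (hs.trans_le (hbase₁ δ))
    refine ⟨t, rfl, funext fun γ => ?_⟩
    by_cases hγ : 𝒯.orb t ≤ γ
    · rw [hc_root hst hs γ hγ, hsw]
    · rw [show c t γ = 0 from if_neg hγ, not_not.1 fun h => hγ (w.2.2.1 γ h)]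
  let Z : 𝒯.Coordinates N :=
    { coord := c
      coord_lt := hc_lt
      coord_eq_iff := hc_agree
      exists_perturb := fun t i hi => by
        obtain ⟨w, hw₁, hw₂⟩ := exists_finSeq_update (δ := 𝒯.orb t)
          ⟨c t, hc_lt t, hc₀ t, hc_fin t⟩ le_rfl hi
        obtain ⟨t', h₁, h₂⟩ := hc_surj (𝒯.orb t) w
        exact ⟨t', h₁, (congrFun h₂ _).trans hw₁,
          fun γ hγ => (congrFun h₂ γ).trans (hw₂ γ hγ.ne')⟩ }
  have hproj : ∀ {t u : T} (_ : t ≤ u) (hle : 𝒯.orb t ≤ 𝒯.orb u) (ht hu),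
      Z.toProjSystem.proj hle ⟨Z.loc t (𝒯.orb t), ht⟩ = ⟨Z.loc u (𝒯.orb u), hu⟩ :=
    fun htu hle _ _ => Z.proj_loc htu rfl rfl hle
  obtain ⟨e, he₁, he₂⟩ := Z.exists_equiv_point Z.toProjSystem rfl hproj
  refine ⟨𝒯.Condensed, inferInstance, N, hΔ, Z.toProjSystem, fun δ => ?_, fun δ z w => ?_,
    fun δ => ?_, nonempty_continuousMulEquiv_of_equiv e he₂⟩
  · ext z
    constructor
    · rintro ⟨t, -, rfl⟩
      exact ⟨fun γ => ⟨c t γ, hc_lt t γ⟩, fun β => (hc_fin t).subset Set.inter_subset_left,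
        fun _ => rfl⟩
    · rintro ⟨x, hx, hzx⟩
      obtain ⟨t, ht, hct⟩ := hc_surj δ ⟨fun γ => if δ ≤ γ then (x γ).1 else 0, fun γ => by
          beta_reduce
          split_ifs
          exacts [(x γ).2, hpos γ],
        fun γ h => by
          by_contra hcon
          exact h (if_neg hcon),
        (hx δ).subset fun γ h => by
          by_cases hγ : δ ≤ γ
          · rw [Set.mem_ofPred_eq] at h
            beta_reduce at h
            rw [if_pos hγ] at h
            exact ⟨h, hγ⟩
          · exact absurd (if_neg hγ) h⟩
      refine ⟨t, ht, funext fun γ => Subtype.ext ?_⟩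
      change (z γ).1 = c t γ.1
      rw [hct, hzx]
      exact (if_pos γ.2).symm
  -- The set `S δ` corresponds to a single orbit of the automorphism group, on which that group is
  -- transitive by definition.
  · obtain ⟨t, ht⟩ := e.surjective ⟨δ, z⟩
    obtain ⟨u, hu⟩ := e.surjective ⟨δ, w⟩
    obtain ⟨_, ht'⟩ := he₁ t
    obtain ⟨_, hu'⟩ := he₁ u
    have h₁ : 𝒯.orb t = δ := congrArg Sigma.fst (ht'.symm.trans ht)
    have h₂ : 𝒯.orb u = δ := congrArg Sigma.fst (hu'.symm.trans hu)
    obtain ⟨f, hf, hfu⟩ := 𝒯.orb_eq_iff.1 (h₁.trans h₂.symm)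
    refine ⟨_, (he₂ f).1 hf, ?_⟩
    rw [← ht, ← hu, ← hfu]
    simp
  -- The cone is partitioned by the base, whose index is at most `idx δ`. Going up, more orbits lie
  -- below and the index can only decrease, so the parts are convex. Within a part all coordinates
  -- come from the same base orbit, so the projections are restrictions.
  · refine ⟨idx δ + 1, fun k => {γ | δ ≤ γ ∧ idx (base γ) = k}, ?_, ?_, fun k => ⟨⟨?_⟩, ?_⟩⟩
    · ext γ
      simp only [Set.mem_iUnion, Set.mem_ofPred_eq, Set.mem_Ici]
      exact ⟨fun ⟨_, h, _⟩ => h, fun h =>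
        ⟨⟨idx (base γ), Nat.lt_succ_of_le (hbase₂ γ δ h)⟩, h, rfl⟩⟩
    · intro k k' hkk
      refine Set.disjoint_left.2 fun γ h h' => hkk (Fin.ext ?_)
      exact h.2.symm.trans h'.2
    · rintro γ ⟨h₁, h₂⟩ γ'' ⟨h₃, h₄⟩ γ' ⟨h₅, h₆⟩
      refine ⟨h₁.trans h₅, le_antisymm ?_ ?_⟩
      · rw [← h₂]
        exact hbase₂ _ _ ((hbase₁ γ).trans h₅)
      · rw [← h₄]
        exact hbase₂ _ _ ((hbase₁ γ').trans h₆)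
    · rintro γ ⟨h₁, h₂⟩ β ⟨h₃, h₄⟩ h ⟨_, t, rfl, rfl⟩
      obtain ⟨u, htu, rfl⟩ := 𝒯.exists_le_of_orb_le h
      refine (congrArg Subtype.val (hproj htu h ⟨t, rfl, rfl⟩ ⟨u, rfl, rfl⟩)).trans ?_
      have hb : base (𝒯.orb t) = base (𝒯.orb u) := hidx (h₂.trans h₄.symm)
      refine funext fun ε => Subtype.ext ?_
      change c u ε.1 = c t ε.1
      rw [hc_root ((hroot₁ t).trans htu) ((hroot₂ t).trans hb) ε.1 ε.2, hc (h.trans ε.2)]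

end WeakLTree

/-! ### The equivalences -/

theorem mainTheorem1 {G : Type*} [Group G] [TopologicalSpace G] [IsTopologicalGroup G] :
    List.TFAE [
      ∃ (U : Type) (_ : MetricSpace U), IsPolishUltrametric U ∧ Nonempty (G ≃ₜ* (U ≃ᵢ U)),
      ∃ (U : Type) (_ : MetricSpace U), IsPolishUltrametric U ∧ PerfectSpace U ∧
        LocallyCompactSpace U ∧ Nonempty (G ≃ₜ* (U ≃ᵢ U)),
      ∃ (U : Type) (_ : MetricSpace U), IsPolishUltrametric U ∧ IsUniformlyDiscrete U ∧
        Nonempty (G ≃ₜ* (U ≃ᵢ U)),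
      ∃ (L T : Type) (_ : LinearOrder L) (_ : PartialOrder T) (𝒯 : WeakLTree L T),
        𝒯.IsLTree ∧ Countable T ∧ 𝒯.IsPruned ∧ Nonempty (G ≃ₜ* 𝒯.aut),
      ∃ (L T : Type) (_ : LinearOrder L) (_ : PartialOrder T) (𝒯 : WeakLTree L T),
        (∃ m : L, IsBot m) ∧ 𝒯.IsLTree ∧ Countable T ∧ 𝒯.IsPruned ∧ 𝒯.IsSpecial ∧
        Nonempty (G ≃ₜ* 𝒯.aut),
      ∃ (T : Type) (_ : PartialOrder T) (𝒯 : WeakLTree ℚ T),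
        𝒯.IsLTree ∧ Countable T ∧ 𝒯.IsPruned ∧ 𝒯.IsSpecial ∧ Nonempty (G ≃ₜ* 𝒯.aut),
      ∃ (Δ : Type) (_ : PartialOrder Δ) (N : Δ → ℕ∞), IsCountableTreeableSkeleton Δ N ∧
        ∃ P : ProjSystem N, (∀ δ, P.S δ = admissibleLocal N (suppLF Δ) δ) ∧
          P.IsLocallyHomogeneous ∧ P.HasFiniteCharacter ∧ Nonempty (G ≃ₜ* P.wrSym),
      ∃ (Δ : Type) (_ : PartialOrder Δ) (N : Δ → ℕ∞), IsCountableTreeableSkeleton Δ N ∧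
        ∃ D : LocalDomains N, (∀ δ, D.S δ ⊆ admissibleLocal N (suppMax Δ) δ) ∧
          Countable ((δ : Δ) × D.S δ) ∧ Nonempty (G ≃ₜ* D.wrSym),
      ∃ (Δ : Type) (_ : PartialOrder Δ) (N : Δ → ℕ∞), IsCountableTreeableSkeleton Δ N ∧
        ∃ P : ProjSystem N, (∀ δ, P.S δ ⊆ admissibleLocal N (suppMax Δ) δ) ∧
          Countable ((δ : Δ) × P.S δ) ∧ Nonempty (G ≃ₜ* P.wrSym)] := by
  tfae_have 2 → 1 := fun ⟨U, i, h, _, _, e⟩ => ⟨U, i, h, e⟩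
  tfae_have 3 → 1 := fun ⟨U, i, h, _, e⟩ => ⟨U, i, h, e⟩
  tfae_have 5 → 4 := fun ⟨L, T, i, j, 𝒯, _, h₁, h₂, h₃, _, e⟩ => ⟨L, T, i, j, 𝒯, h₁, h₂, h₃, e⟩
  tfae_have 6 → 4 := fun ⟨T, j, 𝒯, h₁, h₂, h₃, _, e⟩ => ⟨ℚ, T, inferInstance, j, 𝒯, h₁, h₂, h₃, e⟩
  tfae_have 4 → 3 := by
    rintro ⟨L, T, _, _, 𝒯, h₁, h₂, -, ⟨e⟩⟩
    obtain ⟨U, i, h₃, h₄, ⟨e'⟩⟩ := 𝒯.exists_uniformlyDiscrete h₁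
    exact ⟨U, i, h₃, h₄, ⟨e.trans e'⟩⟩
  tfae_have 9 → 3 := by
    rintro ⟨Δ, _, N, h₁, P, h₂, h₃, ⟨e⟩⟩
    obtain ⟨U, i, h₄, h₅, ⟨e'⟩⟩ := P.exists_uniformlyDiscrete h₁ h₂
    exact ⟨U, i, h₄, h₅, ⟨e.trans e'⟩⟩
  tfae_have 3 → 2 := by
    rintro ⟨V, _, h₁, h₂, ⟨e⟩⟩
    obtain ⟨U, i, h₃, h₄, h₅, ⟨e'⟩⟩ := exists_perfect_locallyCompact V h₁ h₂
    exact ⟨U, i, h₃, h₄, h₅, ⟨e.trans e'⟩⟩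
  tfae_have 1 → 6 := by
    rintro ⟨U, _, h₁, ⟨e⟩⟩
    obtain ⟨T, i, 𝒯, h₂, h₃, h₄, h₅, ⟨e'⟩⟩ := BallTree.exists_special_rat_tree h₁
    exact ⟨T, i, 𝒯, h₂, h₃, h₄, h₅, ⟨e.trans e'⟩⟩
  tfae_have 3 → 5 := by
    rintro ⟨U, _, h₁, h₁', ⟨e⟩⟩
    obtain ⟨L, T, i, j, 𝒯, h₂, h₃, h₄, h₅, h₆, ⟨e'⟩⟩ :=
      BallTree.exists_special_tree_with_bot h₁ h₁'
    exact ⟨L, T, i, j, 𝒯, h₂, h₃, h₄, h₅, h₆, ⟨e.trans e'⟩⟩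
  tfae_have 6 → 7 := by
    rintro ⟨T, _, 𝒯, h₁, h₂, h₃, h₄, ⟨e⟩⟩
    have : Nonempty T := ⟨(𝒯.lam_surjective 0).choose⟩
    obtain ⟨Δ, i, N, h₅, P, h₆, h₇, h₈, ⟨e'⟩⟩ := 𝒯.exists_projSystem_LF h₁ h₃ h₄
    exact ⟨Δ, i, N, h₅, P, h₆, h₇, h₈, ⟨e.trans e'⟩⟩
  tfae_have 6 → 8 := by
    rintro ⟨T, _, 𝒯, h₁, h₂, h₃, h₄, ⟨e⟩⟩
    have : Nonempty T := ⟨(𝒯.lam_surjective 0).choose⟩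
    obtain ⟨Δ, i, N, h₅, D, h₆, h₇, ⟨e'⟩⟩ := 𝒯.exists_localDomains h₁ h₃ h₄
    exact ⟨Δ, i, N, h₅, D, h₆, h₇, ⟨e.trans e'⟩⟩
  tfae_have 7 → 9 := by
    rintro ⟨Δ, i, N, h₁, P, h₂, -, -, e⟩
    refine ⟨Δ, i, N, h₁, P, fun δ => ?_, ?_, e⟩
    · rw [h₂]
      exact admissibleLocal_mono N (suppLF_subset_suppMax Δ) δ
    · have := h₁.countable
      have : ∀ δ, Countable (P.S δ) := fun δ => by
        rw [h₂]
        exact countable_admissibleLocal_suppLF N δ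
      infer_instance
  tfae_have 8 → 9 := fun ⟨Δ, i, N, h₁, D, h₂, h₃, e⟩ => ⟨Δ, i, N, h₁, D.toProjSystem, h₂, h₃, e⟩
  tfae_finish
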